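/- A \emph{quantum oracle} is an infinite collection $U=\{U_m\}$ of unitary transformations, $U_m$ acting on $m$ qubits. A \emph{quantum circuit with access to $U$} is a circuit over the universal basis $\{H,T,\mathrm{CNOT}\}$ that may also apply, as a single gate, any $U_m$ or $U_m^{-1}$, or their controlled versions, to any of its wires; it may use ancilla qubits initialized to $|0\rangle$ and discard qubits at the end, and its size is its number of wires plus its number of gates. Circuit families are nonuniform. A \emph{public-key quantum money scheme relative to $U$} consists, for every key size $n$, of two circuits of size $\mathrm{poly}(n)$ with access to $U$: a bank $B$, which takes a secret key $s\in\{0,1\}^n$ and outputs a classical string $e_s$ (the public key) together with a mixed state $\rho_s$ (the banknote); and an authenticator $A$, which takes a string $e$ and a state $\rho$ and either accepts or rejects. It has \emph{perfect completeness} if $A(e_s,\rho_s)$ accepts with probability $1$ for all $n$ and $s\in\{0,1\}^n$. It has \emph{soundness error} $\delta=\delta(n)$ if, for all polynomially bounded $k=k(n)$, $r=r(n)$ and all families $C$ of circuits of size $\mathrm{poly}(n)$ with access to the same $U$ (the counterfeiters) that take $e_s$ and $\rho_s^{\otimes k}$ as input and output a state $\sigma_s$ on $k+r$ registers, each of the size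 of a banknote, one has for all sufficiently large $n$ \[ \sum_{i=1}^{k+r}p_i\le k+\delta(n),\qquad p_i=\frac1{2^n}\sum_{s\in\{0,1\}^n}\Pr\bigl[A(e_s,\sigma_s^i)\text{ accepts}\bigr], \] where $\sigma_s^i$ is the reduced state of the $i$-th register of $\sigma_s$. \textbf{Theorem.} There exists a quantum oracle $U$ relative to which there is a public-key quantum money scheme with perfect completeness and negligible soundness error, that is, with soundness error $\delta$ for some function $\delta(n)$ that is $o(1/p(n))$ for every polynomial $p$. The bank, the authenticators and the counterfeiters all have the same access to $U$. -/

import Mathlib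

noncomputable section

namespace QuantumMoney

/-! ## States of finitely many qubits -/

/-- Operators on the space of qubits labelled by `ι`, as matrices in the computational basis.
A (mixed) state is a density matrix of this kind. -/
abbrev Op (ι : Type) : Type := Matrix (ι → Bool) (ι → Bool) ℂ

/-- The projector `|x⟩⟨x|` on a computational basis state. -/
def basisState {ι : Type} [Fintype ι] [DecidableEq ι] (x : ι → Bool) : Op ι :=
  Matrix.single x x 1

/-- The tensor product of a state of the qubits `ι` and a state of the qubits `κ`. -/
def tensor {ι κ : Type} (ρ : Op ι) (σ : Op κ) : Op (ι ⊕ κ) :=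
  Matrix.of fun a b => ρ (a ∘ Sum.inl) (b ∘ Sum.inl) * σ (a ∘ Sum.inr) (b ∘ Sum.inr)

/-- The `k`-fold tensor power; the `j`-th copy lives on the qubits `(j, i)`, `i : ι`. -/
def tensorPow {ι : Type} (k : ℕ) (ρ : Op ι) : Op (Fin k × ι) :=
  Matrix.of fun a b => ∏ j : Fin k, ρ (fun i => a (j, i)) (fun i => b (j, i))

/-- The operator that applies `G` to the qubits selected by `w` and the identity to the others. -/
def onWires {ι κ : Type} [Fintype ι] [DecidableEq ι] [Fintype κ]
    (w : κ ↪ ι) (G : Op κ) : Op ι :=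
  Matrix.of fun a b =>
    if ∀ i, (∀ j, w j ≠ i) → a i = b i then G (a ∘ w) (b ∘ w) else 0

/-- If qubit `c` is `1`, apply `G`; if it is `0`, do nothing.
(Used for `G` acting on qubits other than `c`.) -/
def controlled {ι : Type} [Fintype ι] [DecidableEq ι] (c : ι) (G : Op ι) : Op ι :=
  Matrix.of fun a b => if a c then G a b else (1 : Op ι) a b

/-- The reduced state on the qubits selected by `w`: the partial trace over all other qubits. -/
def reduce {ι κ : Type} [Fintype ι] [DecidableEq ι] [Fintype κ] [DecidableEq κ]
    (w : κ ↪ ι) (ρ : Op ι) : Op κ :=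
  Matrix.of fun x y => ∑ a : ι → Bool, ∑ b : ι → Bool,
    if a ∘ w = x ∧ b ∘ w = y ∧ ∀ i, (∀ j, w j ≠ i) → a i = b i then ρ a b else 0

/-! ## Quantum oracles and quantum circuits with oracle gates -/

/-- A quantum oracle: an infinite collection of unitary transformations, with one
transformation on `m` qubits for every `m`. -/
abbrev QuantumOracle : Type := (m : ℕ) → Matrix.unitaryGroup (Fin m → Bool) ℂ

/-- The Hadamard gate. -/
def hadamardMatrix : Op Unit :=
  Matrix.of fun a b => (if a () && b () then -1 else 1) / (Real.sqrt 2 : ℂ)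

/-- The gate `diag(1, exp(iπ/4))`. -/
def tMatrix : Op Unit :=
  Matrix.diagonal fun a => if a () then Complex.exp (Complex.I * Real.pi / 4) else 1

/-- The NOT gate. -/
def notMatrix : Op Unit :=
  Matrix.of fun a b => if a () = b () then 0 else 1

/-- The embedding that selects a single qubit. -/
def wire {ι : Type} (i : ι) : Unit ↪ ι := ⟨fun _ => i, fun _ _ _ => rfl⟩

/-- Gates on the wires `ι`: the universal basis Hadamard, `T`, CNOT, together with oracle gates.
An oracle gate applies the `m`-qubit oracle transformation or its inverse to any `m` distinct
wires, possibly controlled by a further wire. -/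
inductive Gate (ι : Type) : Type
  | hadamard (i : ι)
  | t (i : ι)
  | cnot (c i : ι) (h : i ≠ c)
  | oracle (inverse : Bool) (m : ℕ) (w : Fin m ↪ ι)
  | controlledOracle (inverse : Bool) (c : ι) (m : ℕ) (w : Fin m ↪ ι) (h : ∀ j, w j ≠ c)

/-- The oracle transformation on `m` qubits, or its inverse. -/
def QuantumOracle.call (U : QuantumOracle) (inverse : Bool) (m : ℕ) : Op (Fin m) :=
  if inverse then ((U m)⁻¹ : Matrix.unitaryGroup (Fin m → Bool) ℂ) else U m

/-- The unitary transformation carried out by a gate, given the oracle. -/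
def Gate.toOp {ι : Type} [Fintype ι] [DecidableEq ι] (U : QuantumOracle) : Gate ι → Op ι
  | .hadamard i => onWires (wire i) hadamardMatrix
  | .t i => onWires (wire i) tMatrix
  | .cnot c i _ => controlled c (onWires (wire i) notMatrix)
  | .oracle inverse m w => onWires w (U.call inverse m)
  | .controlledOracle inverse c m w _ => controlled c (onWires w (U.call inverse m))

/-- A quantum circuit with input qubits `I` and output qubits `O`: `ancillas` further qubits that
start in `|0⟩`, a list of gates (applied from the first to the last), and a choice of distinct
output wires.  The remaining wires are discarded. -/
structure QCircuit (I O : Type) : Type where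
  ancillas : ℕ
  gates : List (Gate (I ⊕ Fin ancillas))
  out : O ↪ I ⊕ Fin ancillas

/-- The size of a circuit: its number of wires plus its number of gates. -/
def QCircuit.size {I O : Type} [Fintype I] (C : QCircuit I O) : ℕ :=
  Fintype.card I + C.ancillas + C.gates.length

/-- The product of the gates of a circuit. -/
def QCircuit.unitary {I O : Type} [Fintype I] [DecidableEq I] (U : QuantumOracle)
    (C : QCircuit I O) : Op (I ⊕ Fin C.ancillas) :=
  C.gates.foldl (fun V g => g.toOp U * V) 1

/-- The output state of the circuit on the input state `ρ`. -/
def QCircuit.run {I O : Type} [Fintype I] [DecidableEq I] [Fintype O] [DecidableEq O]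
    (U : QuantumOracle) (C : QCircuit I O) (ρ : Op I) : Op O :=
  reduce C.out
    (C.unitary U * tensor ρ (basisState fun _ => false) * (C.unitary U).conjTranspose)

/-- The probability that a measurement of the output bit of the circuit yields `1`. -/
def QCircuit.acceptProb {I : Type} [Fintype I] [DecidableEq I]
    (U : QuantumOracle) (C : QCircuit I Unit) (ρ : Op I) : ℝ :=
  (C.run U ρ (fun _ => true) (fun _ => true)).re

/-- `f n = O(poly(n))`. -/
def PolyBounded (f : ℕ → ℕ) : Prop :=
  ∃ p : Polynomial ℕ, ∀ n, f n ≤ p.eval n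

/-- `δ` is negligible: `δ n = o(1 / p n)` for every polynomial `p`. -/
def Negligible (δ : ℕ → ℝ) : Prop :=
  Asymptotics.SuperpolynomialDecay Filter.atTop (fun n : ℕ => (n : ℝ)) δ

/-! ## Quantum money -/

/-- A quantum money scheme relative to the oracle `U`, one bank and one authenticator for each
key size `n`.  On the secret key `s`, the bank outputs the classical string `publicKey n s`
together with the state `note n s`. -/
structure MoneyScheme (U : QuantumOracle) where
  /-- length of the public key -/
  keyLen : ℕ → ℕ
  /-- number of qubits of a banknote -/
  noteLen : ℕ → ℕ
  bank : (n : ℕ) → QCircuit (Fin n) (Fin (keyLen n) ⊕ Fin (noteLen n))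
  auth : (n : ℕ) → QCircuit (Fin (keyLen n) ⊕ Fin (noteLen n)) Unit
  bank_poly : PolyBounded fun n => (bank n).size
  auth_poly : PolyBounded fun n => (auth n).size
  publicKey : (n : ℕ) → (Fin n → Bool) → (Fin (keyLen n) → Bool)
  note : (n : ℕ) → (Fin n → Bool) → Op (Fin (noteLen n))
  bank_output : ∀ n s,
    (bank n).run U (basisState s) = tensor (basisState (publicKey n s)) (note n s)

namespace MoneyScheme

variable {U : QuantumOracle}

/-- The probability that the authenticator accepts the state `σ` as a banknote for the
public key `e`. -/
def acceptProb (M : MoneyScheme U) (n : ℕ) (e : Fin (M.keyLen n) → Bool)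
    (σ : Op (Fin (M.noteLen n))) : ℝ :=
  (M.auth n).acceptProb U (tensor (basisState e) σ)

/-- Completeness error `ε`: every banknote is accepted with probability at least `1 - ε n`. -/
def HasCompletenessError (M : MoneyScheme U) (ε : ℕ → ℝ) : Prop :=
  ∀ n s, 1 - ε n ≤ M.acceptProb n (M.publicKey n s) (M.note n s)

/-- A public-key counterfeiter for key size `n`: a circuit that receives the public key and `k`
banknotes and outputs `k + r` registers, each of the size of a banknote. -/
abbrev Counterfeiter (M : MoneyScheme U) (n k r : ℕ) : Type :=
  QCircuit (Fin (M.keyLen n) ⊕ (Fin k × Fin (M.noteLen n))) (Fin (k + r) × Fin (M.noteLen n))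

/-- The state of the `k + r` registers output by the counterfeiter for the secret key `s`. -/
def forged (M : MoneyScheme U) {n k r : ℕ} (C : M.Counterfeiter n k r) (s : Fin n → Bool) :
    Op (Fin (k + r) × Fin (M.noteLen n)) :=
  C.run U (tensor (basisState (M.publicKey n s)) (tensorPow k (M.note n s)))

/-- The probability, averaged over all secret keys, that the authenticator accepts the `i`-th
output register of the counterfeiter. -/
def passProb (M : MoneyScheme U) {n k r : ℕ} (C : M.Counterfeiter n k r) (i : Fin (k + r)) : ℝ :=
  (∑ s : Fin n → Bool, M.acceptProb n (M.publicKey n s)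
    (reduce (Function.Embedding.sectR i (Fin (M.noteLen n))) (M.forged C s))) / 2 ^ n

/-- Public-key soundness error `δ`: for all polynomially bounded `k` and `r` and every family of
polynomial-size counterfeiters with access to the same oracle, the expected number of accepted
registers is at most `k + δ` once the key size is large enough. -/
def HasPublicKeySoundnessError (M : MoneyScheme U) (δ : ℕ → ℝ) : Prop :=
  ∀ k r : ℕ → ℕ, PolyBounded k → PolyBounded r →
    ∀ C : (n : ℕ) → M.Counterfeiter n (k n) (r n), PolyBounded (fun n => (C n).size) →
      ∀ᶠ n in Filter.atTop, ∑ i, M.passProb (C n) i ≤ (k n : ℝ) + δ n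

end MoneyScheme

end QuantumMoney

end

/-! The oracle carries random data at every level `d`; write `q = 2 ^ d`. A secret key names a block
(a row and a column) and a location in it. The random table of the block turns the location into a
tag, the public key is the block together with the tag, and the banknote is the phase state with
amplitudes proportional to `(-1)^f(x)`, where `f` is the random function attached to the public key.
Bank gates compute public key and note from the secret key; verification gates flip a flag exactly
on the right phase state. Completeness is immediate. Soundness has three layers.

No cloning with verification queries. If no secret key leads to the public key, a circuit depends on
`f` only through its `k` input copies and the projection onto the phase state. As a function of `f`,
the joint state is a combination of characters of the group of Boolean functions. With `k` copies
their degree is at most `k`, and up to an error of order `√(k / 2 ^ (12 d))` the projection only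
exchanges one element of the index set for another (`l2_shiftProj_sub_keepProj_le`), so the degree
stays at most `k`. A register that passes the projection is maximally entangled with one of the at
most `k` elements, and by monogamy disjoint registers hardly share one (`sum_nsq_pairOverlap_le`).
So about `k` registers can pass (`sum_nsq_phaseProj_le`, `expect_forgedCount_le`). To reach this
situation, the tag of the secret location is replaced by a fresh one; a hybrid argument shows that a
small circuit hardly notices (`expect_blockCount_le`).

Concentration. Counterfeiters are nonuniform and may depend on the oracle, so a union bound over
about `exp (q ^ 4)` circuits is needed, and an expectation bound is too weak. One random block is
chosen in each row, and for the count of one chosen block the chosen blocks of all other rows are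
blanked, which again a small circuit hardly notices. Given the unchosen blocks, the counts of the
chosen ones are independent, and a Chernoff bound makes failure as unlikely as `exp (-q ^ 8 / 16)`
(`expect_indicator_forgedCount_le`).

One oracle for all levels. The failure probabilities sum to less than `1`, uniformly in the data of
the other levels, and each failure event depends on finitely many levels. Compactness of a product
of finite sets yields a world without failures (`exists_forall_not`, `exists_unforgeable`). The
soundness error is `4 / 2 ^ d` with `d = n / 28`, and every polynomial size is eventually below `2 ^
d`. -/

noncomputable section

namespace QuantumMoney

open Finset BigOperators

set_option linter.unusedSectionVars false

section

/-! ## Splicing assignments -/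

section Splice

variable {ι κ μ β : Type}

/-- `splice u y a` overwrites the entries of `a` selected by `u` with `y`. -/
def splice (u : κ ↪ ι) (y : κ → β) (a : ι → β) : ι → β := Function.extend u y a

@[simp] lemma splice_apply (u : κ ↪ ι) (y : κ → β) (a : ι → β) (j : κ) :
    splice u y a (u j) = y j := u.injective.extend_apply _ _ _

@[simp] lemma splice_comp (u : κ ↪ ι) (y : κ → β) (a : ι → β) : splice u y a ∘ u = y := by
  ext j; simp

lemma splice_of_not_mem (u : κ ↪ ι) (y : κ → β) (a : ι → β) {i : ι} (h : ∀ j, u j ≠ i) :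
    splice u y a i = a i := Function.extend_apply' _ _ _ (by rintro ⟨j, hj⟩; exact h j hj)

lemma splice_comp_of_disjoint (u : κ ↪ ι) (w : μ → ι) (h : ∀ j k, u j ≠ w k)
    (y : κ → β) (a : ι → β) : splice u y a ∘ w = a ∘ w := by
  ext k; exact splice_of_not_mem u y a fun j => h j k

lemma eq_splice {u : κ ↪ ι} {y : κ → β} {a b : ι → β} (h1 : ∀ j, b (u j) = y j)
    (h2 : ∀ i, (∀ j, u j ≠ i) → b i = a i) : b = splice u y a := by
  ext i
  by_cases h : ∃ j, u j = i
  · obtain ⟨j, rfl⟩ := h; simp [h1]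
  · push Not at h; rw [splice_of_not_mem _ _ _ h, h2 i h]

@[simp] lemma splice_self (u : κ ↪ ι) (a : ι → β) : splice u (a ∘ u) a = a :=
  (eq_splice (fun _ => rfl) fun _ _ => rfl).symm

@[simp] lemma splice_splice (u : κ ↪ ι) (y z : κ → β) (a : ι → β) :
    splice u y (splice u z a) = splice u y a :=
  eq_splice (by simp) fun i hi => by rw [splice_of_not_mem _ _ _ hi, splice_of_not_mem _ _ _ hi]

lemma splice_trans (u : κ ↪ ι) (w : μ ↪ κ) (z : μ → β) (y : κ → β) (a : ι → β) :
    splice u (splice w z y) a = splice (w.trans u) z (splice u y a) := by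
  refine eq_splice (by simp) fun i hi => ?_
  by_cases h' : ∃ j, u j = i
  · obtain ⟨j, rfl⟩ := h'
    simp only [splice_apply]
    exact splice_of_not_mem _ _ _ fun k hk => hi k (by simp [hk])
  · push Not at h'
    rw [splice_of_not_mem _ _ _ h', splice_of_not_mem _ _ _ h']

lemma splice_eq_iff (u : κ ↪ ι) (y : κ → β) (a b : ι → β) :
    b = splice u y a ↔ b ∘ u = y ∧ ∀ i, (∀ j, u j ≠ i) → a i = b i := by
  constructor
  · rintro rfl; exact ⟨by simp, fun i hi => (splice_of_not_mem _ _ _ hi).symm⟩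
  · rintro ⟨h1, h2⟩; exact eq_splice (fun j => congrFun h1 j) fun i hi => (h2 i hi).symm

/-- Exchanging the entries selected by `u` with an independent assignment of them. -/
def spliceEquiv (u : κ ↪ ι) : ((ι → β) × (κ → β)) ≃ ((ι → β) × (κ → β)) :=
  Function.Involutive.toPerm (fun p => (splice u p.2 p.1, p.1 ∘ u)) fun p => by simp

variable [Fintype ι] [DecidableEq ι] [Fintype κ] [DecidableEq κ] [Fintype β]
  {M : Type} [AddCommMonoid M]

/-- Exchanging the entries at `u` with an independent assignment is an involution, so it permutes
the summands. Partial traces, register averages and the resampling of random data all come down to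
this identity. -/
lemma sum_splice_swap (u : κ ↪ ι) (F : (ι → β) → (κ → β) → M) :
    ∑ a, ∑ y, F a y = ∑ a, ∑ y, F (splice u y a) (a ∘ u) := by
  rw [← Fintype.sum_prod_type', ← Fintype.sum_prod_type']
  exact (Equiv.sum_comp (spliceEquiv u) fun p : (ι → β) × (κ → β) => F p.1 p.2).symm

lemma sum_sum_splice (u : κ ↪ ι) (F : (ι → β) → M) :
    ∑ a, ∑ y : κ → β, F (splice u y a) = Fintype.card (κ → β) • ∑ a, F a := by
  have := sum_splice_swap u (fun a (_ : κ → β) => F a)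
  rw [← this]; simp [Finset.smul_sum]

end Splice

/-! ### Uniform averages under resampling of some coordinates. -/

section Expect

variable {ι κ β : Type} [Fintype ι] [DecidableEq ι] [Fintype κ] [DecidableEq κ] [Fintype β]
  [Nonempty β]

lemma expect_expect_splice (u : κ ↪ ι) (F : (ι → β) → ℝ) :
    𝔼 a, 𝔼 y : κ → β, F (splice u y a) = 𝔼 a, F a := by
  simp only [Fintype.expect_eq_sum_div_card]
  rw [← Finset.sum_div, sum_sum_splice]
  have : (Fintype.card (κ → β) : ℝ) ≠ 0 := by exact_mod_cast Fintype.card_ne_zero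
  rw [nsmul_eq_mul]; field_simp

omit [Nonempty β] in
lemma expect_splice_swap (u : κ ↪ ι) (F : (ι → β) → (κ → β) → ℝ) :
    𝔼 a, 𝔼 y, F a y = 𝔼 a, 𝔼 y, F (splice u y a) (a ∘ u) := by
  simp only [Fintype.expect_eq_sum_div_card]
  rw [← Finset.sum_div, ← Finset.sum_div, sum_splice_swap u]

lemma expect_comp_splice (u : κ ↪ ι) (F : (κ → β) → ℝ) :
    𝔼 a : ι → β, F (a ∘ u) = 𝔼 y, F y := by
  have h := expect_splice_swap u (fun (a : ι → β) (y : κ → β) => F y)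
  simp only [Fintype.expect_const] at h
  exact h.symm

lemma expect_update (i : ι) (F : (ι → β) → ℝ) :
    𝔼 a, 𝔼 y, F (Function.update a i y) = 𝔼 a, F a := by
  rw [← expect_expect_splice (wire i) F]
  refine Finset.expect_congr rfl fun a _ => ?_
  rw [← Fintype.expect_equiv (Equiv.funUnique Unit β).symm _
    (fun y => F (splice (wire i) y a)) fun y => ?_]
  congr 1
  refine eq_splice (fun _ => Function.update_self i y a) fun k hk => ?_
  exact Function.update_of_ne (fun h => hk () h.symm) _ _

end Expect

/-! ## Euclidean norms of complex vectors -/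

section Norm

variable {α : Type} [Fintype α]

/-- The squared Euclidean norm. -/
def nsq (v : α → ℂ) : ℝ := ∑ a, ‖v a‖ ^ 2

/-- The Euclidean norm. -/
def l2 (v : α → ℂ) : ℝ := √(nsq v)

lemma nsq_nonneg (v : α → ℂ) : 0 ≤ nsq v := Finset.sum_nonneg fun _ _ => by positivity

lemma l2_nonneg (v : α → ℂ) : 0 ≤ l2 v := Real.sqrt_nonneg _

lemma l2_sq (v : α → ℂ) : l2 v ^ 2 = nsq v := Real.sq_sqrt (nsq_nonneg v)

lemma l2_eq_norm (v : α → ℂ) : l2 v = ‖(WithLp.toLp 2 v : EuclideanSpace ℂ α)‖ := by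
  rw [EuclideanSpace.norm_eq]; rfl

lemma l2_add_le (v w : α → ℂ) : l2 (v + w) ≤ l2 v + l2 w := by
  simp only [l2_eq_norm, WithLp.toLp_add]; exact norm_add_le _ _

lemma l2_sub_le (v w : α → ℂ) : l2 (v - w) ≤ l2 v + l2 w := by
  simp only [l2_eq_norm, WithLp.toLp_sub]; exact norm_sub_le _ _

lemma l2_le_of_nsq_le {v : α → ℂ} {c : ℝ} (hc : 0 ≤ c) (h : nsq v ≤ c ^ 2) : l2 v ≤ c :=
  Real.sqrt_le_iff.2 ⟨hc, h⟩

lemma l2_le_l2_add_sub (v w : α → ℂ) : l2 v ≤ l2 w + l2 (v - w) := by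
  simpa using l2_add_le w (v - w)

@[simp] lemma l2_zero : l2 (0 : α → ℂ) = 0 := by simp [l2, nsq]

lemma nsq_smul (c : ℂ) (v : α → ℂ) : nsq (c • v) = ‖c‖ ^ 2 * nsq v := by
  simp [nsq, Finset.mul_sum, mul_pow]

/-- The difference of squares factors as `(l2 v - l2 w) * (l2 v + l2 w)`, and the second factor is
at most `2`. -/
lemma nsq_le_nsq_add {v w : α → ℂ} {η : ℝ} (h : l2 (v - w) ≤ η) (hv : l2 v ≤ 1) (hw : l2 w ≤ 1) :
    nsq v ≤ nsq w + 2 * η := by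
  have h1 := l2_le_l2_add_sub v w
  rw [← l2_sq, ← l2_sq]
  nlinarith [l2_nonneg v, l2_nonneg w, l2_nonneg (v - w)]

/-- Cauchy–Schwarz for a finite sum of complex numbers. -/
lemma norm_sum_sq_le {β : Type} (s : Finset β) (f : β → ℂ) :
    ‖∑ x ∈ s, f x‖ ^ 2 ≤ s.card * ∑ x ∈ s, ‖f x‖ ^ 2 := by
  calc ‖∑ x ∈ s, f x‖ ^ 2 ≤ (∑ x ∈ s, ‖f x‖) ^ 2 := by gcongr; exact norm_sum_le _ _
    _ ≤ _ := sq_sum_le_card_mul_sum_sq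

end Norm

end

section

/-! ## Phase states and their Fourier description -/

/-- The sign `(-1)^b`. -/
def sgn (b : Bool) : ℂ := if b then -1 else 1

@[simp] lemma sgn_mul_self (b : Bool) : sgn b * sgn b = 1 := by cases b <;> simp [sgn]

@[simp] lemma norm_sgn (b : Bool) : ‖sgn b‖ = 1 := by cases b <;> simp [sgn]

@[simp] lemma star_sgn (b : Bool) : (starRingEnd ℂ) (sgn b) = sgn b := by cases b <;> simp [sgn]

section Characters

variable {X : Type} [Fintype X] [DecidableEq X]

/-- The characters of the group of all Boolean functions on `X`. -/
def chi (S : Finset X) (f : X → Bool) : ℂ := ∏ x ∈ S, sgn (f x)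

lemma chi_eq (S : Finset X) (f : X → Bool) :
    chi S f = ∏ x, if x ∈ S then sgn (f x) else 1 := by simp [chi]

@[simp] lemma chi_singleton (x : X) (f : X → Bool) : chi {x} f = sgn (f x) := by simp [chi]

@[simp] lemma star_chi (S : Finset X) (f : X → Bool) : (starRingEnd ℂ) (chi S f) = chi S f := by
  simp [chi, map_prod]

lemma chi_symmDiff (S T : Finset X) (f : X → Bool) :
    chi (symmDiff S T) f = chi S f * chi T f := by
  simp only [chi_eq, ← Finset.prod_mul_distrib]
  refine Finset.prod_congr rfl fun x _ => ?_
  by_cases h1 : x ∈ S <;> by_cases h2 : x ∈ T <;> simp [Finset.mem_symmDiff, h1, h2]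

lemma sum_chi (S : Finset X) :
    ∑ f, chi S f = if S = ∅ then (Fintype.card (X → Bool) : ℂ) else 0 := by
  split_ifs with h
  · subst h; simp [chi]
  · obtain ⟨x, hx⟩ := Finset.nonempty_iff_ne_empty.2 h
    have h1 : ∑ f, chi S f = ∏ x, ∑ b : Bool, if x ∈ S then sgn b else 1 := by
      rw [Finset.prod_univ_sum, Fintype.piFinset_univ]; simp only [chi_eq]
    rw [h1]
    refine Finset.prod_eq_zero (Finset.mem_univ x) ?_
    simp [hx, sgn]

lemma sum_chi_mul_chi (S T : Finset X) :
    ∑ f, chi S f * chi T f = if S = T then (Fintype.card (X → Bool) : ℂ) else 0 := by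
  simp only [← chi_symmDiff, sum_chi]
  congr 1
  exact propext symmDiff_eq_bot

/-- Parseval's identity, from the orthogonality of the characters. -/
lemma sum_norm_sq_chi (θ : Finset X → ℂ) :
    ∑ f, ‖∑ S, chi S f * θ S‖ ^ 2 = Fintype.card (X → Bool) * ∑ S, ‖θ S‖ ^ 2 := by
  have key : ∑ f, (∑ S, chi S f * θ S) * (starRingEnd ℂ) (∑ S, chi S f * θ S) =
      Fintype.card (X → Bool) * ∑ S, θ S * (starRingEnd ℂ) (θ S) := by
    simp only [map_sum, map_mul, star_chi, Finset.sum_mul_sum]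
    rw [Finset.sum_comm, Finset.mul_sum]
    refine Finset.sum_congr rfl fun S _ => ?_
    rw [Finset.sum_comm]
    have : ∀ T, ∑ f, chi S f * θ S * (chi T f * (starRingEnd ℂ) (θ T)) =
        (∑ f, chi S f * chi T f) * (θ S * (starRingEnd ℂ) (θ T)) := fun T => by
      rw [Finset.sum_mul]; exact Finset.sum_congr rfl fun f _ => by ring
    simp only [this, sum_chi_mul_chi, ite_mul, zero_mul, Finset.sum_ite_eq, Finset.mem_univ,
      if_true]
  simp only [Complex.mul_conj, Complex.normSq_eq_norm_sq] at key
  exact_mod_cast key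

lemma card_symmDiff_singleton_le (S : Finset X) (x : X) :
    (symmDiff S {x}).card ≤ S.card + 1 := by
  refine (Finset.card_le_card (symmDiff_le_sup : symmDiff S {x} ≤ S ⊔ {x})).trans ?_
  exact (Finset.card_union_le _ _).trans (by simp)

lemma sum_symmDiff {M : Type} [AddCommMonoid M] (T : Finset X) (F : Finset X → M) :
    ∑ S, F (symmDiff S T) = ∑ S, F S :=
  Equiv.sum_comp (Function.Involutive.toPerm (fun S => symmDiff S T)
    fun S => symmDiff_symmDiff_cancel_right T S) F

end Characters

/-! ### The projection onto a random phase state in Fourier coordinates. -/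

section Compressed

variable {ι κ : Type} [Fintype ι] [DecidableEq ι] [Fintype κ] [DecidableEq κ]

/-- The number of basis states of a register, as a real number. -/
abbrev dim (κ : Type) [Fintype κ] [DecidableEq κ] : ℝ := Fintype.card (κ → Bool)

lemma dim_pos : 0 < dim κ := by exact_mod_cast Fintype.card_pos

/-- The projection of the register `u` onto the phase state given by `f`. -/
def phaseProj (f : (κ → Bool) → Bool) (u : κ ↪ ι) : ((ι → Bool) → ℂ) →ₗ[ℂ] ((ι → Bool) → ℂ) where
  toFun v a := (∑ y, sgn (f (a ∘ u)) * sgn (f y) * v (splice u y a)) / (dim κ : ℂ)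
  map_add' v w := by
    ext a; simp [mul_add, Finset.sum_add_distrib, add_div]
  map_smul' c v := by
    ext a
    simp only [Pi.smul_apply, smul_eq_mul, RingHom.id_apply, ← mul_div_assoc, Finset.mul_sum]
    congr 1
    exact Finset.sum_congr rfl fun y _ => by ring

lemma phaseProj_apply (f : (κ → Bool) → Bool) (u : κ ↪ ι) (v : (ι → Bool) → ℂ) (a : ι → Bool) :
    phaseProj f u v a = (∑ y, sgn (f (a ∘ u)) * sgn (f y) * v (splice u y a)) / (dim κ : ℂ) := rfl

/-- Cauchy–Schwarz over the register bounds each entry by an average over the register, and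
averaging over the register preserves the total. -/
lemma nsq_phaseProj_le (f : (κ → Bool) → Bool) (u : κ ↪ ι) (v : (ι → Bool) → ℂ) :
    nsq (phaseProj f u v) ≤ nsq v := by
  have hN := dim_pos (κ := κ)
  have h : ∀ a, ‖phaseProj f u v a‖ ^ 2 ≤ (∑ y : κ → Bool, ‖v (splice u y a)‖ ^ 2) / dim κ := by
    intro a
    rw [phaseProj_apply, norm_div, div_pow]
    have := norm_sum_sq_le univ fun y => sgn (f (a ∘ u)) * sgn (f y) * v (splice u y a)
    simp only [norm_mul, norm_sgn, one_mul, card_univ, Complex.norm_real, Real.norm_eq_abs,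
      abs_of_pos hN] at this ⊢
    rw [div_le_div_iff₀ (by positivity) hN]
    nlinarith
  calc nsq (phaseProj f u v) ≤ ∑ a, (∑ y : κ → Bool, ‖v (splice u y a)‖ ^ 2) / dim κ :=
        Finset.sum_le_sum fun a _ => h a
    _ = nsq v := by
        rw [← Finset.sum_div, sum_sum_splice u (fun a => ‖v a‖ ^ 2), nsmul_eq_mul]
        exact mul_div_cancel_left₀ _ hN.ne'

/-- The family of states with Fourier coefficients `Θ`, normalized to be an isometry. -/
def synth : (Finset (κ → Bool) × (ι → Bool) → ℂ) →ₗ[ℂ]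
    (((κ → Bool) → Bool) × (ι → Bool) → ℂ) where
  toFun Θ p := (∑ S, chi S p.1 * Θ (S, p.2)) / (√(Fintype.card ((κ → Bool) → Bool)) : ℂ)
  map_add' v w := by
    ext a; simp [mul_add, Finset.sum_add_distrib, add_div]
  map_smul' c v := by
    ext a
    simp only [Pi.smul_apply, smul_eq_mul, RingHom.id_apply, ← mul_div_assoc, Finset.mul_sum]
    congr 1
    exact Finset.sum_congr rfl fun y _ => by ring

lemma synth_apply (Θ : Finset (κ → Bool) × (ι → Bool) → ℂ) (f : (κ → Bool) → Bool)
    (a : ι → Bool) : synth Θ (f, a) =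
      (∑ S, chi S f * Θ (S, a)) / (√(Fintype.card ((κ → Bool) → Bool)) : ℂ) := rfl

lemma nsq_synth (Θ : Finset (κ → Bool) × (ι → Bool) → ℂ) : nsq (synth Θ) = nsq Θ := by
  have hF : (0 : ℝ) < Fintype.card ((κ → Bool) → Bool) := by exact_mod_cast Fintype.card_pos
  simp only [nsq, Fintype.sum_prod_type_right, synth_apply, norm_div, div_pow, Complex.norm_real,
    Real.norm_eq_abs, sq_abs, Real.sq_sqrt hF.le, ← Finset.sum_div]
  rw [Finset.sum_div]
  refine Finset.sum_congr rfl fun a _ => ?_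
  rw [sum_norm_sq_chi fun S => Θ (S, a)]
  field_simp

lemma l2_synth (Θ : Finset (κ → Bool) × (ι → Bool) → ℂ) : l2 (synth Θ) = l2 Θ := by
  simp [l2, nsq_synth]

/-- `Θ` involves only characters of degree at most `k`. -/
def LowDegree (k : ℕ) (Θ : Finset (κ → Bool) × (ι → Bool) → ℂ) : Prop :=
  ∀ S a, k < S.card → Θ (S, a) = 0

/-- The phase projection in the Fourier picture. -/
def shiftProj (u : κ ↪ ι) (Θ : Finset (κ → Bool) × (ι → Bool) → ℂ) :
    Finset (κ → Bool) × (ι → Bool) → ℂ := fun p =>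
  (∑ y, Θ (symmDiff (symmDiff p.1 {p.2 ∘ u}) {y}, splice u y p.2)) / (dim κ : ℂ)

/-- The part of the phase projection that removes an element and inserts an element. -/
def keepProj (u : κ ↪ ι) (Θ : Finset (κ → Bool) × (ι → Bool) → ℂ) :
    Finset (κ → Bool) × (ι → Bool) → ℂ := fun p =>
  (∑ y, if p.2 ∘ u ∈ p.1 ∧ y ∉ p.1.erase (p.2 ∘ u) then
    Θ (symmDiff (symmDiff p.1 {p.2 ∘ u}) {y}, splice u y p.2) else 0) / (dim κ : ℂ)

/-- Multiplying by `sgn (f x) * sgn (f y)` multiplies the character of `S` by those of `{x}` and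
`{y}`, so it shifts the index set by two symmetric differences. -/
lemma phaseProj_synth (u : κ ↪ ι) (Θ : Finset (κ → Bool) × (ι → Bool) → ℂ)
    (f : (κ → Bool) → Bool) (a : ι → Bool) :
    phaseProj f u (fun a => synth Θ (f, a)) a = synth (shiftProj u Θ) (f, a) := by
  simp only [phaseProj_apply, synth_apply, shiftProj, Finset.sum_div, Finset.mul_sum,
    ← mul_div_assoc, div_div]
  rw [Finset.sum_comm (s := univ) (t := (univ : Finset (Finset (κ → Bool))))]
  rw [Finset.sum_comm (s := (univ : Finset (Finset (κ → Bool))))]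
  conv_rhs => rw [Finset.sum_comm]
  refine Finset.sum_congr rfl fun y _ => ?_
  rw [← sum_symmDiff {y}, ← sum_symmDiff {a ∘ u}]
  refine Finset.sum_congr rfl fun S _ => ?_
  rw [chi_symmDiff, chi_symmDiff, chi_singleton, chi_singleton]
  rw [mul_comm (dim κ : ℂ)]
  congr 1
  have h1 := sgn_mul_self (f (a ∘ u))
  have h2 := sgn_mul_self (f y)
  linear_combination (chi S f * Θ (symmDiff (symmDiff S {a ∘ u}) {y}, splice u y a)) *
    (sgn (f y) * sgn (f y) * h1 + h2)

/-- The terms kept by `keepProj` exchange `x` for `y`; this is why it does not raise the degree. -/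
lemma card_keep {S : Finset (κ → Bool)} {x y : κ → Bool} (hx : x ∈ S) (hy : y ∉ S.erase x) :
    symmDiff (symmDiff S {x}) {y} = insert y (S.erase x) ∧
    (insert y (S.erase x)).card = S.card := by
  constructor
  · ext z
    simp only [mem_symmDiff, mem_singleton, mem_insert, mem_erase] at *
    by_cases h1 : z = x <;> by_cases h2 : z = y <;> subst_vars <;> simp_all
  · rw [card_insert_of_notMem hy, card_erase_of_mem hx]
    have := card_pos.2 ⟨x, hx⟩; omega

lemma lowDegree_keepProj {k : ℕ} {Θ : Finset (κ → Bool) × (ι → Bool) → ℂ} (h : LowDegree k Θ)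
    (u : κ ↪ ι) : LowDegree k (keepProj u Θ) := by
  intro S a hS
  simp only [keepProj]
  rw [Finset.sum_eq_zero, zero_div]
  intro y _
  split_ifs with hc
  · obtain ⟨h1, h2⟩ := card_keep hc.1 hc.2
    exact h _ _ (by rw [h1, h2]; exact hS)
  · rfl

/-- Replacing `S` by `S △ {x} △ {y}` while exchanging the register content `x` with `y` is an
involution. It turns a sum indexed by outputs of the projection into one indexed by its inputs,
where only the number of admissible outputs has to be counted. -/
lemma sum_shift_swap (u : κ ↪ ι) (w : Finset (κ → Bool) → (κ → Bool) → (κ → Bool) → ℝ)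
    (Θ : Finset (κ → Bool) × (ι → Bool) → ℂ) :
    ∑ S, ∑ a, ∑ y, w S (a ∘ u) y *
      ‖Θ (symmDiff (symmDiff S {a ∘ u}) {y}, splice u y a)‖ ^ 2 =
    ∑ S, ∑ a, ‖Θ (S, a)‖ ^ 2 * ∑ y, w (symmDiff (symmDiff S {a ∘ u}) {y}) y (a ∘ u) := by
  simp_rw [fun S => sum_splice_swap u fun a y => w S (a ∘ u) y *
      ‖Θ (symmDiff (symmDiff S {a ∘ u}) {y}, splice u y a)‖ ^ 2]
  simp only [splice_comp, splice_splice, splice_self]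
  rw [Finset.sum_comm]
  conv_rhs => rw [Finset.sum_comm]
  refine Finset.sum_congr rfl fun a _ => ?_
  simp only [Finset.mul_sum]
  rw [Finset.sum_comm]
  conv_rhs => rw [Finset.sum_comm]
  refine Finset.sum_congr rfl fun y _ => ?_
  rw [← sum_symmDiff {y}, ← sum_symmDiff {a ∘ u}]
  refine Finset.sum_congr rfl fun S _ => ?_
  rw [symmDiff_symmDiff_cancel_right, symmDiff_symmDiff_cancel_right, mul_comm]

/-- The part of the phase projection that only inserts elements. -/
def insertProj (u : κ ↪ ι) (Θ : Finset (κ → Bool) × (ι → Bool) → ℂ) :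
    Finset (κ → Bool) × (ι → Bool) → ℂ := fun p =>
  (∑ y, if p.2 ∘ u ∉ p.1 then
    Θ (symmDiff (symmDiff p.1 {p.2 ∘ u}) {y}, splice u y p.2) else 0) / (dim κ : ℂ)

/-- The part of the phase projection that only removes elements. -/
def removeProj (u : κ ↪ ι) (Θ : Finset (κ → Bool) × (ι → Bool) → ℂ) :
    Finset (κ → Bool) × (ι → Bool) → ℂ := fun p =>
  (∑ y ∈ p.1.erase (p.2 ∘ u), if p.2 ∘ u ∈ p.1 then
    Θ (symmDiff (symmDiff p.1 {p.2 ∘ u}) {y}, splice u y p.2) else 0) / (dim κ : ℂ)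

/-- With `x = a ∘ u`, the terms missing from `keepProj` are those with `x ∉ S` and those with `x ∈
S` and `y ∈ S \ {x}`. -/
lemma shiftProj_sub_keepProj (u : κ ↪ ι) (Θ : Finset (κ → Bool) × (ι → Bool) → ℂ) :
    shiftProj u Θ - keepProj u Θ = insertProj u Θ + removeProj u Θ := by
  ext ⟨S, a⟩
  simp only [Pi.sub_apply, Pi.add_apply, shiftProj, keepProj, insertProj, removeProj]
  rw [← sub_div, ← add_div]
  congr 1
  have e : ∀ g : (κ → Bool) → ℂ, ∑ y ∈ S.erase (a ∘ u), g y =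
      ∑ y, if y ∈ S.erase (a ∘ u) then g y else 0 := fun g => by
    rw [Finset.sum_ite_mem, Finset.univ_inter]
  rw [e]
  rw [← Finset.sum_sub_distrib, ← Finset.sum_add_distrib]
  refine Finset.sum_congr rfl fun y _ => ?_
  by_cases h1 : a ∘ u ∈ S <;> by_cases h2 : y ∈ S.erase (a ∘ u) <;> simp only [h1, h2] <;> simp

/-- Cauchy–Schwarz over all `y` leaves one factor `1 / dim κ`. After the sum is indexed by inputs,
an input set `T` with register content `x` is counted once for every `y ∈ T △ {x}`, hence at most `k
+ 1` times. -/
lemma nsq_insertProj_le {k : ℕ} {Θ : Finset (κ → Bool) × (ι → Bool) → ℂ} (h : LowDegree k Θ)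
    (u : κ ↪ ι) : nsq (insertProj u Θ) ≤ (k + 1) / dim κ * nsq Θ := by
  have hN := dim_pos (κ := κ)
  have h1 : ∀ S a, ‖insertProj u Θ (S, a)‖ ^ 2 ≤ (∑ y, (if a ∘ u ∉ S then 1 else 0) *
      ‖Θ (symmDiff (symmDiff S {a ∘ u}) {y}, splice u y a)‖ ^ 2) / dim κ := by
    intro S a
    simp only [insertProj]
    rw [norm_div, div_pow, Complex.norm_real, Real.norm_eq_abs, abs_of_pos hN]
    have := norm_sum_sq_le univ fun y => if a ∘ u ∉ S then
      Θ (symmDiff (symmDiff S {a ∘ u}) {y}, splice u y a) else 0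
    have e : ∀ y, ‖if a ∘ u ∉ S then
      Θ (symmDiff (symmDiff S {a ∘ u}) {y}, splice u y a) else 0‖ ^ 2 =
      (if a ∘ u ∉ S then 1 else 0) *
        ‖Θ (symmDiff (symmDiff S {a ∘ u}) {y}, splice u y a)‖ ^ 2 := by
      intro y; split_ifs <;> simp
    simp only [e, card_univ] at this
    rw [div_le_div_iff₀ (by positivity) hN]
    nlinarith
  calc nsq (insertProj u Θ) = ∑ S, ∑ a, ‖insertProj u Θ (S, a)‖ ^ 2 := by
        rw [nsq, Fintype.sum_prod_type]
    _ ≤ ∑ S, ∑ a, (∑ y, (if a ∘ u ∉ S then 1 else 0) *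
      ‖Θ (symmDiff (symmDiff S {a ∘ u}) {y}, splice u y a)‖ ^ 2) / dim κ :=
        Finset.sum_le_sum fun S _ => Finset.sum_le_sum fun a _ => h1 S a
    _ = (∑ S, ∑ a, ‖Θ (S, a)‖ ^ 2 * ∑ y,
          if y ∉ symmDiff (symmDiff S {a ∘ u}) {y} then (1 : ℝ) else 0) / dim κ := by
        simp only [← Finset.sum_div]
        rw [sum_shift_swap u fun S x _ => if x ∉ S then (1 : ℝ) else 0]
    _ ≤ (∑ S, ∑ a, ‖Θ (S, a)‖ ^ 2 * (k + 1)) / dim κ := by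
        refine div_le_div_of_nonneg_right ?_ hN.le
        refine Finset.sum_le_sum fun S _ => Finset.sum_le_sum fun a _ => ?_
        by_cases hS : k < S.card
        · simp [h S a hS]
        · refine mul_le_mul_of_nonneg_left ?_ (by positivity)
          have : ∀ y, y ∉ symmDiff (symmDiff S {a ∘ u}) {y} ↔ y ∈ symmDiff S {a ∘ u} := by
            intro y
            by_cases hy : y ∈ symmDiff S {a ∘ u} <;>
            simp only [hy, iff_true, iff_false, Finset.mem_symmDiff (a := y) (s := symmDiff S {a ∘ u})] <;> simp
          simp only [this]
          rw [Finset.sum_boole]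
          simp only [Finset.filter_mem_eq_inter, Finset.univ_inter]
          have := card_symmDiff_singleton_le S (a ∘ u)
          push Not at hS
          exact_mod_cast this.trans (by omega)
    _ = (k + 1) / dim κ * nsq Θ := by
        rw [nsq, Fintype.sum_prod_type]
        simp only [← Finset.sum_mul]; ring

/-- The input set is `S` without `x` and `y`, so by low degree only sets with `S \ {x}` of size at
most `k + 1` contribute. Cauchy–Schwarz then runs over at most `k + 1` terms, against a denominator
`dim κ ^ 2`; indexing by inputs costs one factor `dim κ`. -/
lemma nsq_removeProj_le {k : ℕ} {Θ : Finset (κ → Bool) × (ι → Bool) → ℂ} (h : LowDegree k Θ)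
    (u : κ ↪ ι) : nsq (removeProj u Θ) ≤ (k + 1) / dim κ * nsq Θ := by
  have hN := dim_pos (κ := κ)
  have h1 : ∀ S a, ‖removeProj u Θ (S, a)‖ ^ 2 ≤ (k + 1) / dim κ ^ 2 * ∑ y, 1 *
      ‖Θ (symmDiff (symmDiff S {a ∘ u}) {y}, splice u y a)‖ ^ 2 := by
    intro S a
    simp only [removeProj, one_mul]
    rw [norm_div, div_pow, Complex.norm_real, Real.norm_eq_abs, abs_of_pos hN, div_mul_eq_mul_div]
    refine div_le_div_of_nonneg_right ?_ (by positivity)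
    by_cases hx : a ∘ u ∈ S
    · simp only [hx, if_true]
      by_cases hS : (S.erase (a ∘ u)).card ≤ k + 1
      · refine (norm_sum_sq_le _ _).trans ?_
        have : ((S.erase (a ∘ u)).card : ℝ) ≤ k + 1 := by exact_mod_cast hS
        have h2 := Finset.sum_le_sum_of_subset_of_nonneg (Finset.subset_univ (S.erase (a ∘ u)))
          (f := fun y => ‖Θ (symmDiff (symmDiff S {a ∘ u}) {y}, splice u y a)‖ ^ 2)
          fun _ _ _ => by positivity
        gcongr
      · rw [Finset.sum_eq_zero, norm_zero, zero_pow two_ne_zero]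
        · positivity
        intro y hy
        apply h
        have e : symmDiff (symmDiff S {a ∘ u}) {y} = (S.erase (a ∘ u)).erase y := by
          ext z
          simp only [mem_symmDiff, mem_singleton, mem_erase] at *
          by_cases h1 : z = a ∘ u <;> by_cases h2 : z = y <;> subst_vars <;> simp_all
        rw [e, card_erase_of_mem hy]; omega
    · simp only [hx, if_false, Finset.sum_const_zero, norm_zero, zero_pow two_ne_zero]; positivity
  calc nsq (removeProj u Θ) = ∑ S, ∑ a, ‖removeProj u Θ (S, a)‖ ^ 2 := by
        rw [nsq, Fintype.sum_prod_type]
    _ ≤ ∑ S, ∑ a, (k + 1) / dim κ ^ 2 * ∑ y, 1 *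
      ‖Θ (symmDiff (symmDiff S {a ∘ u}) {y}, splice u y a)‖ ^ 2 :=
        Finset.sum_le_sum fun S _ => Finset.sum_le_sum fun a _ => h1 S a
    _ = (k + 1) / dim κ * nsq Θ := by
        simp_rw [← Finset.mul_sum ((univ : Finset (ι → Bool))), ← Finset.mul_sum (univ : Finset (Finset (κ → Bool)))]
        rw [sum_shift_swap u fun _ _ _ => 1]
        simp only [Finset.sum_const, card_univ, nsmul_eq_mul, mul_one, ← Finset.sum_mul]
        rw [nsq, Fintype.sum_prod_type]
        field_simp

lemma l2_shiftProj_sub_keepProj_le {k : ℕ} {Θ : Finset (κ → Bool) × (ι → Bool) → ℂ}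
    (h : LowDegree k Θ) (u : κ ↪ ι) :
    l2 (shiftProj u Θ - keepProj u Θ) ≤ 2 * √((k + 1) / dim κ) * l2 Θ := by
  have hN := dim_pos (κ := κ)
  have e : ((k : ℝ) + 1) / dim κ * nsq Θ = (√((k + 1) / dim κ) * l2 Θ) ^ 2 := by
    rw [mul_pow, Real.sq_sqrt (by positivity), l2_sq]
  have hnn : 0 ≤ √((k + 1) / dim κ) * l2 Θ := mul_nonneg (Real.sqrt_nonneg _) (l2_nonneg _)
  rw [shiftProj_sub_keepProj]
  have h1 := l2_le_of_nsq_le hnn ((nsq_insertProj_le h u).trans_eq e)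
  have h2 := l2_le_of_nsq_le hnn ((nsq_removeProj_le h u).trans_eq e)
  linarith [l2_add_le (insertProj u Θ) (removeProj u Θ)]

/-! ## Monogamy: one reference register cannot be correlated with many registers -/

section Monogamy

variable {m : Type} [Fintype m] [DecidableEq m]

/-- The overlap of a vector on the system and a reference register with the maximally entangled
state of the register `u` and the reference register. -/
def pairOverlap (u : κ ↪ ι) (θ : (ι → Bool) → (κ → Bool) → ℂ) (a : ι → Bool) : ℂ :=
  (∑ y, θ (splice u y a) y) / (dim κ : ℂ)

@[simp] lemma pairOverlap_splice (u : κ ↪ ι) (θ : (ι → Bool) → (κ → Bool) → ℂ) (y : κ → Bool)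
    (a : ι → Bool) : pairOverlap u θ (splice u y a) = pairOverlap u θ a := by
  simp [pairOverlap]

/-- `pairOverlap u θ` does not depend on the entries at `u`, so averaging over them turns `θ a (a ∘
u)` into `pairOverlap u θ a`. In other words, a squared projection is an inner product with the
original vector. -/
lemma sum_norm_sq_pairOverlap_eq (u : κ ↪ ι) (θ : (ι → Bool) → (κ → Bool) → ℂ) :
    ((nsq (pairOverlap u θ) : ℝ) : ℂ) =
      ∑ a, (starRingEnd ℂ) (pairOverlap u θ a) * θ a (a ∘ u) := by
  have hN : (dim κ : ℂ) ≠ 0 := by exact_mod_cast (dim_pos (κ := κ)).ne'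
  have h1 : ((nsq (pairOverlap u θ) : ℝ) : ℂ) =
      ∑ a, (starRingEnd ℂ) (pairOverlap u θ a) * pairOverlap u θ a := by
    rw [nsq, Complex.ofReal_sum]
    refine Finset.sum_congr rfl fun a _ => ?_
    rw [Complex.conj_mul', Complex.ofReal_pow]
  have h2 := sum_splice_swap u (fun a (_ : κ → Bool) =>
    (starRingEnd ℂ) (pairOverlap u θ a) * θ a (a ∘ u))
  simp only [Finset.sum_const, card_univ, nsmul_eq_mul, pairOverlap_splice, splice_comp,
    ← Finset.mul_sum] at h2
  have h3 : ∀ a, ∑ y, θ (splice u y a) y = (dim κ : ℂ) * pairOverlap u θ a := fun a => by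
    rw [pairOverlap, mul_div_cancel₀ _ hN]
  simp only [h3, mul_left_comm _ (dim κ : ℂ), ← Finset.mul_sum] at h2
  rw [h1]
  exact (mul_left_cancel₀ hN (by simpa using h2)).symm

/-- The overlap is constant in the register `u`, whose content agrees with that of the disjoint
register `w` for one value in `dim κ`. This is the near-orthogonality of the entangled pairs. -/
lemma sum_pairOverlap_eq_comp (u w : κ ↪ ι) (h : ∀ j k, u j ≠ w k)
    (θ : (ι → Bool) → (κ → Bool) → ℂ) :
    ∑ a, (if a ∘ w = a ∘ u then ‖pairOverlap u θ a‖ ^ 2 else 0) =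
      nsq (pairOverlap u θ) / dim κ := by
  have hN := dim_pos (κ := κ)
  have h2 := sum_splice_swap u (fun a (_ : κ → Bool) =>
    if a ∘ w = a ∘ u then ‖pairOverlap u θ a‖ ^ 2 else 0)
  simp only [Finset.sum_const, card_univ, nsmul_eq_mul, pairOverlap_splice, splice_comp,
    splice_comp_of_disjoint u w h, ← Finset.mul_sum, Finset.sum_ite_eq, Finset.mem_univ,
    if_true] at h2
  rw [eq_div_iff hN.ne', mul_comm]
  exact h2

/-- Let `s` be the left side and `Φ` the sum of the projections of `θ` onto the entangled pairs.
Then `s = ⟨Φ, θ⟩`, so `s ^ 2 ≤ ‖Φ‖ ^ 2 * ‖θ‖ ^ 2`, while near-orthogonality gives `‖Φ‖ ^ 2 ≤ (1 + m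
/ dim κ) * s` for `m` registers. Cancel one factor `s`. -/
lemma sum_nsq_pairOverlap_le (u : m → κ ↪ ι) (hu : ∀ i i', i ≠ i' → ∀ j k, u i j ≠ u i' k)
    (θ : (ι → Bool) → (κ → Bool) → ℂ) :
    ∑ i, nsq (pairOverlap (u i) θ) ≤
      (1 + Fintype.card m / dim κ) * ∑ a, ∑ y, ‖θ a y‖ ^ 2 := by
  have hN := dim_pos (κ := κ)
  set α := fun i => pairOverlap (u i) θ with hα
  set s := ∑ i, nsq (α i) with hs
  have hs0 : 0 ≤ s := Finset.sum_nonneg fun i _ => nsq_nonneg _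
  set Φ : (ι → Bool) × (κ → Bool) → ℂ := fun p => ∑ i, if p.1 ∘ u i = p.2 then α i p.1 else 0
  set θ' : (ι → Bool) × (κ → Bool) → ℂ := fun p => θ p.1 p.2
  have hθ' : nsq θ' = ∑ a, ∑ y, ‖θ a y‖ ^ 2 := by rw [nsq, Fintype.sum_prod_type]
  have h1 : (s : ℂ) = ∑ p, (starRingEnd ℂ) (Φ p) * θ' p := by
    rw [hs, Complex.ofReal_sum, Fintype.sum_prod_type]
    simp only [Φ, map_sum, Finset.sum_mul]
    simp_rw [Finset.sum_comm (s := (univ : Finset (κ → Bool))) (t := (univ : Finset m))]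
    rw [Finset.sum_comm]
    refine Finset.sum_congr rfl fun i _ => ?_
    rw [hα, sum_norm_sq_pairOverlap_eq]
    refine Finset.sum_congr rfl fun a _ => ?_
    rw [Finset.sum_eq_single (a ∘ u i)]
    · simp [θ']
    · intro y _ hy; simp [hy.symm]
    · simp
  have h2 : s ≤ ∑ p, ‖Φ p‖ * ‖θ' p‖ := by
    have : ‖(s : ℂ)‖ ≤ ∑ p, ‖Φ p‖ * ‖θ' p‖ := by
      rw [h1]; refine (norm_sum_le _ _).trans_eq ?_; simp
    rwa [Complex.norm_real, Real.norm_of_nonneg hs0] at this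
  have h3 : s ^ 2 ≤ nsq Φ * nsq θ' :=
    (pow_le_pow_left₀ hs0 h2 2).trans (Finset.sum_mul_sq_le_sq_mul_sq _ _ _)
  have h4 : nsq Φ ≤ (1 + Fintype.card m / dim κ) * s := by
    have hp : ∀ p, ‖Φ p‖ ^ 2 ≤ ∑ i, ∑ j,
        if p.1 ∘ u j = p.2 ∧ p.1 ∘ u i = p.2 then ‖α i p.1‖ ^ 2 else 0 := by
      intro p
      simp only [Φ]
      rw [← Finset.sum_filter]
      refine (norm_sum_sq_le _ _).trans_eq ?_
      rw [Finset.mul_sum, Finset.sum_filter]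
      refine Finset.sum_congr rfl fun i _ => ?_
      by_cases hi : p.1 ∘ u i = p.2
      · simp only [hi, if_true, and_true]
        rw [← Finset.sum_filter, Finset.sum_const, nsmul_eq_mul]
      · simp [hi]
    calc nsq Φ ≤ ∑ p : (ι → Bool) × (κ → Bool), ∑ i, ∑ j,
        (if p.1 ∘ u j = p.2 ∧ p.1 ∘ u i = p.2 then ‖α i p.1‖ ^ 2 else 0) :=
          Finset.sum_le_sum fun p _ => hp p
      _ = ∑ i, ∑ j, ∑ a, (if a ∘ u j = a ∘ u i then ‖α i a‖ ^ 2 else 0) := by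
          rw [Finset.sum_comm]
          refine Finset.sum_congr rfl fun i _ => ?_
          rw [Finset.sum_comm]
          refine Finset.sum_congr rfl fun j _ => ?_
          rw [Fintype.sum_prod_type]
          refine Finset.sum_congr rfl fun a _ => ?_
          rw [Finset.sum_eq_single (a ∘ u i)]
          · simp
          · intro y _ hy; simp [hy.symm]
          · simp
      _ ≤ ∑ i, ∑ j, ((if j = i then nsq (α i) else 0) + nsq (α i) / dim κ) := by
          refine Finset.sum_le_sum fun i _ => Finset.sum_le_sum fun j _ => ?_
          have hd : 0 ≤ nsq (α i) / dim κ := div_nonneg (nsq_nonneg _) hN.le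
          by_cases hj : j = i
          · subst hj; simp only [if_true]; exact le_add_of_nonneg_right hd
          · rw [hα]
            simp only [hj, if_false, zero_add]
            exact (sum_pairOverlap_eq_comp (u i) (u j) (hu i j (Ne.symm hj)) θ).le
      _ = (1 + Fintype.card m / dim κ) * s := by
          simp only [Finset.sum_add_distrib, Finset.sum_ite_eq', Finset.mem_univ, if_true,
            Finset.sum_const, card_univ, nsmul_eq_mul, ← Finset.mul_sum, ← Finset.sum_div]
          ring
  rw [← hθ']
  have hθn := nsq_nonneg θ'
  have hc : (0 : ℝ) < 1 + Fintype.card m / dim κ := by positivity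
  rcases hs0.eq_or_lt with h0 | h0
  · rw [← h0]; positivity
  · have : s * s ≤ s * ((1 + Fintype.card m / dim κ) * nsq θ') := by nlinarith
    exact le_of_mul_le_mul_left this h0

/-- Splitting `S` as `insert y R` turns the marked element `y` into the content of a reference
register, and `keepProj` becomes the overlap of this register with `u i`. Each `S` arises from
`S.card ≤ k` pairs `(R, y)`, which produces the factor `k`; monogamy does the rest. -/
lemma sum_nsq_keepProj_le {k : ℕ} {Θ : Finset (κ → Bool) × (ι → Bool) → ℂ}
    (h : LowDegree k Θ) (u : m → κ ↪ ι) (hu : ∀ i i', i ≠ i' → ∀ j k, u i j ≠ u i' k) :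
    ∑ i, nsq (keepProj (u i) Θ) ≤ k * (1 + Fintype.card m / dim κ) * nsq Θ := by
  have hN := dim_pos (κ := κ)
  set θ : Finset (κ → Bool) → (ι → Bool) → (κ → Bool) → ℂ := fun R a y =>
    if y ∉ R then Θ (insert y R, a) else 0 with hθ
  have h1 : ∀ i, nsq (keepProj (u i) Θ) ≤ ∑ R, nsq (pairOverlap (u i) (θ R)) := by
    intro i
    rw [nsq, Fintype.sum_prod_type_right]
    simp only [nsq]
    conv_rhs => rw [Finset.sum_comm]
    refine Finset.sum_le_sum fun a _ => ?_
    rw [← sum_symmDiff {a ∘ u i}]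
    refine Finset.sum_le_sum fun R _ => ?_
    by_cases hR : a ∘ u i ∈ R
    · have : a ∘ u i ∉ symmDiff R {a ∘ u i} := by simp [Finset.mem_symmDiff, hR]
      simp only [keepProj, this, false_and, if_false, Finset.sum_const_zero, zero_div, norm_zero,
        zero_pow two_ne_zero]
      positivity
    · have e1 : a ∘ u i ∈ symmDiff R {a ∘ u i} := by simp [Finset.mem_symmDiff, hR]
      have e2 : (symmDiff R {a ∘ u i}).erase (a ∘ u i) = R := by
        ext z
        by_cases hz : z = a ∘ u i
        · subst hz; simp [hR]
        · simp [Finset.mem_symmDiff, hz]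
      simp only [keepProj, e1, true_and, e2, symmDiff_symmDiff_cancel_right, pairOverlap, hθ]
      have e3 : ∀ y, (if y ∉ R then Θ (symmDiff R {y}, splice (u i) y a) else 0) =
          if y ∉ R then Θ (insert y R, splice (u i) y a) else 0 := by
        intro y
        by_cases hy : y ∈ R
        · simp [hy]
        · have : symmDiff R {y} = insert y R := by
            ext z
            by_cases hz : z = y
            · subst hz; simp [Finset.mem_symmDiff, hy]
            · simp [Finset.mem_symmDiff, hz]
          rw [this]
      simp only [e3]
      exact le_rfl
  have h2 : ∑ R, ∑ a, ∑ y, ‖θ R a y‖ ^ 2 ≤ k * nsq Θ := by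
    calc ∑ R, ∑ a, ∑ y, ‖θ R a y‖ ^ 2
        = ∑ a, ∑ y, ∑ S : Finset (κ → Bool), if y ∈ S then ‖Θ (S, a)‖ ^ 2 else 0 := by
          rw [Finset.sum_comm]
          refine Finset.sum_congr rfl fun a _ => ?_
          rw [Finset.sum_comm]
          refine Finset.sum_congr rfl fun y _ => ?_
          rw [← sum_symmDiff {y}]
          refine Finset.sum_congr rfl fun S _ => ?_
          by_cases hy : y ∈ S
          · have e : insert y (symmDiff S {y}) = S := by
              ext z
              by_cases hz : z = y
              · subst hz; simp [hy]
              · simp [Finset.mem_symmDiff, hz]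
            simp [hθ, Finset.mem_symmDiff, hy, e]
          · simp [hθ, Finset.mem_symmDiff, hy]
      _ = ∑ S : Finset (κ → Bool), ∑ a, S.card * ‖Θ (S, a)‖ ^ 2 := by
          rw [Finset.sum_comm (s := (univ : Finset (Finset (κ → Bool))))]
          refine Finset.sum_congr rfl fun a _ => ?_
          rw [Finset.sum_comm]
          refine Finset.sum_congr rfl fun S _ => ?_
          rw [Finset.sum_ite_mem, Finset.univ_inter, Finset.sum_const, nsmul_eq_mul]
      _ ≤ ∑ S : Finset (κ → Bool), ∑ a, k * ‖Θ (S, a)‖ ^ 2 := by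
          refine Finset.sum_le_sum fun S _ => Finset.sum_le_sum fun a _ => ?_
          by_cases hS : k < S.card
          · simp [h S a hS]
          · push Not at hS
            gcongr
      _ = k * nsq Θ := by
          rw [nsq, Fintype.sum_prod_type]; simp only [← Finset.mul_sum]
  calc ∑ i, nsq (keepProj (u i) Θ) ≤ ∑ i, ∑ R, nsq (pairOverlap (u i) (θ R)) :=
        Finset.sum_le_sum fun i _ => h1 i
    _ = ∑ R, ∑ i, nsq (pairOverlap (u i) (θ R)) := Finset.sum_comm
    _ ≤ ∑ R, (1 + Fintype.card m / dim κ) * ∑ a, ∑ y, ‖θ R a y‖ ^ 2 :=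
        Finset.sum_le_sum fun R _ => sum_nsq_pairOverlap_le u hu (θ R)
    _ ≤ _ := by
        rw [← Finset.mul_sum]
        have hc : (0 : ℝ) ≤ 1 + Fintype.card m / dim κ := by positivity
        nlinarith [mul_le_mul_of_nonneg_left h2 hc]

end Monogamy

end Compressed

end

section

/-! ## Evolution under queries to the projection onto an unknown phase state -/

section Evolution

variable {ι κ : Type} [Fintype ι] [DecidableEq ι] [Fintype κ] [DecidableEq κ]

/-- An operation that uses the projection onto an unknown phase state once. -/
structure PhaseQuery (ι κ : Type) where
  free : ((ι → Bool) → ℂ) →ₗ[ℂ] ((ι → Bool) → ℂ)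
  probe : ((ι → Bool) → ℂ) →ₗ[ℂ] ((ι → Bool) → ℂ)
  register : κ ↪ ι

/-- The operation carried out if the unknown phase state is given by `f`. -/
def PhaseQuery.step (p : PhaseQuery ι κ) (f : (κ → Bool) → Bool) (v : (ι → Bool) → ℂ) :
    (ι → Bool) → ℂ := p.free v + phaseProj f p.register (p.probe v)

/-- A member of a family of states. -/
def fiber {α β : Type} (Ψ : α × β → ℂ) (f : α) : β → ℂ := fun a => Ψ (f, a)

/-- Applying an operation to each member of a family of states. -/
def fiberwise {α β : Type} (W : α → (β → ℂ) → (β → ℂ)) (Ψ : α × β → ℂ) : α × β → ℂ :=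
  fun p => W p.1 (fiber Ψ p.1) p.2

section

variable {α β : Type}

lemma fiberwise_apply (W : α → (β → ℂ) → (β → ℂ)) (Ψ : α × β → ℂ) (f : α) (a : β) :
    fiberwise W Ψ (f, a) = W f (fiber Ψ f) a := rfl

lemma fiber_fiberwise (W : α → (β → ℂ) → (β → ℂ)) (Ψ : α × β → ℂ) (f : α) :
    fiber (fiberwise W Ψ) f = W f (fiber Ψ f) := rfl

lemma fiber_sub (Ψ Ψ' : α × β → ℂ) (f : α) : fiber (Ψ - Ψ') f = fiber Ψ f - fiber Ψ' f := rfl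

variable [Fintype α] [Fintype β]

lemma nsq_eq_sum_fiber (Ψ : α × β → ℂ) : nsq Ψ = ∑ f, nsq (fiber Ψ f) := by
  simp only [nsq, Fintype.sum_prod_type, fiber]

lemma l2_fiberwise_le {W : α → (β → ℂ) → (β → ℂ)} {c : ℝ} (hc : 0 ≤ c)
    (hW : ∀ f v, l2 (W f v) ≤ c * l2 v) (Ψ : α × β → ℂ) : l2 (fiberwise W Ψ) ≤ c * l2 Ψ := by
  refine l2_le_of_nsq_le (mul_nonneg hc (l2_nonneg _)) ?_
  rw [mul_pow, l2_sq, nsq_eq_sum_fiber, nsq_eq_sum_fiber Ψ, Finset.mul_sum]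
  refine Finset.sum_le_sum fun f _ => ?_
  rw [fiber_fiberwise, ← l2_sq, ← l2_sq (fiber Ψ f), ← mul_pow]
  exact pow_le_pow_left₀ (l2_nonneg _) (hW f _) 2

lemma l2_fiberwise_le_self {W : α → (β → ℂ) → (β → ℂ)}
    (hW : ∀ f v, l2 (W f v) ≤ l2 v) (Ψ : α × β → ℂ) : l2 (fiberwise W Ψ) ≤ l2 Ψ := by
  have := l2_fiberwise_le zero_le_one (fun f v => (hW f v).trans_eq (one_mul _).symm) Ψ
  rwa [one_mul] at this

end

/-- The approximate Fourier description of `PhaseQuery.step`. -/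
def PhaseQuery.keepStep (p : PhaseQuery ι κ) (Θ : Finset (κ → Bool) × (ι → Bool) → ℂ) :
    Finset (κ → Bool) × (ι → Bool) → ℂ :=
  fiberwise (fun _ => p.free) Θ + keepProj p.register (fiberwise (fun _ => p.probe) Θ)

lemma fiberwise_synth (L : ((ι → Bool) → ℂ) →ₗ[ℂ] ((ι → Bool) → ℂ))
    (Θ : Finset (κ → Bool) × (ι → Bool) → ℂ) :
    fiberwise (fun _ => L) (synth Θ) = synth (fiberwise (fun _ => L) Θ) := by
  have e : ∀ f, fiber (synth Θ) f =
      (√(Fintype.card ((κ → Bool) → Bool)) : ℂ)⁻¹ • ∑ S, chi S f • fiber Θ S := by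
    intro f; ext a; simp [fiber, synth_apply, Finset.sum_apply, div_eq_inv_mul]
  ext ⟨f, a⟩
  rw [fiberwise_apply, e, map_smul, map_sum, synth_apply]
  simp only [map_smul, Pi.smul_apply, Finset.sum_apply, smul_eq_mul, div_eq_inv_mul,
    fiberwise_apply]

lemma lowDegree_fiberwise {k : ℕ} {Θ : Finset (κ → Bool) × (ι → Bool) → ℂ} (h : LowDegree k Θ)
    (L : ((ι → Bool) → ℂ) →ₗ[ℂ] ((ι → Bool) → ℂ)) :
    LowDegree k (fiberwise (fun _ => L) Θ) := by
  intro S a hS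
  have : fiber Θ S = 0 := by ext a; exact h S a hS
  rw [fiberwise_apply, this, map_zero, Pi.zero_apply]

/-- The size of the error of the Fourier description. -/
def keepError (κ : Type) [Fintype κ] [DecidableEq κ] (k : ℕ) : ℝ := 2 * √((k + 1) / dim κ)

lemma keepError_nonneg (k : ℕ) : 0 ≤ keepError κ k := by unfold keepError; positivity

lemma fiberwise_step_synth (p : PhaseQuery ι κ) (Θ : Finset (κ → Bool) × (ι → Bool) → ℂ) :
    fiberwise p.step (synth Θ) - synth (p.keepStep Θ) =
      synth (shiftProj p.register (fiberwise (fun _ => p.probe) Θ) -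
        keepProj p.register (fiberwise (fun _ => p.probe) Θ)) := by
  have h : fiberwise p.step (synth Θ) = synth (fiberwise (fun _ => p.free) Θ) +
      synth (shiftProj p.register (fiberwise (fun _ => p.probe) Θ)) := by
    rw [← fiberwise_synth]
    ext ⟨f, a⟩
    rw [Pi.add_apply, ← phaseProj_synth, ← fiberwise_synth]
    rfl
  rw [h, PhaseQuery.keepStep, map_add, map_sub]
  abel

lemma l2_step_synth_le {k : ℕ} (p : PhaseQuery ι κ) (hp : ∀ v, l2 (p.probe v) ≤ 2 * l2 v)
    {Θ : Finset (κ → Bool) × (ι → Bool) → ℂ} (h : LowDegree k Θ) :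
    l2 (fiberwise p.step (synth Θ) - synth (p.keepStep Θ)) ≤ 2 * keepError κ k * l2 Θ := by
  rw [fiberwise_step_synth, l2_synth]
  refine (l2_shiftProj_sub_keepProj_le (lowDegree_fiberwise h p.probe) _).trans ?_
  have h1 := l2_fiberwise_le zero_le_two (fun _ v => hp v) Θ
  have := mul_le_mul_of_nonneg_left h1 (keepError_nonneg (κ := κ) k)
  unfold keepError at *
  linarith

lemma fiberwise_step_sub (p : PhaseQuery ι κ) (Ψ Ψ' : ((κ → Bool) → Bool) × (ι → Bool) → ℂ) :
    fiberwise p.step (Ψ - Ψ') = fiberwise p.step Ψ - fiberwise p.step Ψ' := by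
  ext ⟨f, a⟩
  simp only [fiberwise_apply, fiber_sub, PhaseQuery.step, map_sub, Pi.sub_apply, Pi.add_apply]
  ring

/-- The exact step is a contraction, so an old error does not grow; the new error is at most `2 *
keepError κ k` times the norm of the approximation, which is at most `1 + e`. Hence `1 + e` grows by
the factor `1 + 2 * keepError κ k` per query. -/
lemma exists_lowDegree_evolution {k : ℕ} (ps : List (PhaseQuery ι κ))
    (hp : ∀ p ∈ ps, ∀ v, l2 (p.probe v) ≤ 2 * l2 v)
    (hiso : ∀ p ∈ ps, ∀ f v, l2 (p.step f v) ≤ l2 v)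
    {Ψ : ((κ → Bool) → Bool) × (ι → Bool) → ℂ} (hΨ : l2 Ψ ≤ 1)
    {Θ : Finset (κ → Bool) × (ι → Bool) → ℂ} (hΘ : LowDegree k Θ)
    {e : ℝ} (he : l2 (Ψ - synth Θ) ≤ e) :
    ∃ Θ', LowDegree k Θ' ∧
      l2 (fiberwise (fun f v => ps.foldl (fun w p => p.step f w) v) Ψ - synth Θ') ≤
        (1 + 2 * keepError κ k) ^ ps.length * (1 + e) - 1 := by
  induction ps generalizing Ψ Θ e with
  | nil =>
    have : fiberwise (fun f v => List.foldl (fun w (p : PhaseQuery ι κ) => p.step f w) v []) Ψ =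
      Ψ := rfl
    exact ⟨Θ, hΘ, by rw [this]; simpa using he⟩
  | cons p ps ih =>
    have hΨ' : l2 (fiberwise p.step Ψ) ≤ 1 := by
      exact (l2_fiberwise_le_self (hiso p (by simp)) Ψ).trans hΨ
    have hk := keepError_nonneg (κ := κ) k
    have hΘn : l2 Θ ≤ 1 + e := by
      rw [← l2_synth]
      have := l2_le_l2_add_sub (synth Θ) Ψ
      have h2 : l2 (synth Θ - Ψ) = l2 (Ψ - synth Θ) := by
        simp only [l2_eq_norm, WithLp.toLp_sub]; exact norm_sub_rev _ _
      linarith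
    have hstep : l2 (fiberwise p.step Ψ - synth (p.keepStep Θ)) ≤
        (1 + 2 * keepError κ k) * (1 + e) - 1 := by
      have e1 : fiberwise p.step Ψ - synth (p.keepStep Θ) = fiberwise p.step (Ψ - synth Θ) +
          (fiberwise p.step (synth Θ) - synth (p.keepStep Θ)) := by
        rw [fiberwise_step_sub]; abel
      rw [e1]
      refine (l2_add_le _ _).trans ?_
      have h1 := l2_step_synth_le p (hp p (by simp)) hΘ
      have h2 : l2 (fiberwise p.step (Ψ - synth Θ)) ≤ l2 (Ψ - synth Θ) :=
        l2_fiberwise_le_self (hiso p (by simp)) (Ψ - synth Θ)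
      have h3 := mul_le_mul_of_nonneg_left hΘn (mul_nonneg zero_le_two hk)
      linarith
    have hlow : LowDegree k (p.keepStep Θ) := by
      intro S a hS
      have h1 := lowDegree_fiberwise hΘ p.free S a hS
      have h2 := lowDegree_keepProj (lowDegree_fiberwise hΘ p.probe) p.register S a hS
      rw [PhaseQuery.keepStep, Pi.add_apply, h1, h2, add_zero]
    obtain ⟨Θ', h1, h2⟩ := ih (fun q hq => hp q (by simp [hq])) (fun q hq => hiso q (by simp [hq]))
      hΨ' hlow hstep
    refine ⟨Θ', h1, ?_⟩
    rw [List.length_cons, pow_succ]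
    calc _ ≤ _ := h2
      _ = _ := by ring

variable {m : Type} [Fintype m] [DecidableEq m]

/-- From states that are generated with `k` copies of a random phase state and with queries to
the projection onto it, hardly more than `k` copies of it can be extracted. -/
theorem sum_nsq_phaseProj_le {k : ℕ} (ps : List (PhaseQuery ι κ))
    (hp : ∀ p ∈ ps, ∀ v, l2 (p.probe v) ≤ 2 * l2 v)
    (hiso : ∀ p ∈ ps, ∀ f v, l2 (p.step f v) ≤ l2 v)
    {Θ : Finset (κ → Bool) × (ι → Bool) → ℂ} (hΘ : LowDegree k Θ) (hΘ1 : l2 Θ ≤ 1)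
    (u : m → κ ↪ ι) (hu : ∀ i i', i ≠ i' → ∀ j k, u i j ≠ u i' k)
    {η : ℝ} (hη : (1 + 2 * keepError κ k) ^ ps.length - 1 ≤ η) (hη1 : η ≤ 1) :
    ∑ f, ∑ i, nsq (phaseProj f (u i)
      (ps.foldl (fun w p => p.step f w) (fiber (synth Θ) f))) ≤
      k * (1 + Fintype.card m / dim κ) * (1 + 3 * η) +
        2 * Fintype.card m * (2 * keepError κ k + η) := by
  have hk := keepError_nonneg (κ := κ) k
  have hN := dim_pos (κ := κ)
  have hη0 : 0 ≤ η := by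
    have : (1 : ℝ) ≤ (1 + 2 * keepError κ k) ^ ps.length := one_le_pow₀ (by linarith)
    linarith
  obtain ⟨Θ', hL, hd⟩ := exists_lowDegree_evolution ps hp hiso (Ψ := synth Θ)
    (by rwa [l2_synth]) hΘ (e := 0) (by simp)
  set Ψ := fiberwise (fun f v => ps.foldl (fun w p => p.step f w) v) (synth Θ) with hΨdef
  have hd' : l2 (Ψ - synth Θ') ≤ η := by linarith
  have hfold : ∀ (qs : List (PhaseQuery ι κ)), (∀ p ∈ qs, ∀ f v, l2 (p.step f v) ≤ l2 v) →
      ∀ f v, l2 (qs.foldl (fun w p => p.step f w) v) ≤ l2 v := by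
    intro qs
    induction qs with
    | nil => intro _ f v; exact le_rfl
    | cons q qs ih =>
      intro h f v
      exact (ih (fun p hp => h p (by simp [hp])) f _).trans (h q (by simp) f v)
  have hΨ1 : l2 Ψ ≤ 1 := by
    have := l2_fiberwise_le_self (hfold ps hiso) (synth Θ)
    rw [l2_synth] at this
    exact this.trans hΘ1
  have hΘ' : l2 Θ' ≤ 1 + η := by
    rw [← l2_synth]
    have := l2_le_l2_add_sub (synth Θ') Ψ
    have h2 : l2 (synth Θ' - Ψ) = l2 (Ψ - synth Θ') := by
      simp only [l2_eq_norm, WithLp.toLp_sub]; exact norm_sub_rev _ _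
    linarith
  have hP : ∀ i (Φ : ((κ → Bool) → Bool) × (ι → Bool) → ℂ),
      l2 (fiberwise (fun f => phaseProj f (u i)) Φ) ≤ l2 Φ := fun i Φ =>
    l2_fiberwise_le_self (fun f v => Real.sqrt_le_sqrt (nsq_phaseProj_le f (u i) v)) Φ
  have hterm : ∀ i, nsq (fiberwise (fun f => phaseProj f (u i)) Ψ) ≤
      nsq (keepProj (u i) Θ') + 2 * (2 * keepError κ k + η) := by
    intro i
    have e1 : fiberwise (fun f => phaseProj f (u i)) Ψ = synth (keepProj (u i) Θ') +
        synth (shiftProj (u i) Θ' - keepProj (u i) Θ') +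
        fiberwise (fun f => phaseProj f (u i)) (Ψ - synth Θ') := by
      ext ⟨f, a⟩
      have : phaseProj f (u i) (fiber (synth Θ') f) a = synth (shiftProj (u i) Θ') (f, a) :=
        phaseProj_synth _ _ _ _
      simp only [fiberwise_apply, fiber_sub, map_sub, Pi.add_apply, Pi.sub_apply, this]
      ring
    have h1 : l2 (fiberwise (fun f => phaseProj f (u i)) Ψ) ≤
        l2 (keepProj (u i) Θ') + (2 * keepError κ k + η) := by
      rw [e1]
      refine (l2_add_le _ _).trans ?_
      have h2 := l2_add_le (synth (keepProj (u i) Θ'))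
        (synth (shiftProj (u i) Θ' - keepProj (u i) Θ'))
      rw [l2_synth, l2_synth] at h2
      have h3 := l2_shiftProj_sub_keepProj_le hL (u i)
      have h4 := hP i (Ψ - synth Θ')
      have h5 : keepError κ k * l2 Θ' ≤ keepError κ k * 2 := by gcongr; linarith
      unfold keepError at *
      linarith
    have h2 := (hP i Ψ).trans hΨ1
    rw [← l2_sq, ← l2_sq]
    have h3 := l2_nonneg (keepProj (u i) Θ')
    have h4 := l2_nonneg (fiberwise (fun f => phaseProj f (u i)) Ψ)
    -- In the second case both norms are at most `1`, so their squares differ by at most twice the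
    -- difference of the norms.
    by_cases hc : l2 (fiberwise (fun f => phaseProj f (u i)) Ψ) ≤ l2 (keepProj (u i) Θ')
    · nlinarith
    · push Not at hc
      nlinarith
  calc _ = ∑ i, nsq (fiberwise (fun f => phaseProj f (u i)) Ψ) := by
        rw [Finset.sum_comm]
        refine Finset.sum_congr rfl fun i _ => ?_
        rw [nsq_eq_sum_fiber]
        rfl
    _ ≤ ∑ i, (nsq (keepProj (u i) Θ') + 2 * (2 * keepError κ k + η)) :=
        Finset.sum_le_sum fun i _ => hterm i
    _ ≤ k * (1 + Fintype.card m / dim κ) * nsq Θ' +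
        2 * Fintype.card m * (2 * keepError κ k + η) := by
        rw [Finset.sum_add_distrib, Finset.sum_const, card_univ, nsmul_eq_mul]
        linarith [sum_nsq_keepProj_le hL u hu]
    _ ≤ _ := by
        have : nsq Θ' ≤ 1 + 3 * η := by
          rw [← l2_sq]; nlinarith [l2_nonneg Θ']
        have hc : 0 ≤ (k : ℝ) * (1 + Fintype.card m / dim κ) := by positivity
        nlinarith

end Evolution

end

section

/-! ## Circuits acting on pure states -/

section Circuits

variable {ι κ μ : Type} [Fintype ι] [DecidableEq ι] [Fintype κ] [DecidableEq κ]
  [Fintype μ] [DecidableEq μ]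

lemma sum_agree {M : Type} [AddCommMonoid M] (w : κ ↪ ι) (a : ι → Bool)
    (F : (ι → Bool) → M) :
    ∑ b, (if ∀ i, (∀ j, w j ≠ i) → a i = b i then F b else 0) = ∑ z, F (splice w z a) := by
  rw [← Finset.sum_filter]
  symm
  refine Finset.sum_bij' (fun z _ => splice w z a) (fun b _ => b ∘ w) ?_ ?_ ?_ ?_ ?_
  · intro z _
    simp only [Finset.mem_filter, Finset.mem_univ, true_and]
    exact fun i hi => (splice_of_not_mem _ _ _ hi).symm
  · simp
  · simp
  · intro b hb
    simp only [Finset.mem_filter, Finset.mem_univ, true_and] at hb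
    exact ((splice_eq_iff w (b ∘ w) a b).2 ⟨rfl, hb⟩).symm
  · simp

lemma onWires_mulVec (w : κ ↪ ι) (G : Op κ) (v : (ι → Bool) → ℂ) (a : ι → Bool) :
    (onWires w G).mulVec v a = ∑ z, G (a ∘ w) z * v (splice w z a) := by
  simp only [Matrix.mulVec, dotProduct, onWires, Matrix.of_apply, ite_mul, zero_mul]
  rw [sum_agree w a fun b => G (a ∘ w) (b ∘ w) * v b]
  simp

lemma controlled_mulVec (c : ι) (G : Op ι) (v : (ι → Bool) → ℂ) (a : ι → Bool) :
    (controlled c G).mulVec v a = if a c then G.mulVec v a else v a := by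
  simp only [Matrix.mulVec, dotProduct, controlled, Matrix.of_apply]
  split_ifs with h
  · rfl
  · simp [Matrix.one_apply]

/-- The sum over all assignments also runs over the entries at `w`, which are overwritten; this
redundancy is the factor `dim κ`. In this form partial traces can be handled by `sum_splice_swap`.
-/
lemma reduce_apply (w : κ ↪ ι) (ρ : Op ι) (x y : κ → Bool) :
    (dim κ : ℂ) * reduce w ρ x y = ∑ a, ρ (splice w x a) (splice w y a) := by
  have h1 : reduce w ρ x y = ∑ a : ι → Bool, if a ∘ w = x then ρ a (splice w y a) else 0 := by
    simp only [reduce, Matrix.of_apply]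
    refine Finset.sum_congr rfl fun a _ => ?_
    have : ∀ b : ι → Bool, (if a ∘ w = x ∧ b ∘ w = y ∧ ∀ i, (∀ j, w j ≠ i) → a i = b i
        then ρ a b else 0) = if ∀ i, (∀ j, w j ≠ i) → a i = b i then
          (if a ∘ w = x ∧ b ∘ w = y then ρ a b else 0) else 0 := by
      intro b; rw [← ite_and]; congr 1; exact propext (by tauto)
    simp only [this]
    rw [sum_agree w a fun b => if a ∘ w = x ∧ b ∘ w = y then ρ a b else 0]
    simp only [splice_comp]
    by_cases hx : a ∘ w = x <;> simp [hx]
  have h2 := sum_splice_swap w (fun a (_ : κ → Bool) =>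
    if a ∘ w = x then ρ a (splice w y a) else 0)
  rw [h1]
  simp only [Finset.sum_const, card_univ, nsmul_eq_mul, splice_comp, splice_splice] at h2
  rw [← Finset.mul_sum] at h2
  simpa using h2

lemma reduce_reduce (w : κ ↪ ι) (u : μ ↪ κ) (ρ : Op ι) :
    reduce u (reduce w ρ) = reduce (u.trans w) ρ := by
  ext x y
  have hμ : (dim μ : ℂ) ≠ 0 := by exact_mod_cast (dim_pos (κ := μ)).ne'
  have hκ : (dim κ : ℂ) ≠ 0 := by exact_mod_cast (dim_pos (κ := κ)).ne'
  refine mul_left_cancel₀ hκ (mul_left_cancel₀ hμ ?_)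
  rw [mul_left_comm, reduce_apply, Finset.mul_sum, mul_left_comm, reduce_apply]
  simp only [reduce_apply]
  rw [Finset.sum_comm]
  simp only [splice_trans]
  rw [sum_sum_splice w fun a => ρ (splice (u.trans w) x a) (splice (u.trans w) y a),
    nsmul_eq_mul]
  simp

/-- The density matrix of a pure state. -/
def pureState (v : (ι → Bool) → ℂ) : Op ι := Matrix.of fun a b => v a * (starRingEnd ℂ) (v b)

lemma mul_pureState_mul (V : Op ι) (v : (ι → Bool) → ℂ) :
    V * pureState v * V.conjTranspose = pureState (V.mulVec v) := by
  ext a b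
  simp only [pureState, Matrix.mul_apply, Matrix.of_apply, Matrix.conjTranspose_apply,
    Matrix.mulVec, dotProduct, map_sum, map_mul, Finset.sum_mul_sum]
  rw [Finset.sum_comm]
  simp only [Finset.sum_mul]
  refine Finset.sum_congr rfl fun c _ => Finset.sum_congr rfl fun d _ => ?_
  simp only [RCLike.star_def]; ring

lemma basisState_eq_pureState (x : ι → Bool) : basisState x = pureState (Pi.single x 1) := by
  ext a b
  simp only [basisState, pureState, Matrix.single_apply, Matrix.of_apply, Pi.single_apply]
  by_cases h1 : a = x <;> by_cases h2 : b = x <;> simp [h1, h2, eq_comm (a := x)]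

lemma tensor_pureState (v : (ι → Bool) → ℂ) (w : (κ → Bool) → ℂ) :
    tensor (pureState v) (pureState w) =
      pureState fun a => v (a ∘ Sum.inl) * w (a ∘ Sum.inr) := by
  ext a b
  simp only [tensor, pureState, Matrix.of_apply, map_mul]; ring

lemma tensorPow_pureState (k : ℕ) (v : (ι → Bool) → ℂ) :
    tensorPow k (pureState v) = pureState fun a => ∏ j : Fin k, v fun i => a (j, i) := by
  ext a b
  simp only [tensorPow, pureState, Matrix.of_apply, map_prod, Finset.prod_mul_distrib]

/-- The pure state of all wires at the end of a circuit. -/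
def runGates (U : QuantumOracle) (gs : List (Gate ι)) (v : (ι → Bool) → ℂ) : (ι → Bool) → ℂ :=
  gs.foldl (fun v g => (g.toOp U).mulVec v) v

lemma foldl_mul_mulVec (U : QuantumOracle) (gs : List (Gate ι)) (V : Op ι)
    (v : (ι → Bool) → ℂ) :
    (gs.foldl (fun V g => g.toOp U * V) V).mulVec v = runGates U gs (V.mulVec v) := by
  induction gs generalizing V with
  | nil => rfl
  | cons g gs ih => rw [List.foldl_cons, ih, ← Matrix.mulVec_mulVec]; rfl

/-- The initial state of the wires of a circuit on a pure input. -/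
def initState {n : ℕ} (v : (ι → Bool) → ℂ) (a : ι ⊕ Fin n → Bool) : ℂ :=
  v (a ∘ Sum.inl) * if a ∘ Sum.inr = fun _ => false then 1 else 0

lemma run_pureState (U : QuantumOracle) (C : QCircuit ι κ) (v : (ι → Bool) → ℂ) :
    C.run U (pureState v) = reduce C.out (pureState (runGates U C.gates (initState v))) := by
  rw [QCircuit.run, basisState_eq_pureState, tensor_pureState, mul_pureState_mul,
    QCircuit.unitary, foldl_mul_mulVec, Matrix.one_mulVec]
  congr 4
  ext a
  simp [initState, Pi.single_apply]

/-! ## Gates preserve the norm -/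

/-- Operators that preserve the norm. -/
def Isometric (G : Op ι) : Prop := ∀ v, nsq (G.mulVec v) = nsq v

lemma isometric_of_unitary (G : Matrix.unitaryGroup (ι → Bool) ℂ) : Isometric (G : Op ι) := by
  intro v
  have h : ∀ w : (ι → Bool) → ℂ, ((nsq w : ℝ) : ℂ) = dotProduct (star w) w := by
    intro w
    rw [nsq, Complex.ofReal_sum, dotProduct]
    refine Finset.sum_congr rfl fun a _ => ?_
    rw [Pi.star_apply, RCLike.star_def, Complex.conj_mul', Complex.ofReal_pow]
  have h2 : (G : Op ι).conjTranspose * (G : Op ι) = 1 := Matrix.UnitaryGroup.star_mul_self G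
  have : ((nsq ((G : Op ι).mulVec v) : ℝ) : ℂ) = (nsq v : ℝ) := by
    rw [h, h, Matrix.star_mulVec, ← Matrix.dotProduct_mulVec, Matrix.mulVec_mulVec, h2,
      Matrix.one_mulVec]
  exact_mod_cast this

lemma isometric_onWires (w : κ ↪ ι) {G : Op κ} (hG : Isometric G) : Isometric (onWires w G) := by
  intro v
  have hκ : (dim κ) ≠ 0 := (dim_pos (κ := κ)).ne'
  refine mul_left_cancel₀ hκ ?_
  have h1 := sum_splice_swap w (fun a (_ : κ → Bool) => ‖(onWires w G).mulVec v a‖ ^ 2)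
  have h2 : ∀ a, ∑ y, ‖(onWires w G).mulVec v (splice w y a)‖ ^ 2 =
      ∑ y, ‖v (splice w y a)‖ ^ 2 := by
    intro a
    have := hG fun z => v (splice w z a)
    simp only [nsq, Matrix.mulVec, dotProduct] at this
    simp only [onWires_mulVec, splice_comp, splice_splice]
    exact this
  simp only [h2, Finset.sum_const, card_univ, nsmul_eq_mul] at h1
  rw [sum_sum_splice w fun a => ‖v a‖ ^ 2, nsmul_eq_mul, ← Finset.mul_sum] at h1
  exact h1

lemma onWires_mulVec_ite (w : κ ↪ ι) (c : ι) (hc : ∀ j, w j ≠ c) (G : Op κ)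
    (v : (ι → Bool) → ℂ) (a : ι → Bool) :
    (onWires w G).mulVec (fun a => if a c then v a else 0) a =
      if a c then (onWires w G).mulVec v a else 0 := by
  simp only [onWires_mulVec, splice_of_not_mem w _ _ hc]
  split_ifs <;> simp

/-- The register of `G` avoids `c`, so applying `G` commutes with restricting to `c = 1`, and the
branches `c = 1` and `c = 0` are orthogonal. -/
lemma isometric_controlled (w : κ ↪ ι) (c : ι) (hc : ∀ j, w j ≠ c) {G : Op κ}
    (hG : Isometric G) : Isometric (controlled c (onWires w G)) := by
  intro v
  have h1 := isometric_onWires w hG fun a => if a c then v a else 0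
  have e1 : nsq ((controlled c (onWires w G)).mulVec v) =
      nsq ((onWires w G).mulVec fun a => if a c then v a else 0) +
        nsq fun a => if a c then 0 else v a := by
    simp only [nsq, ← Finset.sum_add_distrib, onWires_mulVec_ite w c hc, controlled_mulVec]
    refine Finset.sum_congr rfl fun a _ => ?_
    split_ifs <;> simp
  rw [e1, h1]
  simp only [nsq, ← Finset.sum_add_distrib]
  refine Finset.sum_congr rfl fun a _ => ?_
  split_ifs <;> simp

lemma sum_unit_bool {M : Type} [AddCommMonoid M] (F : (Unit → Bool) → M) :
    ∑ x, F x = F (fun _ => true) + F fun _ => false := by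
  rw [← Equiv.sum_comp (Equiv.funUnique Unit Bool).symm F, Fintype.sum_bool]; rfl

lemma isometric_hadamard : Isometric hadamardMatrix := by
  intro v
  simp only [nsq, Matrix.mulVec, dotProduct, sum_unit_bool, hadamardMatrix, Matrix.of_apply]
  set x := v fun _ => true
  set y := v fun _ => false
  have h := parallelogram_law_with_norm ℝ x y
  have e1 : (if (true && true) = true then (-1 : ℂ) else 1) / (√2 : ℂ) * x +
      (if (true && false) = true then (-1 : ℂ) else 1) / (√2 : ℂ) * y = -(x - y) / (√2 : ℂ) := by
    simp; ring
  have e2 : (if (false && true) = true then (-1 : ℂ) else 1) / (√2 : ℂ) * x +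
      (if (false && false) = true then (-1 : ℂ) else 1) / (√2 : ℂ) * y = (x + y) / (√2 : ℂ) := by
    simp; ring
  rw [e1, e2, norm_div, norm_div, norm_neg, div_pow, div_pow, Complex.norm_real,
    Real.norm_of_nonneg (Real.sqrt_nonneg _), Real.sq_sqrt zero_le_two]
  linarith

lemma isometric_t : Isometric tMatrix := by
  intro v
  simp only [nsq, tMatrix, Matrix.mulVec_diagonal, sum_unit_bool]
  have : ‖Complex.exp (Complex.I * Real.pi / 4)‖ = 1 := by
    rw [Complex.norm_exp]; simp
  simp [this]

lemma isometric_not : Isometric notMatrix := by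
  intro v
  have h : ((fun _ => false : Unit → Bool) = fun _ => true) ↔ False := by
    simp [funext_iff]
  simp [nsq, Matrix.mulVec, dotProduct, sum_unit_bool, notMatrix]
  ring

lemma isometric_call (U : QuantumOracle) (inverse : Bool) (m : ℕ) :
    Isometric (U.call inverse m) := by
  unfold QuantumOracle.call
  split_ifs
  · exact isometric_of_unitary _
  · exact isometric_of_unitary _

lemma isometric_gate (U : QuantumOracle) (g : Gate ι) : Isometric (g.toOp U) := by
  cases g with
  | hadamard i => exact isometric_onWires _ isometric_hadamard
  | t i => exact isometric_onWires _ isometric_t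
  | cnot c i h => exact isometric_controlled _ _ (fun _ => h) isometric_not
  | oracle inverse m w => exact isometric_onWires _ (isometric_call U _ _)
  | controlledOracle inverse c m w h => exact isometric_controlled _ _ h (isometric_call U _ _)

lemma l2_gate (U : QuantumOracle) (g : Gate ι) (v : (ι → Bool) → ℂ) :
    l2 ((g.toOp U).mulVec v) = l2 v := by
  rw [l2, isometric_gate, l2]

lemma l2_runGates (U : QuantumOracle) (gs : List (Gate ι)) (v : (ι → Bool) → ℂ) :
    l2 (runGates U gs v) = l2 v := by
  induction gs generalizing v with
  | nil => rfl
  | cons g gs ih => exact (ih _).trans (l2_gate U g v)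

lemma sum_sum_eq {M : Type} [AddCommMonoid M] (F : (ι ⊕ κ → Bool) → M) :
    ∑ a, F a = ∑ x, ∑ y, F (Sum.elim x y) := by
  rw [← Fintype.sum_prod_type', ← Equiv.sum_comp (Equiv.sumArrowEquivProdArrow ι κ Bool).symm F]
  rfl

lemma nsq_initState {n : ℕ} (v : (ι → Bool) → ℂ) : nsq (initState (n := n) v) = nsq v := by
  simp only [nsq, initState]
  rw [sum_sum_eq]
  refine Finset.sum_congr rfl fun x _ => ?_
  rw [Finset.sum_eq_single fun _ => false]
  · simp
  · intro y _ hy; simp [hy]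
  · simp

end Circuits

end

section

/-! ## The oracle -/

/-- Wires that hold a secret key: two parts that name a block, and a location in the block. -/
abbrev KeyIdx (d : ℕ) : Type := Fin (12 * d) ⊕ Fin (8 * d) ⊕ Fin (8 * d)

/-- Wires that hold a public key: the two parts that name a block, and a tag. -/
abbrev PubIdx (d : ℕ) : Type := Fin (12 * d) ⊕ Fin (8 * d) ⊕ Fin (12 * d)

/-- Wires of a bank query: secret key, public key, banknote. -/
abbrev BankIdx (d : ℕ) : Type := KeyIdx d ⊕ PubIdx d ⊕ Fin (12 * d)

/-- Wires of a verification query: public key, banknote, flag. -/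
abbrev VerIdx (d : ℕ) : Type := PubIdx d ⊕ Fin (12 * d) ⊕ Unit

/-- The sizes are balanced for circuits of size `q = 2 ^ d`. With `q ^ 8` columns and locations, `q`
queries find a random one with amplitude at most `q * q ^ (-4)`. With `q ^ 12` tags, a fresh tag is
already in use with probability at most `q ^ (-4)`. With `q ^ 12` rows there are enough independent
samples to beat the number of circuits. -/
abbrev Row (d : ℕ) : Type := Fin (12 * d) → Bool
abbrev Column (d : ℕ) : Type := Fin (8 * d) → Bool
abbrev Loc (d : ℕ) : Type := Fin (8 * d) → Bool
abbrev Tag (d : ℕ) : Type := Fin (12 * d) → Bool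
abbrev Phase (d : ℕ) : Type := (Fin (12 * d) → Bool) → Bool

/-- The data of one block: the tag of every location, and the phase function of every tag. -/
abbrev BlockData (d : ℕ) : Type := (Loc d → Tag d) × (Tag d → Phase d)

abbrev LevelData (d : ℕ) : Type := Row d × Column d → BlockData d

abbrev World : Type := (d : ℕ) → LevelData d

variable {d : ℕ}

def keyBlock (z : KeyIdx d → Bool) : Row d × Column d :=
  (z ∘ Sum.inl, z ∘ Sum.inr ∘ Sum.inl)

def keyLoc (z : KeyIdx d → Bool) : Loc d := z ∘ Sum.inr ∘ Sum.inr

def pubBlock (e : PubIdx d → Bool) : Row d × Column d :=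
  (e ∘ Sum.inl, e ∘ Sum.inr ∘ Sum.inl)

def pubTag (e : PubIdx d → Bool) : Tag d := e ∘ Sum.inr ∘ Sum.inr

def mkPub (b : Row d × Column d) (y : Tag d) : PubIdx d → Bool :=
  Sum.elim b.1 (Sum.elim b.2 y)

@[simp] lemma pubBlock_mkPub (b : Row d × Column d) (y : Tag d) : pubBlock (mkPub b y) = b := rfl

@[simp] lemma pubTag_mkPub (b : Row d × Column d) (y : Tag d) : pubTag (mkPub b y) = y := rfl

lemma mkPub_eta (e : PubIdx d → Bool) : mkPub (pubBlock e) (pubTag e) = e := by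
  ext i; rcases i with i | i | i <;> rfl

/-- The public key that belongs to a secret key. -/
def publicOf (D : LevelData d) (z : KeyIdx d → Bool) : PubIdx d → Bool :=
  mkPub (keyBlock z) ((D (keyBlock z)).1 (keyLoc z))

/-- The phase function of the banknotes that belong to a public key. -/
def phaseOf (D : LevelData d) (e : PubIdx d → Bool) : Phase d := (D (pubBlock e)).2 (pubTag e)

/-- The matrix of the Hadamard transformation of a register. -/
def walsh {κ : Type} [Fintype κ] [DecidableEq κ] (x y : κ → Bool) : ℂ :=
  chi (univ.filter fun i => x i = true) y / (√(dim κ) : ℂ)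

lemma sum_walsh_mul {κ : Type} [Fintype κ] [DecidableEq κ] (x x' : κ → Bool) :
    ∑ y, walsh x y * (starRingEnd ℂ) (walsh x' y) = if x = x' then 1 else 0 := by
  have hN := dim_pos (κ := κ)
  have h1 : ∀ y, walsh x y * (starRingEnd ℂ) (walsh x' y) =
      (chi (univ.filter fun i => x i = true) y * chi (univ.filter fun i => x' i = true) y) /
        (dim κ : ℂ) := by
    intro y
    rw [walsh, walsh, map_div₀, star_chi, Complex.conj_ofReal, div_mul_div_comm,
      ← Complex.ofReal_mul, Real.mul_self_sqrt hN.le]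
  simp only [h1, ← Finset.sum_div, sum_chi_mul_chi]
  have h2 : ((univ.filter fun i => x i = true) = univ.filter fun i => x' i = true) ↔ x = x' := by
    constructor
    · intro h
      ext i
      have := congrArg (i ∈ ·) h
      simp only [Finset.mem_filter, Finset.mem_univ, true_and, eq_iff_iff] at this
      exact Bool.eq_iff_iff.2 this
    · rintro rfl; rfl
  simp only [h2]
  split_ifs
  · exact div_self (by exact_mod_cast hN.ne')
  · simp

lemma walsh_false {κ : Type} [Fintype κ] [DecidableEq κ] (x : κ → Bool) :
    walsh x (fun _ => false) = 1 / (√(dim κ) : ℂ) := by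
  simp [walsh, chi, sgn]

/-- The bank's transformation: from a secret key, compute the public key and a banknote. -/
def bankMatrix (D : LevelData d) : Op (BankIdx d) := Matrix.of fun a b =>
  if a ∘ Sum.inl = b ∘ Sum.inl ∧ b ∘ Sum.inr ∘ Sum.inl =
      fun i => xor (a (Sum.inr (Sum.inl i))) (publicOf D (b ∘ Sum.inl) i) then
    sgn (phaseOf D (publicOf D (b ∘ Sum.inl)) (a ∘ Sum.inr ∘ Sum.inr)) *
      walsh (a ∘ Sum.inr ∘ Sum.inr) (b ∘ Sum.inr ∘ Sum.inr)
  else 0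

lemma sum_type_ext {ι κ : Type} {a b : ι ⊕ κ → Bool} :
    a = b ↔ a ∘ Sum.inl = b ∘ Sum.inl ∧ a ∘ Sum.inr = b ∘ Sum.inr := by
  constructor
  · rintro rfl; exact ⟨rfl, rfl⟩
  · rintro ⟨h1, h2⟩
    ext i
    rcases i with i | i
    · exact congrFun h1 i
    · exact congrFun h2 i

/-- The key is left unchanged; for each key the matrix is a permutation (xor with the public key) of
the second register, tensored with a Hadamard transformation followed by a diagonal of signs. -/
lemma bankMatrix_mem (D : LevelData d) :
    bankMatrix D ∈ Matrix.unitaryGroup (BankIdx d → Bool) ℂ := by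
  rw [Matrix.mem_unitaryGroup_iff]
  ext a a'
  rw [Matrix.mul_apply, sum_sum_eq]
  simp only [sum_sum_eq (ι := PubIdx d) (κ := Fin (12 * d)), Matrix.star_apply, bankMatrix, Matrix.of_apply, RCLike.star_def]
  obtain ⟨k, a, rfl⟩ : ∃ k a1, a = Sum.elim k a1 :=
    ⟨a ∘ Sum.inl, a ∘ Sum.inr, by ext i; rcases i with i | i <;> rfl⟩
  obtain ⟨p, x, rfl⟩ : ∃ k a1, a = Sum.elim k a1 :=
    ⟨a ∘ Sum.inl, a ∘ Sum.inr, by ext i; rcases i with i | i <;> rfl⟩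
  obtain ⟨k', a', rfl⟩ : ∃ k a1, a' = Sum.elim k a1 :=
    ⟨a' ∘ Sum.inl, a' ∘ Sum.inr, by ext i; rcases i with i | i <;> rfl⟩
  obtain ⟨p', x', rfl⟩ : ∃ k a1, a' = Sum.elim k a1 :=
    ⟨a' ∘ Sum.inl, a' ∘ Sum.inr, by ext i; rcases i with i | i <;> rfl⟩
  simp only [← Function.comp_assoc, Sum.elim_comp_inl, Sum.elim_comp_inr, Sum.elim_inr,
    Sum.elim_inl]
  rw [Finset.sum_eq_single k (fun b _ hb => by simp [hb.symm]) (by simp)]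
  rw [Finset.sum_eq_single (fun i => xor (p i) (publicOf D k i))
    (fun b _ hb => by simp [hb]) (by simp)]
  have hp : ((fun i => xor (p i) (publicOf D k i)) = fun i => xor (p' i) (publicOf D k i)) ↔
      p = p' := by
    constructor
    · intro h; ext i; simpa using congrFun h i
    · rintro rfl; rfl
  simp only [hp, and_true, if_true]
  rw [Matrix.one_apply]
  simp only [sum_type_ext (a := Sum.elim k (Sum.elim p x)), sum_type_ext (a := Sum.elim p x),
    Sum.elim_comp_inl, Sum.elim_comp_inr]
  by_cases hk : k' = k
  · subst hk
    by_cases hpp : p = p'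
    · subst hpp
      simp only [true_and, if_true, map_mul, star_sgn]
      have : ∀ y, sgn (phaseOf D (publicOf D k') x) * walsh x y *
          (sgn (phaseOf D (publicOf D k') x') * (starRingEnd ℂ) (walsh x' y)) =
          sgn (phaseOf D (publicOf D k') x) * sgn (phaseOf D (publicOf D k') x') *
          (walsh x y * (starRingEnd ℂ) (walsh x' y)) := fun y => by ring
      simp only [this, ← Finset.mul_sum, sum_walsh_mul]
      by_cases hx : x = x'
      · subst hx; simp
      · simp [hx]
    · simp [hpp]
  · simp [hk, Ne.symm hk]

/-- The verification: flip the flag if and only if the banknote is in the state that belongs to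
the public key. -/
def verMatrix (D : LevelData d) : Op (VerIdx d) := Matrix.of fun a b =>
  if a ∘ Sum.inl = b ∘ Sum.inl then
    (if a ∘ Sum.inr = b ∘ Sum.inr then 1 else 0) +
      sgn (phaseOf D (b ∘ Sum.inl) (a ∘ Sum.inr ∘ Sum.inl)) *
      sgn (phaseOf D (b ∘ Sum.inl) (b ∘ Sum.inr ∘ Sum.inl)) *
      (if a (Sum.inr (Sum.inr ())) = b (Sum.inr (Sum.inr ())) then -1 else 1) /
      (dim (Fin (12 * d)) : ℂ)
  else 0

/-- The wires of the banknote in a verification query. -/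
def verNote (d : ℕ) : Fin (12 * d) ↪ VerIdx d :=
  ⟨fun i => Sum.inr (Sum.inl i), fun i j h => by simpa using h⟩

@[simp] lemma verNote_apply (i : Fin (12 * d)) : verNote d i = Sum.inr (Sum.inl i) := rfl

/-- The effect of a NOT gate on an assignment. -/
def flipWire {ι : Type} [DecidableEq ι] (c : ι) (a : ι → Bool) : ι → Bool :=
  Function.update a c (!a c)

/-- The difference between a vector with a qubit flipped and the vector itself. -/
def flipDiff {ι : Type} [DecidableEq ι] (c : ι) :
    ((ι → Bool) → ℂ) →ₗ[ℂ] ((ι → Bool) → ℂ) where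
  toFun v a := v (flipWire c a) - v a
  map_add' v w := by ext a; simp; ring
  map_smul' r v := by ext a; simp; ring

lemma flipDiff_apply {ι : Type} [DecidableEq ι] (c : ι) (v : (ι → Bool) → ℂ) (a : ι → Bool) :
    flipDiff c v a = v (flipWire c a) - v a := rfl

/-- The matrix is `1 + P ⊗ (X - 1)`, where `P` is the projection onto the phase state of the public
key and `X` flips the flag. All uses of the verification go through this form. -/
lemma verMatrix_mulVec (D : LevelData d) (v : (VerIdx d → Bool) → ℂ) (a : VerIdx d → Bool) :
    (verMatrix D).mulVec v a =
      v a + phaseProj (phaseOf D (a ∘ Sum.inl)) (verNote d)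
        (flipDiff (Sum.inr (Sum.inr ())) v) a := by
  obtain ⟨p, a, rfl⟩ : ∃ k a1, a = Sum.elim k a1 :=
    ⟨a ∘ Sum.inl, a ∘ Sum.inr, by ext i; rcases i with i | i <;> rfl⟩
  obtain ⟨x, t, rfl⟩ : ∃ k a1, a = Sum.elim k a1 :=
    ⟨a ∘ Sum.inl, a ∘ Sum.inr, by ext i; rcases i with i | i <;> rfl⟩
  simp only [Matrix.mulVec, dotProduct]
  rw [sum_sum_eq]
  simp only [sum_sum_eq (ι := Fin (12 * d)) (κ := Unit), verMatrix, Matrix.of_apply]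
  simp only [← Function.comp_assoc, Sum.elim_comp_inl, Sum.elim_comp_inr, Sum.elim_inr]
  rw [Finset.sum_eq_single p (fun b _ hb => by simp [hb.symm]) (by simp)]
  simp only [if_true, add_mul, Finset.sum_add_distrib]
  congr 1
  · have : ∀ y s, ((Sum.elim x t : Fin (12 * d) ⊕ Unit → Bool) = Sum.elim y s) ↔
        x = y ∧ t = s := fun y s => by
      rw [sum_type_ext]; simp only [Sum.elim_comp_inl, Sum.elim_comp_inr]
    simp only [this]
    rw [Finset.sum_eq_single x (fun b _ hb => by simp [hb.symm]) (by simp)]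
    rw [Finset.sum_eq_single t (fun b _ hb => by simp [hb.symm]) (by simp)]
    simp
  · rw [phaseProj_apply, Finset.sum_div]
    refine Finset.sum_congr rfl fun y _ => ?_
    have e1 : splice (verNote d) y (Sum.elim p (Sum.elim x t)) = Sum.elim p (Sum.elim y t) := by
      symm
      refine eq_splice (fun j => rfl) fun i hi => ?_
      rcases i with i | i | i
      · rfl
      · exact absurd rfl (hi i)
      · rfl
    have e2 : (Sum.elim p (Sum.elim x t) : VerIdx d → Bool) ∘ verNote d = x := rfl
    have e3 : flipWire (Sum.inr (Sum.inr ())) (Sum.elim p (Sum.elim y t) : VerIdx d → Bool) =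
        Sum.elim p (Sum.elim y fun _ => !(t ())) := by
      ext i
      rcases i with i | i | i
      · simp [flipWire]
      · simp [flipWire]
      · simp [flipWire]
    rw [e1, e2, flipDiff_apply, e3, sum_unit_bool]
    obtain ⟨b, rfl⟩ : ∃ b, t = fun _ => b := ⟨t (), rfl⟩
    cases b <;> simp <;> ring

lemma phaseProj_phaseProj {ι κ : Type} [Fintype ι] [DecidableEq ι] [Fintype κ] [DecidableEq κ]
    (f : (κ → Bool) → Bool) (u : κ ↪ ι) (v : (ι → Bool) → ℂ) :
    phaseProj f u (phaseProj f u v) = phaseProj f u v := by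
  have hN : (dim κ : ℂ) ≠ 0 := by exact_mod_cast (dim_pos (κ := κ)).ne'
  ext a
  rw [phaseProj_apply]
  simp only [phaseProj_apply f u v, splice_comp, splice_splice, ← Finset.mul_sum, mul_assoc]
  have : ∀ y, sgn (f y) * (sgn (f y) * ∑ i, sgn (f i) * v (splice u i a) : ℂ) =
      ∑ i, sgn (f i) * v (splice u i a) := fun y => by rw [← mul_assoc]; simp
  simp only [← mul_div_assoc, this, Finset.sum_const, card_univ, nsmul_eq_mul]
  congr 1
  field_simp
  rw [show ((dim κ : ℝ) : ℂ) = (Fintype.card (κ → Bool) : ℂ) from Complex.ofReal_natCast _]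
  ring

/-- Since `P² = P` and `(X - 1)² = -2 (X - 1)`, the square of `1 + P (X - 1)` is `1`. -/
lemma verMatrix_mul_self (D : LevelData d) : verMatrix D * verMatrix D = 1 := by
  refine Matrix.mulVec_injective ?_
  ext v a
  rw [← Matrix.mulVec_mulVec, Matrix.one_mulVec, verMatrix_mulVec]
  set f := phaseOf D (a ∘ Sum.inl)
  set c : VerIdx d := Sum.inr (Sum.inr ())
  have hflip : ∀ b : VerIdx d → Bool, flipWire c b ∘ Sum.inl = b ∘ Sum.inl := fun b => by
    ext i; simp [flipWire, c]
  have hflip2 : ∀ b : VerIdx d → Bool, flipWire c (flipWire c b) = b := fun b => by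
    ext i; by_cases hi : i = c <;> simp [flipWire, hi]
  have hflip3 : ∀ b : VerIdx d → Bool, flipWire c b ∘ verNote d = b ∘ verNote d := fun b => by
    ext i; simp [flipWire, c]
  have hsp : ∀ (b : VerIdx d → Bool) y,
      splice (verNote d) y (flipWire c b) = flipWire c (splice (verNote d) y b) := by
    intro b y
    symm
    refine eq_splice (fun j => ?_) fun i hi => ?_
    · have : (verNote d) j ≠ c := by simp [c]
      rw [flipWire, Function.update_of_ne this, splice_apply]
    · by_cases hic : i = c
      · subst hic; simp [flipWire, splice_of_not_mem _ _ _ hi]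
      · simp [flipWire, hic, splice_of_not_mem _ _ _ hi]
  have hinl : ∀ (b : VerIdx d → Bool) y, splice (verNote d) y b ∘ Sum.inl = b ∘ Sum.inl :=
    fun b y => splice_comp_of_disjoint _ _ (by simp) y b
  have hfd : ∀ b : VerIdx d → Bool, b ∘ Sum.inl = a ∘ Sum.inl →
      flipDiff c ((verMatrix D).mulVec v) b =
        flipDiff c v b - 2 * phaseProj f (verNote d) (flipDiff c v) b := by
    intro b hb
    rw [flipDiff_apply, verMatrix_mulVec, verMatrix_mulVec, hflip, hb, flipDiff_apply]
    have : phaseProj f (verNote d) (flipDiff c v) (flipWire c b) =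
        -phaseProj f (verNote d) (flipDiff c v) b := by
      rw [phaseProj_apply, phaseProj_apply, hflip3, ← neg_div, ← Finset.sum_neg_distrib]
      congr 1
      refine Finset.sum_congr rfl fun y _ => ?_
      rw [hsp, flipDiff_apply, flipDiff_apply, hflip2]; ring
    rw [this]; ring
  have h2 : phaseProj f (verNote d) (flipDiff c ((verMatrix D).mulVec v)) a =
      phaseProj f (verNote d) (flipDiff c v - (2 : ℂ) •
        phaseProj f (verNote d) (flipDiff c v)) a := by
    rw [phaseProj_apply, phaseProj_apply]
    congr 1
    refine Finset.sum_congr rfl fun y _ => ?_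
    rw [hfd _ (hinl a y)]
    simp
  rw [verMatrix_mulVec, h2, map_sub, map_smul, phaseProj_phaseProj]
  simp only [Pi.sub_apply, Pi.smul_apply, smul_eq_mul]
  ring

lemma verMatrix_conjTranspose (D : LevelData d) : (verMatrix D).conjTranspose = verMatrix D := by
  ext a b
  rw [Matrix.conjTranspose_apply]
  simp only [verMatrix, Matrix.of_apply, RCLike.star_def]
  by_cases h : a ∘ Sum.inl = b ∘ Sum.inl
  · simp only [h, if_true, map_add, map_div₀, map_mul, star_sgn, Complex.conj_ofReal,
      eq_comm (a := b ∘ Sum.inr), eq_comm (a := b (Sum.inr (Sum.inr ())))]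
    rw [mul_comm (sgn _) (sgn _)]
    split_ifs <;> simp
  · simp [h, Ne.symm h]

lemma verMatrix_mem (D : LevelData d) :
    verMatrix D ∈ Matrix.unitaryGroup (VerIdx d → Bool) ℂ := by
  rw [Matrix.mem_unitaryGroup_iff, Matrix.star_eq_conjTranspose, verMatrix_conjTranspose,
    verMatrix_mul_self]

end

section

/-! ### Assembling the level transformations into an oracle indexed by the number of qubits. -/

section Reindex

variable {ι κ μ : Type} [Fintype ι] [DecidableEq ι] [Fintype κ] [DecidableEq κ]
  [Fintype μ] [DecidableEq μ]

/-- Renaming the qubits of a unitary transformation. -/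
def reindexU (e : μ ≃ κ) (G : Matrix.unitaryGroup (κ → Bool) ℂ) :
    Matrix.unitaryGroup (μ → Bool) ℂ :=
  ⟨(G : Op κ).submatrix (e.arrowCongr (Equiv.refl Bool)) (e.arrowCongr (Equiv.refl Bool)), by
    rw [Matrix.mem_unitaryGroup_iff, Matrix.star_eq_conjTranspose, Matrix.conjTranspose_submatrix,
      Matrix.submatrix_mul_equiv, ← Matrix.star_eq_conjTranspose,
      Matrix.mem_unitaryGroup_iff.1 G.2, Matrix.submatrix_one_equiv]⟩

lemma reindexU_apply (e : μ ≃ κ) (G : Matrix.unitaryGroup (κ → Bool) ℂ) (a b : μ → Bool) :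
    (reindexU e G : Op μ) a b = (G : Op κ) (a ∘ e.symm) (b ∘ e.symm) := rfl

lemma reindexU_inv (e : μ ≃ κ) (G : Matrix.unitaryGroup (κ → Bool) ℂ) :
    (reindexU e G)⁻¹ = reindexU e G⁻¹ := by
  refine Subtype.ext ?_
  ext a b
  rfl

lemma onWires_reindexU (e : μ ≃ κ) (w : μ ↪ ι) (G : Matrix.unitaryGroup (κ → Bool) ℂ) :
    onWires w (reindexU e G : Op μ) = onWires (e.symm.toEmbedding.trans w) (G : Op κ) := by
  ext a b
  simp only [onWires, Matrix.of_apply, reindexU_apply]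
  have : ∀ i, (∀ j, w j ≠ i) ↔ ∀ j, (e.symm.toEmbedding.trans w) j ≠ i := fun i =>
    ⟨fun h j => h _, fun h j => by simpa using h (e j)⟩
  simp only [this]
  rfl

end Reindex

variable {d : ℕ}

/-- The wires of the bank's oracle transformation. -/
def bankEquiv {m : ℕ} (h : 72 * d = m) : Fin m ≃ BankIdx d :=
  (Fintype.equivFinOfCardEq (by simp only [Fintype.card_sum, Fintype.card_fin]; omega)).symm

/-- The wires of the verification oracle transformation. -/
def verEquiv {m : ℕ} (h : 44 * d + 1 = m) : Fin m ≃ VerIdx d :=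
  (Fintype.equivFinOfCardEq
    (by simp only [Fintype.card_sum, Fintype.card_fin, Fintype.card_unit]; omega)).symm

/-- The oracle that belongs to a world. -/
def oracleOf (D : World) : QuantumOracle := fun m =>
  if h : 72 * (m / 72) = m then reindexU (bankEquiv h) ⟨bankMatrix (D (m / 72)), bankMatrix_mem _⟩
  else if h : 44 * ((m - 1) / 44) + 1 = m then
    reindexU (verEquiv h) ⟨verMatrix (D ((m - 1) / 44)), verMatrix_mem _⟩
  else 1

lemma oracleOf_bank (D : World) {m : ℕ} (h : 72 * d = m) :
    oracleOf D m = reindexU (bankEquiv h) ⟨bankMatrix (D d), bankMatrix_mem _⟩ := by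
  have h1 : m / 72 = d := by omega
  subst h1
  rw [oracleOf, dif_pos h]

lemma oracleOf_ver (D : World) {m : ℕ} (h : 44 * d + 1 = m) :
    oracleOf D m = reindexU (verEquiv h) ⟨verMatrix (D d), verMatrix_mem _⟩ := by
  have h1 : (m - 1) / 44 = d := by omega
  subst h1
  -- A multiple of `72` is even and `44 * d + 1` is odd, so no number of qubits serves both
  -- purposes.
  rw [oracleOf, dif_neg (by omega), dif_pos h]

/-- The three kinds of oracle transformations. -/
lemma oracleOf_cases (m : ℕ) : (∃ d, 72 * d = m) ∨ (∃ d, 44 * d + 1 = m) ∨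
    ∀ D, oracleOf D m = 1 := by
  by_cases h : 72 * (m / 72) = m
  · exact Or.inl ⟨_, h⟩
  · by_cases h' : 44 * ((m - 1) / 44) + 1 = m
    · exact Or.inr (Or.inl ⟨_, h'⟩)
    · exact Or.inr (Or.inr fun D => by rw [oracleOf, dif_neg h, dif_neg h'])

/-! ### The dependence of a gate on the oracle data. -/

section Gates

variable {ι : Type} [Fintype ι] [DecidableEq ι]

/-- Control by an optional wire. -/
def optControlled (c : Option ι) (G : Op ι) : Op ι :=
  match c with
  | none => G
  | some c => controlled c G

lemma optControlled_mulVec (c : Option ι) (G : Op ι) (v : (ι → Bool) → ℂ) (a : ι → Bool) :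
    (optControlled c G).mulVec v a =
      if ∀ i ∈ c, a i = true then G.mulVec v a else v a := by
  cases c with
  | none => simp [optControlled]
  | some c => simp [optControlled, controlled_mulVec]

lemma optControlled_apply (c : Option ι) (G : Op ι) (a b : ι → Bool) :
    optControlled c G a b = if ∀ i ∈ c, a i = true then G a b else (1 : Op ι) a b := by
  cases c with
  | none => simp [optControlled]
  | some c => simp [optControlled, controlled]

/-- The effect of a gate on the space of all wires, by kind of gate. -/
inductive GateForm (g : Gate ι) : Prop
  | const (G : Op ι) (h : ∀ D, g.toOp (oracleOf D) = G)
  | bank (d : ℕ) (w : BankIdx d ↪ ι) (c : Option ι) (hc : ∀ i ∈ c, ∀ j, w j ≠ i)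
      (h : ∀ D, g.toOp (oracleOf D) = optControlled c (onWires w (bankMatrix (D d))))
  | bankInv (d : ℕ) (w : BankIdx d ↪ ι) (c : Option ι) (hc : ∀ i ∈ c, ∀ j, w j ≠ i)
      (h : ∀ D, g.toOp (oracleOf D) =
        optControlled c (onWires w (bankMatrix (D d)).conjTranspose))
  | ver (d : ℕ) (w : VerIdx d ↪ ι) (c : Option ι) (hc : ∀ i ∈ c, ∀ j, w j ≠ i)
      (h : ∀ D, g.toOp (oracleOf D) = optControlled c (onWires w (verMatrix (D d))))

lemma gateForm_of_call (g : Gate ι) (inverse : Bool) (m : ℕ) (w : Fin m ↪ ι) (c : Option ι)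
    (hc : ∀ i ∈ c, ∀ j, w j ≠ i) (hg : ∀ D, g.toOp (oracleOf D) =
      optControlled c (onWires w ((oracleOf D).call inverse m))) : GateForm g := by
  rcases oracleOf_cases m with ⟨d, hd⟩ | ⟨d, hd⟩ | h1
  · cases inverse with
    | false =>
      refine .bank d ((bankEquiv hd).symm.toEmbedding.trans w) c (fun i hi j => hc i hi _)
        fun D => ?_
      rw [hg, QuantumOracle.call, if_neg (by simp), oracleOf_bank D hd, onWires_reindexU]
    | true =>
      refine .bankInv d ((bankEquiv hd).symm.toEmbedding.trans w) c (fun i hi j => hc i hi _)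
        fun D => ?_
      rw [hg, QuantumOracle.call, if_pos rfl, oracleOf_bank D hd, reindexU_inv, onWires_reindexU]
      rfl
  · refine .ver d ((verEquiv hd).symm.toEmbedding.trans w) c (fun i hi j => hc i hi _)
      fun D => ?_
    cases inverse with
    | false =>
      rw [hg, QuantumOracle.call, if_neg (by simp), oracleOf_ver D hd, onWires_reindexU]
    | true =>
      rw [hg, QuantumOracle.call, if_pos rfl, oracleOf_ver D hd, reindexU_inv, onWires_reindexU]
      congr 2
      exact verMatrix_conjTranspose _
  · refine .const (optControlled c (onWires w 1)) fun D => ?_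
    rw [hg, QuantumOracle.call, h1]
    simp

lemma gateForm (g : Gate ι) : GateForm g := by
  cases g with
  | hadamard i => exact .const _ fun _ => rfl
  | t i => exact .const _ fun _ => rfl
  | cnot c i h => exact .const _ fun _ => rfl
  | oracle inverse m w => exact gateForm_of_call _ inverse m w none (by simp) fun D => rfl
  | controlledOracle inverse c m w h =>
    exact gateForm_of_call _ inverse m w (some c) (by simpa using h) fun D => rfl

/-- A query at level `d` occupies at least `d` distinct wires, so a circuit cannot reach levels
beyond its number of wires. -/
lemma gate_congr (g : Gate ι) {D D' : World} (h : ∀ d ≤ Fintype.card ι, D d = D' d) :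
    g.toOp (oracleOf D) = g.toOp (oracleOf D') := by
  rcases gateForm g with ⟨G, hG⟩ | ⟨d, w, c, hc, hG⟩ | ⟨d, w, c, hc, hG⟩ | ⟨d, w, c, hc, hG⟩
  · rw [hG, hG]
  all_goals
    have := Fintype.card_le_of_injective w w.injective
    simp only [Fintype.card_sum, Fintype.card_fin, Fintype.card_unit] at this
    rw [hG, hG, h d (by omega)]

lemma runGates_congr (gs : List (Gate ι)) {D D' : World}
    (h : ∀ d ≤ Fintype.card ι, D d = D' d) (v : (ι → Bool) → ℂ) :
    runGates (oracleOf D) gs v = runGates (oracleOf D') gs v := by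
  simp only [runGates, gate_congr _ h]

/-! ## The places where a gate reads the data of a level -/

/-- An oracle query at level `d` reads the data at a secret key or at a public key. -/
abbrev Addr (d : ℕ) : Type := (KeyIdx d → Bool) ⊕ (PubIdx d → Bool)

/-- A bank query uses both the public key and the phase function behind it, so both must agree; a
verification query uses the phase function only. Agreement makes the corresponding columns of the
oracle matrices equal. -/
def AgreeAt (D D' : LevelData d) : Addr d → Prop
  | .inl z => publicOf D z = publicOf D' z ∧
      phaseOf D (publicOf D z) = phaseOf D' (publicOf D' z)
  | .inr e => phaseOf D e = phaseOf D' e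

lemma bankMatrix_congr {D D' : LevelData d} {b : BankIdx d → Bool}
    (h : AgreeAt D D' (.inl (b ∘ Sum.inl))) (a : BankIdx d → Bool) :
    bankMatrix D a b = bankMatrix D' a b := by
  have h1 : publicOf D (b ∘ Sum.inl) = publicOf D' (b ∘ Sum.inl) := h.1
  have h2 : phaseOf D (publicOf D (b ∘ Sum.inl)) = phaseOf D' (publicOf D' (b ∘ Sum.inl)) := h.2
  rw [h1] at h2
  simp only [bankMatrix, Matrix.of_apply, h1, h2]

/-- The bank preserves the key register, so a nonzero entry has the same key on both sides and it
does not matter which side is prescribed. -/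
lemma bankMatrix_conjTranspose_congr {D D' : LevelData d} {b : BankIdx d → Bool}
    (h : AgreeAt D D' (.inl (b ∘ Sum.inl))) (a : BankIdx d → Bool) :
    (bankMatrix D).conjTranspose a b = (bankMatrix D').conjTranspose a b := by
  simp only [Matrix.conjTranspose_apply]
  congr 1
  by_cases hab : b ∘ Sum.inl = a ∘ Sum.inl
  · rw [hab] at h
    exact bankMatrix_congr h b
  · simp [bankMatrix, hab]

lemma verMatrix_congr {D D' : LevelData d} {b : VerIdx d → Bool}
    (h : AgreeAt D D' (.inr (b ∘ Sum.inl))) (a : VerIdx d → Bool) :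
    verMatrix D a b = verMatrix D' a b := by
  have h' : phaseOf D (b ∘ Sum.inl) = phaseOf D' (b ∘ Sum.inl) := h
  simp only [verMatrix, Matrix.of_apply, h']

/-- Each oracle matrix uses its key or public key register only as a control, so its column at a
basis state depends on the data at a single address. -/
lemma exists_addr (d : ℕ) (g : Gate ι) : ∃ addr : (ι → Bool) → Option (Addr d),
    ∀ D D' : World, (∀ d', d' ≠ d → D d' = D' d') → ∀ a b,
      (∀ x ∈ addr b, AgreeAt (D d) (D' d) x) →
        g.toOp (oracleOf D) a b = g.toOp (oracleOf D') a b := by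
  rcases gateForm g with ⟨G, hG⟩ | ⟨d', w, c, hc, hG⟩ | ⟨d', w, c, hc, hG⟩ | ⟨d', w, c, hc, hG⟩
  · exact ⟨fun _ => none, fun D D' _ a b _ => by rw [hG, hG]⟩
  all_goals
    by_cases hd : d' = d
    swap
    · exact ⟨fun _ => none, fun D D' h a b _ => by rw [hG, hG, h d' hd]⟩
    subst hd
  · refine ⟨fun b => some (.inl (b ∘ w ∘ Sum.inl)), fun D D' _ a b h => ?_⟩
    rw [hG, hG, optControlled_apply, optControlled_apply, onWires, onWires, Matrix.of_apply,
      Matrix.of_apply, bankMatrix_congr (h _ rfl)]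
  · refine ⟨fun b => some (.inl (b ∘ w ∘ Sum.inl)), fun D D' _ a b h => ?_⟩
    rw [hG, hG, optControlled_apply, optControlled_apply, onWires, onWires, Matrix.of_apply,
      Matrix.of_apply, bankMatrix_conjTranspose_congr (h _ rfl)]
  · refine ⟨fun b => some (.inr (b ∘ w ∘ Sum.inl)), fun D D' _ a b h => ?_⟩
    rw [hG, hG, optControlled_apply, optControlled_apply, onWires, onWires, Matrix.of_apply,
      Matrix.of_apply, verMatrix_congr (h _ rfl)]

/-- The data that a gate reads, by assignment of the wires. -/
def addr (d : ℕ) (g : Gate ι) : (ι → Bool) → Option (Addr d) := (exists_addr d g).choose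

lemma toOp_apply_congr (g : Gate ι) {D D' : World} (h : ∀ d', d' ≠ d → D d' = D' d')
    (a b : ι → Bool) (hb : ∀ x ∈ addr d g b, AgreeAt (D d) (D' d) x) :
    g.toOp (oracleOf D) a b = g.toOp (oracleOf D') a b :=
  (exists_addr d g).choose_spec D D' h a b hb

/-- The part of a state on which a gate reads data in `Δ`. -/
def readPart (Δ : Set (Addr d)) (g : Gate ι) (v : (ι → Bool) → ℂ) : (ι → Bool) → ℂ :=
  open Classical in fun b => if ∃ x ∈ addr d g b, x ∈ Δ then v b else 0

/-- The two matrices have equal columns at all basis states that read outside `Δ`, so only `readPart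
Δ g v` contributes to the difference; both gates preserve its norm. -/
lemma l2_gate_sub_le (g : Gate ι) {D D' : World} (h : ∀ d', d' ≠ d → D d' = D' d')
    {Δ : Set (Addr d)} (hΔ : ∀ x ∉ Δ, AgreeAt (D d) (D' d) x) (v : (ι → Bool) → ℂ) :
    l2 ((g.toOp (oracleOf D')).mulVec v - (g.toOp (oracleOf D)).mulVec v) ≤
      2 * l2 (readPart Δ g v) := by
  have e : (g.toOp (oracleOf D')).mulVec v - (g.toOp (oracleOf D)).mulVec v =
      (g.toOp (oracleOf D')).mulVec (readPart Δ g v) -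
        (g.toOp (oracleOf D)).mulVec (readPart Δ g v) := by
    rw [← Matrix.sub_mulVec, ← Matrix.sub_mulVec]
    ext a
    simp only [Matrix.mulVec, dotProduct, Matrix.sub_apply]
    refine Finset.sum_congr rfl fun b _ => ?_
    by_cases hb : ∃ x ∈ addr d g b, x ∈ Δ
    · simp only [readPart, hb, if_true]
    · have : g.toOp (oracleOf D) a b = g.toOp (oracleOf D') a b :=
        toOp_apply_congr g h a b fun x hx => hΔ x fun hxΔ => hb ⟨x, hx, hxΔ⟩
      rw [this, sub_self, zero_mul, zero_mul]
  rw [e]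
  refine (l2_sub_le _ _).trans ?_
  rw [l2_gate, l2_gate]
  linarith

/-- The total amplitude with which the gates of a circuit read data in `Δ`. -/
def readAmplitude (U : QuantumOracle) (Δ : Set (Addr d)) :
    List (Gate ι) → ((ι → Bool) → ℂ) → ℝ
  | [], _ => 0
  | g :: gs, v => l2 (readPart Δ g v) + readAmplitude U Δ gs ((g.toOp U).mulVec v)

lemma runGates_cons (U : QuantumOracle) (g : Gate ι) (gs : List (Gate ι)) (v : (ι → Bool) → ℂ) :
    runGates U (g :: gs) v = runGates U gs ((g.toOp U).mulVec v) := rfl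

lemma runGates_sub (U : QuantumOracle) (gs : List (Gate ι)) (v w : (ι → Bool) → ℂ) :
    runGates U gs (v - w) = runGates U gs v - runGates U gs w := by
  induction gs generalizing v w with
  | nil => rfl
  | cons g gs ih =>
    rw [runGates_cons, runGates_cons, runGates_cons, Matrix.mulVec_sub, ih]

/-- The hybrid argument. -/
lemma l2_runGates_sub_le (gs : List (Gate ι)) {D D' : World} (h : ∀ d', d' ≠ d → D d' = D' d')
    {Δ : Set (Addr d)} (hΔ : ∀ x ∉ Δ, AgreeAt (D d) (D' d) x) (v : (ι → Bool) → ℂ) :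
    l2 (runGates (oracleOf D') gs v - runGates (oracleOf D) gs v) ≤
      2 * readAmplitude (oracleOf D) Δ gs v := by
  induction gs generalizing v with
  | nil => simp [runGates, readAmplitude]
  | cons g gs ih =>
    -- The error of the first gate is propagated isometrically under `D'`, and the remaining gates
    -- are compared on the state of the run under `D`. Thus reads are measured only along the run
    -- under `D`, which allows `D'` to be random.
    have e : runGates (oracleOf D') (g :: gs) v - runGates (oracleOf D) (g :: gs) v =
        runGates (oracleOf D') gs ((g.toOp (oracleOf D')).mulVec v -
          (g.toOp (oracleOf D)).mulVec v) +
        (runGates (oracleOf D') gs ((g.toOp (oracleOf D)).mulVec v) -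
          runGates (oracleOf D) gs ((g.toOp (oracleOf D)).mulVec v)) := by
      rw [runGates_sub, sub_add_sub_cancel]
      rfl
    rw [e, readAmplitude]
    refine (l2_add_le _ _).trans ?_
    rw [l2_runGates]
    linarith [ih ((g.toOp (oracleOf D)).mulVec v), l2_gate_sub_le g h hΔ v]

/-- The state `v` does not depend on `ω`, and each basis state reads at most one address, which lies
in `Δ ω` with probability at most `c`. So the expected squared norm is at most `c * nsq v`; the
square root comes from Cauchy–Schwarz. -/
lemma expect_l2_readPart_le {Ω : Type} [Fintype Ω] [Nonempty Ω] (Δ : Ω → Set (Addr d)) {c : ℝ}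
    (hΔ : ∀ x, 𝔼 ω, (open Classical in if x ∈ Δ ω then (1 : ℝ) else 0) ≤ c)
    (g : Gate ι) (v : (ι → Bool) → ℂ) :
    𝔼 ω, l2 (readPart (Δ ω) g v) ≤ √c * l2 v := by
  classical
  -- Any address serves here; `c` bounds a probability.
  have hc : 0 ≤ c := (Finset.expect_nonneg fun ω _ => by split_ifs <;> simp).trans
    (hΔ (.inl fun _ => false))
  have h1 : 𝔼 ω, nsq (readPart (Δ ω) g v) ≤ c * nsq v := by
    simp only [nsq]
    rw [Finset.expect_sum_comm, Finset.mul_sum]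
    refine Finset.sum_le_sum fun b _ => ?_
    cases hb : addr d g b with
    | none => simp [readPart, hb]; positivity
    | some x =>
      have : ∀ ω, ‖readPart (Δ ω) g v b‖ ^ 2 = (if x ∈ Δ ω then (1 : ℝ) else 0) * ‖v b‖ ^ 2 := by
        intro ω
        simp only [readPart, hb]
        by_cases hx : x ∈ Δ ω <;> simp [hx]
      simp only [this]
      rw [← Finset.expect_mul]
      refine mul_le_mul_of_nonneg_right ?_ (by positivity)
      convert hΔ x
  have h2 : (𝔼 ω, l2 (readPart (Δ ω) g v)) ^ 2 ≤ 𝔼 ω, nsq (readPart (Δ ω) g v) := by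
    simp only [Fintype.expect_eq_sum_div_card, ← l2_sq]
    have hcard : (0 : ℝ) < Fintype.card Ω := by exact_mod_cast Fintype.card_pos
    rw [div_pow, div_le_div_iff₀ (by positivity) hcard]
    have := sq_sum_le_card_mul_sum_sq (s := univ) (f := fun ω => l2 (readPart (Δ ω) g v))
    rw [card_univ] at this
    nlinarith
  have h3 := h2.trans h1
  rw [← l2_sq, ← Real.sq_sqrt hc, ← mul_pow] at h3
  exact abs_le_of_sq_le_sq' h3 (mul_nonneg (Real.sqrt_nonneg _) (l2_nonneg _)) |>.2

lemma expect_readAmplitude_le {Ω : Type} [Fintype Ω] [Nonempty Ω] (Δ : Ω → Set (Addr d)) {c : ℝ}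
    (hΔ : ∀ x, 𝔼 ω, (open Classical in if x ∈ Δ ω then (1 : ℝ) else 0) ≤ c)
    (U : QuantumOracle) (gs : List (Gate ι)) (v : (ι → Bool) → ℂ) :
    𝔼 ω, readAmplitude U (Δ ω) gs v ≤ gs.length * √c * l2 v := by
  induction gs generalizing v with
  | nil => simp [readAmplitude]
  | cons g gs ih =>
    simp only [readAmplitude]
    rw [Finset.expect_add_distrib]
    have h1 := expect_l2_readPart_le Δ hΔ g v
    have h2 := ih ((g.toOp U).mulVec v)
    rw [l2_gate] at h2
    rw [List.length_cons]
    push_cast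
    linarith

end Gates

end

section

variable {d : ℕ}

/-! ## Counterfeiters and the number of valid banknotes that they produce -/

/-- A counterfeiter for the scheme at level `d`. -/
abbrev Forger (d k r : ℕ) : Type :=
  QCircuit (Fin (32 * d) ⊕ (Fin k × Fin (12 * d))) (Fin (k + r) × Fin (12 * d))

/-- The wires of a counterfeiter. -/
abbrev ForgerWires (d k m : ℕ) : Type := (Fin (32 * d) ⊕ (Fin k × Fin (12 * d))) ⊕ Fin m

/-- The wires of a public key. -/
def pubEquiv (d : ℕ) : Fin (32 * d) ≃ PubIdx d :=
  (Fintype.equivFinOfCardEq (by simp only [Fintype.card_sum, Fintype.card_fin]; omega)).symm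

/-- The amplitudes of the state of a banknote. -/
def phaseState {κ : Type} [Fintype κ] [DecidableEq κ] (f : (κ → Bool) → Bool) (x : κ → Bool) : ℂ :=
  sgn (f x) / (√(dim κ) : ℂ)

/-- The input of a counterfeiter. -/
def forgerInput (k : ℕ) (e : PubIdx d → Bool) (f : Phase d)
    (a : Fin (32 * d) ⊕ (Fin k × Fin (12 * d)) → Bool) : ℂ :=
  (if a ∘ Sum.inl = e ∘ pubEquiv d then 1 else 0) *
    ∏ j, phaseState f fun i => a (Sum.inr (j, i))

variable {k r : ℕ}

/-- The wires of a register that the counterfeiter outputs. -/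
def noteReg (C : Forger d k r) (i : Fin (k + r)) :
    Fin (12 * d) ↪ ForgerWires d k C.ancillas :=
  (Function.Embedding.sectR i _).trans C.out

lemma noteReg_ne (C : Forger d k r) {i i' : Fin (k + r)} (h : i ≠ i') (j l : Fin (12 * d)) :
    noteReg C i j ≠ noteReg C i' l := by
  intro he
  have : (i, j) = (i', l) := C.out.injective he
  exact h (Prod.ext_iff.1 this).1

/-- The state of all wires after the counterfeiter has run. -/
def forgedState (U : QuantumOracle) (C : Forger d k r) (e : PubIdx d → Bool) (f : Phase d) :
    (ForgerWires d k C.ancillas → Bool) → ℂ :=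
  runGates U C.gates (initState (forgerInput k e f))

/-- The expected number of registers that are found in the state given by `f`. -/
def forgedCount (U : QuantumOracle) (C : Forger d k r) (e : PubIdx d → Bool) (f : Phase d) : ℝ :=
  ∑ i, nsq (phaseProj f (noteReg C i) (forgedState U C e f))

lemma norm_phaseState {κ : Type} [Fintype κ] [DecidableEq κ] (f : (κ → Bool) → Bool)
    (x : κ → Bool) : ‖phaseState f x‖ ^ 2 = 1 / dim κ := by
  rw [phaseState, norm_div, norm_sgn, Complex.norm_real, Real.norm_of_nonneg (Real.sqrt_nonneg _),
    div_pow, Real.sq_sqrt dim_pos.le, one_pow]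

lemma nsq_forgerInput (e : PubIdx d → Bool) (f : Phase d) : nsq (forgerInput k e f) = 1 := by
  simp only [nsq]
  rw [sum_sum_eq]
  rw [Finset.sum_eq_single (e ∘ pubEquiv d)]
  · simp only [forgerInput, Sum.elim_comp_inl, if_true, one_mul, norm_prod, ← Finset.prod_pow,
      Sum.elim_inr, norm_phaseState, Finset.prod_const, card_univ, Finset.sum_const,
      Fintype.card_fin, nsmul_eq_mul]
    rw [one_div, inv_pow]
    have hcard : (Fintype.card (Fin k × Fin (12 * d) → Bool) : ℝ) = dim (Fin (12 * d)) ^ k := by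
      simp only [dim, Fintype.card_fun, Fintype.card_prod, Fintype.card_fin, Fintype.card_bool]
      push_cast
      rw [← pow_mul, mul_comm k]
    rw [hcard]
    exact mul_inv_cancel₀ (pow_ne_zero _ dim_pos.ne')
  · intro b _ hb
    simp [forgerInput, hb]
  · simp

lemma l2_forgedState (U : QuantumOracle) (C : Forger d k r) (e : PubIdx d → Bool) (f : Phase d) :
    l2 (forgedState U C e f) = 1 := by
  rw [forgedState, l2_runGates, l2, nsq_initState, nsq_forgerInput, Real.sqrt_one]

lemma forgedCount_nonneg (U : QuantumOracle) (C : Forger d k r) (e : PubIdx d → Bool)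
    (f : Phase d) : 0 ≤ forgedCount U C e f := Finset.sum_nonneg fun _ _ => nsq_nonneg _

lemma forgedCount_le (U : QuantumOracle) (C : Forger d k r) (e : PubIdx d → Bool)
    (f : Phase d) : forgedCount U C e f ≤ (k + r : ℕ) := by
  have : ∀ i, nsq (phaseProj f (noteReg C i) (forgedState U C e f)) ≤ 1 := fun i => by
    refine (nsq_phaseProj_le _ _ _).trans ?_
    rw [← l2_sq, l2_forgedState, one_pow]
  refine (Finset.sum_le_sum fun i _ => this i).trans ?_
  simp

/-- Per register, both projected states have norm at most `1` and are no farther apart than the two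
final states. -/
lemma forgedCount_le_add (U U' : QuantumOracle) (C : Forger d k r) (e : PubIdx d → Bool)
    (f : Phase d) : forgedCount U' C e f ≤ forgedCount U C e f +
      (k + r : ℕ) * (2 * l2 (forgedState U' C e f - forgedState U C e f)) := by
  have hp : ∀ i v, l2 (phaseProj f (noteReg C i) v) ≤ l2 v := fun i v =>
    Real.sqrt_le_sqrt (nsq_phaseProj_le f _ v)
  have : ∀ i, nsq (phaseProj f (noteReg C i) (forgedState U' C e f)) ≤
      nsq (phaseProj f (noteReg C i) (forgedState U C e f)) +
        2 * l2 (forgedState U' C e f - forgedState U C e f) := fun i => by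
    refine nsq_le_nsq_add ?_ ((hp i _).trans (l2_forgedState _ _ _ _).le)
      ((hp i _).trans (l2_forgedState _ _ _ _).le)
    rw [← map_sub]
    exact hp i _
  refine (Finset.sum_le_sum fun i _ => this i).trans_eq ?_
  rw [Finset.sum_add_distrib, forgedCount]
  simp

/-! ## Replacing the phase function of one public key -/

/-- Replace the phase function of the public key `e`. -/
def setPhase (L : LevelData d) (e : PubIdx d → Bool) (f : Phase d) : LevelData d :=
  Function.update L (pubBlock e)
    ((L (pubBlock e)).1, Function.update (L (pubBlock e)).2 (pubTag e) f)

lemma publicOf_setPhase (L : LevelData d) (e : PubIdx d → Bool) (f : Phase d)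
    (z : KeyIdx d → Bool) : publicOf (setPhase L e f) z = publicOf L z := by
  unfold publicOf setPhase
  by_cases h : keyBlock z = pubBlock e
  · rw [h, Function.update_self]
  · rw [Function.update_of_ne h]

lemma phaseOf_setPhase_self (L : LevelData d) (e : PubIdx d → Bool) (f : Phase d) :
    phaseOf (setPhase L e f) e = f := by
  simp [phaseOf, setPhase]

lemma phaseOf_setPhase_of_ne (L : LevelData d) {e e' : PubIdx d → Bool} (h : e' ≠ e)
    (f : Phase d) : phaseOf (setPhase L e f) e' = phaseOf L e' := by
  unfold phaseOf setPhase
  by_cases hb : pubBlock e' = pubBlock e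
  · rw [hb, Function.update_self]
    have : pubTag e' ≠ pubTag e := fun ht => h (by rw [← mkPub_eta e', ← mkPub_eta e, hb, ht])
    exact Function.update_of_ne this _ _
  · rw [Function.update_of_ne hb]

section Gates

variable {ι : Type} [Fintype ι] [DecidableEq ι]

lemma onWires_verMatrix_mulVec (w : VerIdx d ↪ ι) (L : LevelData d) (v : (ι → Bool) → ℂ)
    (a : ι → Bool) : (onWires w (verMatrix L)).mulVec v a =
      v a + phaseProj (phaseOf L (a ∘ w ∘ Sum.inl)) ((verNote d).trans w)
        (flipDiff (w (Sum.inr (Sum.inr ()))) v) a := by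
  rw [onWires_mulVec]
  have h := verMatrix_mulVec L (fun z => v (splice w z a)) (a ∘ w)
  simp only [Matrix.mulVec, dotProduct] at h
  rw [h, splice_self, phaseProj_apply, phaseProj_apply]
  congr 2
  refine Finset.sum_congr rfl fun y _ => ?_
  have e1 : splice w (splice (verNote d) y (a ∘ w)) a = splice ((verNote d).trans w) y a := by
    rw [splice_trans, splice_self]
  have e2 : ∀ z, splice w (flipWire (Sum.inr (Sum.inr ())) z) a =
      flipWire (w (Sum.inr (Sum.inr ()))) (splice w z a) := by
    intro z
    symm
    refine eq_splice (fun j => ?_) fun i hi => ?_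
    · by_cases hj : j = Sum.inr (Sum.inr ())
      · subst hj; simp [flipWire]
      · rw [flipWire, Function.update_of_ne (fun h => hj (w.injective h)), splice_apply, flipWire,
          Function.update_of_ne hj]
    · rw [flipWire, Function.update_of_ne (fun h => hi _ h.symm), splice_of_not_mem _ _ _ hi]
  rw [flipDiff_apply, flipDiff_apply, e2, e1]
  rfl

lemma l2_flipDiff_le (c : ι) (v : (ι → Bool) → ℂ) : l2 (flipDiff c v) ≤ 2 * l2 v := by
  have hflip2 : Function.Involutive (flipWire c) := fun b => by
    ext i; by_cases hi : i = c <;> simp [flipWire, hi]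
  have h1 : l2 (fun a => v (flipWire c a)) = l2 v := by
    rw [l2, l2, nsq, nsq]
    exact congrArg _ (Equiv.sum_comp hflip2.toPerm fun a => ‖v a‖ ^ 2)
  have h2 : flipDiff c v = (fun a => v (flipWire c a)) - v := rfl
  rw [h2]
  linarith [l2_sub_le (fun a => v (flipWire c a)) v]

/-- Restriction of a vector to the assignments in a set, as a linear map. -/
def restrictTo (p : Set (ι → Bool)) : ((ι → Bool) → ℂ) →ₗ[ℂ] ((ι → Bool) → ℂ) :=
  open Classical in
  { toFun := fun v a => if a ∈ p then v a else 0
    map_add' := fun v w => by ext a; by_cases h : a ∈ p <;> simp [h]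
    map_smul' := fun c v => by ext a; by_cases h : a ∈ p <;> simp [h] }

lemma restrictTo_of_mem {p : Set (ι → Bool)} {a : ι → Bool} (h : a ∈ p) (v : (ι → Bool) → ℂ) :
    restrictTo p v a = v a := if_pos h

lemma restrictTo_of_not_mem {p : Set (ι → Bool)} {a : ι → Bool} (h : a ∉ p)
    (v : (ι → Bool) → ℂ) : restrictTo p v a = 0 := if_neg h

lemma l2_restrictTo_le (p : Set (ι → Bool)) (v : (ι → Bool) → ℂ) : l2 (restrictTo p v) ≤ l2 v := by
  refine Real.sqrt_le_sqrt (Finset.sum_le_sum fun a _ => ?_)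
  by_cases h : a ∈ p
  · rw [restrictTo_of_mem h]
  · rw [restrictTo_of_not_mem h]; simp

lemma phaseProj_restrictTo {κ : Type} [Fintype κ] [DecidableEq κ] (f : (κ → Bool) → Bool)
    (u : κ ↪ ι) {p : Set (ι → Bool)} (hp : ∀ a y, splice u y a ∈ p ↔ a ∈ p)
    (v : (ι → Bool) → ℂ) : phaseProj f u (restrictTo p v) = restrictTo p (phaseProj f u v) := by
  ext a
  by_cases h : a ∈ p
  · rw [restrictTo_of_mem h, phaseProj_apply, phaseProj_apply]
    congr 1
    exact Finset.sum_congr rfl fun y _ => by rw [restrictTo_of_mem ((hp a y).2 h)]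
  · rw [restrictTo_of_not_mem h, phaseProj_apply]
    rw [Finset.sum_eq_zero, zero_div]
    intro y _
    rw [restrictTo_of_not_mem (fun h' => h ((hp a y).1 h')), mul_zero]

/-- If no secret key has the public key `e`, then a gate depends on the phase function of `e`
only through one use of the projection onto the phase state. -/
lemma exists_phaseQuery (g : Gate ι) (D : World) {e : PubIdx d → Bool}
    (he : ∀ z, publicOf (D d) z ≠ e) (u₀ : Fin (12 * d) ↪ ι) :
    ∃ p : PhaseQuery ι (Fin (12 * d)), (∀ v, l2 (p.probe v) ≤ 2 * l2 v) ∧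
      ∀ f v, (g.toOp (oracleOf (Function.update D d (setPhase (D d) e f)))).mulVec v =
        p.step f v := by
  have hconst : ∀ G : Op ι,
      (∀ f, g.toOp (oracleOf (Function.update D d (setPhase (D d) e f))) = G) →
      ∃ p : PhaseQuery ι (Fin (12 * d)), (∀ v, l2 (p.probe v) ≤ 2 * l2 v) ∧
      ∀ f v, (g.toOp (oracleOf (Function.update D d (setPhase (D d) e f)))).mulVec v =
        p.step f v := fun G hG =>
    -- A gate independent of `f` is a query with zero probe; `u₀` merely fills the register field.
    ⟨⟨G.mulVecLin, 0, u₀⟩, fun v => by simpa using l2_nonneg v, fun f v => by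
      rw [hG]; simp [PhaseQuery.step]⟩
  -- Bank queries only ever see phase functions of public keys of secret keys, and `e` is not one of
  -- these.
  have hagree : ∀ f z, AgreeAt (setPhase (D d) e f) (D d) (.inl z) := fun f z =>
    ⟨publicOf_setPhase _ _ _ _, by
      rw [publicOf_setPhase, phaseOf_setPhase_of_ne _ (he z)]⟩
  rcases gateForm g with ⟨G, hG⟩ | ⟨d', w, c, hc, hG⟩ | ⟨d', w, c, hc, hG⟩ | ⟨d', w, c, hc, hG⟩
  · exact hconst G fun f => hG _
  all_goals
    by_cases hd : d' = d
    swap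
    · exact hconst _ fun f => by rw [hG, Function.update_of_ne hd]
    subst hd
  · refine hconst (optControlled c (onWires w (bankMatrix (D d')))) fun f => ?_
    rw [hG, Function.update_self]
    congr 2
    ext a b
    exact bankMatrix_congr (hagree f _) a
  · refine hconst (optControlled c (onWires w (bankMatrix (D d')).conjTranspose)) fun f => ?_
    rw [hG, Function.update_self]
    congr 2
    ext a b
    exact bankMatrix_conjTranspose_congr (hagree f _) a
  · set u := (verNote d').trans w with hu
    -- The branches on which the gate really tests a note against `e`: the control is on and the
    -- public key register contains `e`. Membership is unaffected by the note register.
    set p : Set (ι → Bool) := {a | (∀ i ∈ c, a i = true) ∧ a ∘ w ∘ Sum.inl = e} with hp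
    set fl := w (Sum.inr (Sum.inr ()))
    have hsp : ∀ a y, splice u y a ∈ p ↔ a ∈ p := by
      intro a y
      have h1 : splice u y a ∘ w ∘ Sum.inl = a ∘ w ∘ Sum.inl :=
        splice_comp_of_disjoint u (w ∘ Sum.inl) (fun j l h => by simpa [hu] using w.injective h) y a
      have h2 : ∀ i ∈ c, splice u y a i = a i := fun i hi =>
        splice_of_not_mem _ _ _ fun j => hc i hi _
      simp only [hp, Set.mem_ofPred_eq, h1]
      refine and_congr_left fun _ => forall₂_congr fun i hi => ?_
      rw [h2 i hi]
    set Z := restrictTo p ∘ₗ flipDiff fl with hZ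
    -- The free part must be a linear map independent of `f`. It is obtained by subtracting the
    -- projection term from the gate at one particular `f₀`; `key` shows that every `f` leaves the
    -- same remainder.
    set f₀ := phaseOf (D d') e
    refine ⟨⟨((g.toOp (oracleOf (Function.update D d' (setPhase (D d') e f₀)))).mulVecLin) -
      phaseProj f₀ u ∘ₗ Z, Z, u⟩, fun v => ?_, fun f v => ?_⟩
    · exact (l2_restrictTo_le _ _).trans (l2_flipDiff_le _ _)
    · have key : ∀ f a,
          (g.toOp (oracleOf (Function.update D d' (setPhase (D d') e f)))).mulVec v a =
          (if (∀ i ∈ c, a i = true) ∧ a ∘ w ∘ Sum.inl ≠ e then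
            v a + phaseProj (phaseOf (D d') (a ∘ w ∘ Sum.inl)) u (flipDiff fl v) a else v a) +
          phaseProj f u (Z v) a := by
        intro f a
        rw [hG, Function.update_self, optControlled_mulVec, onWires_verMatrix_mulVec, hZ,
          LinearMap.comp_apply, phaseProj_restrictTo f u hsp]
        by_cases h1 : ∀ i ∈ c, a i = true
        · by_cases h2 : a ∘ w ∘ Sum.inl = e
          · have h3 : a ∈ p := ⟨h1, h2⟩
            rw [restrictTo_of_mem h3, if_pos h1, if_neg (fun h => h.2 h2), h2,
              phaseOf_setPhase_self]
          · have h3 : a ∉ p := fun h => h2 h.2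
            rw [restrictTo_of_not_mem h3, if_pos h1, if_pos ⟨h1, h2⟩,
              phaseOf_setPhase_of_ne _ h2, add_zero]
        · have h3 : a ∉ p := fun h => h1 h.1
          rw [restrictTo_of_not_mem h3, if_neg h1, if_neg (fun h => h1 h.1), add_zero]
      ext a
      simp only [PhaseQuery.step, LinearMap.sub_apply, Matrix.mulVecLin_apply, Pi.add_apply,
        Pi.sub_apply, LinearMap.comp_apply, key]
      simp only [hZ, LinearMap.comp_apply]
      ring

end Gates

/-! ## The expected number of valid banknotes for a random phase function -/

/-- Repeated points cancel in pairs because signs square to `1`. Consequently the amplitudes of `k`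
copies of a phase state are characters of degree at most `k`. -/
lemma exists_chi_eq_prod {X J : Type} [Fintype X] [DecidableEq X] (t : Finset J) (x : J → X) :
    ∃ S : Finset X, S.card ≤ t.card ∧ ∀ f, chi S f = ∏ j ∈ t, sgn (f (x j)) := by
  classical
  induction t using Finset.induction_on with
  | empty => exact ⟨∅, by simp, by simp [chi]⟩
  | insert j t hj ih =>
    obtain ⟨S, hS, h⟩ := ih
    refine ⟨symmDiff S {x j}, ?_, fun f => ?_⟩
    · rw [card_insert_of_notMem hj]
      exact (card_symmDiff_singleton_le _ _).trans (by omega)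
    · rw [chi_symmDiff, h, chi_singleton, Finset.prod_insert hj, mul_comm]

lemma runGates_smul {ι : Type} [Fintype ι] [DecidableEq ι] (U : QuantumOracle)
    (gs : List (Gate ι)) (c : ℂ) (v : (ι → Bool) → ℂ) :
    runGates U gs (c • v) = c • runGates U gs v := by
  induction gs generalizing v with
  | nil => rfl
  | cons g gs ih => rw [runGates_cons, runGates_cons, Matrix.mulVec_smul, ih]

lemma exists_phaseQueries {ι : Type} [Fintype ι] [DecidableEq ι] (gs : List (Gate ι)) (D : World)
    {e : PubIdx d → Bool} (he : ∀ z, publicOf (D d) z ≠ e) (u₀ : Fin (12 * d) ↪ ι) :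
    ∃ ps : List (PhaseQuery ι (Fin (12 * d))), ps.length = gs.length ∧
      (∀ p ∈ ps, ∀ v, l2 (p.probe v) ≤ 2 * l2 v) ∧
      (∀ p ∈ ps, ∀ f v, l2 (p.step f v) ≤ l2 v) ∧
      ∀ f v, runGates (oracleOf (Function.update D d (setPhase (D d) e f))) gs v =
        ps.foldl (fun w p => p.step f w) v := by
  induction gs with
  | nil => exact ⟨[], rfl, by simp, by simp, fun _ _ => rfl⟩
  | cons g gs ih =>
    obtain ⟨ps, h1, h2, h3, h4⟩ := ih
    obtain ⟨p, hp1, hp2⟩ := exists_phaseQuery g D he u₀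
    refine ⟨p :: ps, by simp [h1], ?_, ?_, fun f v => ?_⟩
    · intro q hq
      rcases List.mem_cons.1 hq with rfl | hq
      · exact hp1
      · exact h2 q hq
    · intro q hq f v
      rcases List.mem_cons.1 hq with rfl | hq
      · rw [← hp2, l2_gate]
      · exact h3 q hq f v
    · rw [runGates_cons, hp2, h4, List.foldl_cons]

/-- A counterfeiter hardly produces more than `k` banknotes if the phase function of the public
key is random and no secret key has this public key. -/
theorem expect_forgedCount_le (D : World) {e : PubIdx d → Bool}
    (he : ∀ z, publicOf (D d) z ≠ e) (C : Forger d k r) {η : ℝ}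
    (hη : (1 + 2 * keepError (Fin (12 * d)) k) ^ C.gates.length - 1 ≤ η) (hη1 : η ≤ 1) :
    𝔼 f, forgedCount (oracleOf (Function.update D d (setPhase (D d) e f))) C e f ≤
      k * (1 + (k + r : ℕ) / dim (Fin (12 * d))) * (1 + 3 * η) +
        2 * (k + r : ℕ) * (2 * keepError (Fin (12 * d)) k + η) := by
  have hk := keepError_nonneg (κ := Fin (12 * d)) k
  have hN := dim_pos (κ := Fin (12 * d))
  have hη0 : 0 ≤ η := by
    have : (1 : ℝ) ≤ (1 + 2 * keepError (Fin (12 * d)) k) ^ C.gates.length :=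
      one_le_pow₀ (by linarith)
    linarith
  -- Without output registers there is no embedding to serve as the default register, so this
  -- trivial case is separate.
  rcases Nat.eq_zero_or_pos (k + r) with h0 | h0
  · have hz : ∀ f, forgedCount (oracleOf (Function.update D d (setPhase (D d) e f))) C e f = 0 := by
      intro f
      have : IsEmpty (Fin (k + r)) := by rw [h0]; infer_instance
      simp [forgedCount]
    simp only [hz, Finset.expect_const_zero]
    positivity
  obtain ⟨ps, h1, h2, h3, h4⟩ := exists_phaseQueries C.gates D he (noteReg C ⟨0, h0⟩)
  set F := Fintype.card (Phase d) with hF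
  have hFpos : (0 : ℝ) < F := by exact_mod_cast Fintype.card_pos
  choose S hS1 hS2 using fun a : ForgerWires d k C.ancillas → Bool => exists_chi_eq_prod (univ : Finset (Fin k))
    fun j i => a (Sum.inl (Sum.inr (j, i)))
  set base : (ForgerWires d k C.ancillas → Bool) → ℂ := fun a =>
    (if a ∘ Sum.inl ∘ Sum.inl = e ∘ pubEquiv d then 1 else 0) *
      (1 / (√(dim (Fin (12 * d))) : ℂ)) ^ k * if a ∘ Sum.inr = fun _ => false then 1 else 0
  have hinit : ∀ f a, initState (n := C.ancillas) (forgerInput k e f) a = chi (S a) f * base a := by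
    intro f a
    simp only [initState, forgerInput, phaseState, hS2, base]
    rw [Finset.prod_div_distrib, Finset.prod_const, card_univ, Fintype.card_fin]
    simp only [Function.comp_apply, Function.comp_assoc]
    ring
  -- At each wire assignment `a` the initial amplitude is a constant times the single character `S
  -- a`. The normalization of `synth` supplies the factor `1 / √F` in each fiber, which turns the
  -- sum over `f` in the general bound into the average.
  set Θ : Finset (Fin (12 * d) → Bool) × (ForgerWires d k C.ancillas → Bool) → ℂ := fun p =>
    if p.1 = S p.2 then base p.2 else 0 with hΘ
  have hfib : ∀ f, fiber (synth Θ) f =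
      (1 / (√F : ℂ)) • initState (n := C.ancillas) (forgerInput k e f) := by
    intro f
    ext a
    simp only [fiber, synth_apply, Pi.smul_apply, smul_eq_mul, hinit, hΘ, mul_ite, mul_zero,
      Finset.sum_ite_eq', Finset.mem_univ, if_true, hF]
    ring
  have hcoef : ‖(1 / (√F : ℂ))‖ ^ 2 = 1 / F := by
    rw [norm_div, norm_one, Complex.norm_real, Real.norm_of_nonneg (Real.sqrt_nonneg _), div_pow,
      Real.sq_sqrt hFpos.le, one_pow]
  have hlow : LowDegree k Θ := by
    intro T a hT
    have : T ≠ S a := by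
      rintro rfl
      have := hS1 a
      rw [card_univ, Fintype.card_fin] at this
      omega
    simp [hΘ, this]
  have hnorm : l2 Θ ≤ 1 := by
    rw [← l2_synth]
    refine l2_le_of_nsq_le zero_le_one ?_
    rw [nsq_eq_sum_fiber]
    simp only [hfib, nsq_smul, hcoef, nsq_initState, nsq_forgerInput]
    rw [Finset.sum_const, card_univ, nsmul_eq_mul, mul_one, one_pow, one_div, mul_inv_cancel₀ hFpos.ne']
  have main := sum_nsq_phaseProj_le ps h2 h3 hlow hnorm (noteReg C)
    (fun i i' hi => noteReg_ne C hi) (by rw [h1]; exact hη) hη1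
  rw [Fintype.card_fin] at main
  refine le_trans (le_of_eq ?_) main
  rw [Fintype.expect_eq_sum_div_card, Finset.sum_div]
  refine Finset.sum_congr rfl fun f _ => ?_
  rw [forgedCount, Finset.sum_div]
  refine Finset.sum_congr rfl fun i _ => ?_
  rw [← h4, hfib, runGates_smul, map_smul, nsq_smul, hcoef, forgedState]
  ring

end

section

variable {d : ℕ}

/-! ## The money scheme -/

/-- The wires of the secret key that are used. -/
def keyEmb (n : ℕ) : KeyIdx (n / 28) ↪ Fin n :=
  (Function.Embedding.nonempty_of_card_le
    (by simp only [Fintype.card_sum, Fintype.card_fin]; omega)).some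

def bankWires (n : ℕ) :
    BankIdx (n / 28) ↪ Fin n ⊕ Fin (32 * (n / 28) + 12 * (n / 28)) :=
  (keyEmb n).sumMap
    (((pubEquiv _).symm.sumCongr (Equiv.refl _)).trans finSumFinEquiv).toEmbedding

def bankCircuit (n : ℕ) : QCircuit (Fin n) (Fin (32 * (n / 28)) ⊕ Fin (12 * (n / 28))) where
  ancillas := 32 * (n / 28) + 12 * (n / 28)
  gates := [.oracle false (72 * (n / 28)) ((bankEquiv rfl).toEmbedding.trans (bankWires n))]
  out := finSumFinEquiv.toEmbedding.trans Function.Embedding.inr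

def verWires (d : ℕ) : VerIdx d ≃ (Fin (32 * d) ⊕ Fin (12 * d)) ⊕ Fin 1 :=
  (Equiv.sumAssoc _ _ _).symm.trans
    (((pubEquiv d).symm.sumCongr (Equiv.refl _)).sumCongr finOneEquiv.symm)

def authCircuit (d : ℕ) : QCircuit (Fin (32 * d) ⊕ Fin (12 * d)) Unit where
  ancillas := 1
  gates := [.oracle false (44 * d + 1)
    ((verEquiv rfl).toEmbedding.trans (verWires d).toEmbedding)]
  out := wire (Sum.inr 0)

section Circuits

variable {I O : Type} [Fintype I] [DecidableEq I] [Fintype O] [DecidableEq O]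
  {κ : Type} [Fintype κ] [DecidableEq κ]

/-- Linearity in the state transfers computations with pure states to the mixed states of single
registers. -/
lemma isLinearMap_run_tensor {J : Type} [Fintype J] [DecidableEq J] (U : QuantumOracle)
    (C : QCircuit (J ⊕ I) O) (b : Op J) (x y : O → Bool) :
    IsLinearMap ℂ fun σ : Op I => C.run U (tensor b σ) x y := by
  have hadd : ∀ (w : O ↪ (J ⊕ I) ⊕ Fin C.ancillas) (ρ σ : Op ((J ⊕ I) ⊕ Fin C.ancillas)),
      reduce w (ρ + σ) = reduce w ρ + reduce w σ := by
    intro w ρ σ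
    ext x y
    simp only [reduce, Matrix.of_apply, Matrix.add_apply, ← Finset.sum_add_distrib]
    refine Finset.sum_congr rfl fun a _ => Finset.sum_congr rfl fun c _ => ?_
    split_ifs <;> simp
  have hsmul : ∀ (w : O ↪ (J ⊕ I) ⊕ Fin C.ancillas) (c : ℂ) (ρ : Op ((J ⊕ I) ⊕ Fin C.ancillas)),
      reduce w (c • ρ) = c • reduce w ρ := by
    intro w c ρ
    ext x y
    simp only [reduce, Matrix.of_apply, Matrix.smul_apply, smul_eq_mul, Finset.mul_sum]
    refine Finset.sum_congr rfl fun a _ => Finset.sum_congr rfl fun c _ => ?_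
    split_ifs <;> simp
  have tadd : ∀ ρ σ : Op I, tensor (tensor b (ρ + σ)) (basisState fun _ => false) =
      tensor (tensor b ρ) (basisState (ι := Fin C.ancillas) fun _ => false) +
      tensor (tensor b σ) (basisState fun _ => false) := by
    intro ρ σ; ext a c; simp [tensor]; ring
  have tsmul : ∀ (t : ℂ) (ρ : Op I), tensor (tensor b (t • ρ)) (basisState fun _ => false) =
      t • tensor (tensor b ρ) (basisState (ι := Fin C.ancillas) fun _ => false) := by
    intro t ρ; ext a c; simp [tensor]; ring
  constructor
  · intro ρ σ
    simp only [QCircuit.run]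
    rw [tadd, mul_add, add_mul, hadd]
    rfl
  · intro c ρ
    simp only [QCircuit.run]
    rw [tsmul, mul_smul_comm, smul_mul_assoc, hsmul]
    rfl

/-- A reduced state is a sum of unnormalized pure states, one for each assignment of the other
wires; summing over all wires counts each of them `dim κ` times. -/
lemma run_tensor_reduce {ι J : Type} [Fintype ι] [DecidableEq ι] [Fintype J] [DecidableEq J]
    (U : QuantumOracle) (C : QCircuit (J ⊕ κ) O) (b : Op J) (u : κ ↪ ι) (Ψ : (ι → Bool) → ℂ)
    (x y : O → Bool) :
    (dim κ : ℂ) * C.run U (tensor b (reduce u (pureState Ψ))) x y =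
      ∑ a, C.run U (tensor b (pureState fun z => Ψ (splice u z a))) x y := by
  have e : (dim κ : ℂ) • reduce u (pureState Ψ) =
      ∑ a, pureState fun z => Ψ (splice u z a) := by
    ext z z'
    rw [Matrix.smul_apply, smul_eq_mul, reduce_apply, Matrix.sum_apply]
    rfl
  have h := isLinearMap_run_tensor U C b x y
  have h1 := congrArg h.mk' e
  rw [map_smul, map_sum] at h1
  exact h1

end Circuits

lemma onWires_call_bank (D : World) {ι : Type} [Fintype ι] [DecidableEq ι] (w : BankIdx d ↪ ι) :
    Gate.toOp (oracleOf D) (.oracle false (72 * d) ((bankEquiv rfl).toEmbedding.trans w)) =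
      onWires w (bankMatrix (D d)) := by
  rw [Gate.toOp, QuantumOracle.call, if_neg (by simp), oracleOf_bank D rfl, onWires_reindexU]
  congr 1
  ext j
  simp

lemma onWires_call_ver (D : World) {ι : Type} [Fintype ι] [DecidableEq ι] (w : VerIdx d ↪ ι) :
    Gate.toOp (oracleOf D) (.oracle false (44 * d + 1) ((verEquiv rfl).toEmbedding.trans w)) =
      onWires w (verMatrix (D d)) := by
  rw [Gate.toOp, QuantumOracle.call, if_neg (by simp), oracleOf_ver D rfl, onWires_reindexU]
  congr 1
  ext j
  simp

/-- The projection of a register onto a phase state, applied to that register alone. -/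
abbrev phaseProjSelf {κ : Type} [Fintype κ] [DecidableEq κ] (f : (κ → Bool) → Bool) :
    ((κ → Bool) → ℂ) →ₗ[ℂ] ((κ → Bool) → ℂ) := phaseProj f (Function.Embedding.refl κ)

lemma phaseProj_eq_phaseProjSelf {ι κ : Type} [Fintype ι] [DecidableEq ι] [Fintype κ]
    [DecidableEq κ] (f : (κ → Bool) → Bool) (u : κ ↪ ι) (v : (ι → Bool) → ℂ) (a : ι → Bool) :
    phaseProj f u v a = phaseProjSelf f (fun z => v (splice u z a)) (a ∘ u) := by
  rw [phaseProj_apply, phaseProj_apply]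
  congr 1
  refine Finset.sum_congr rfl fun y _ => ?_
  have : splice (Function.Embedding.refl κ) y (a ∘ u) = y := by
    have := splice_comp (Function.Embedding.refl κ) y (a ∘ u)
    exact this
  rw [this]
  rfl

lemma sum_nsq_phaseProjSelf {ι κ : Type} [Fintype ι] [DecidableEq ι] [Fintype κ]
    [DecidableEq κ] (f : (κ → Bool) → Bool) (u : κ ↪ ι) (v : (ι → Bool) → ℂ) :
    ∑ a, nsq (phaseProjSelf f fun z => v (splice u z a)) = dim κ * nsq (phaseProj f u v) := by
  have h := sum_sum_splice u fun a => ‖phaseProj f u v a‖ ^ 2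
  rw [nsmul_eq_mul] at h
  rw [nsq, ← h]
  refine Finset.sum_congr rfl fun a _ => Finset.sum_congr rfl fun y _ => ?_
  rw [phaseProj_eq_phaseProjSelf f u]
  simp

/-- The final state of the authenticator on the accepting branch. -/
lemma authState_apply (D : World) (e : Fin (32 * d) → Bool) (v : (Fin (12 * d) → Bool) → ℂ)
    (p : Fin (32 * d) → Bool) (x : Fin (12 * d) → Bool) :
    runGates (oracleOf D) (authCircuit d).gates
      (initState fun a => (Pi.single e 1 : _ → ℂ) (a ∘ Sum.inl) * v (a ∘ Sum.inr))
      (Sum.elim (Sum.elim p x) fun _ => true) =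
    if p = e then phaseProjSelf (phaseOf (D d) (e ∘ (pubEquiv d).symm)) v x else 0 := by
  set a : (Fin (32 * d) ⊕ Fin (12 * d)) ⊕ Fin 1 → Bool := Sum.elim (Sum.elim p x) fun _ => true
  set v₀ : ((Fin (32 * d) ⊕ Fin (12 * d)) ⊕ Fin 1 → Bool) → ℂ :=
    initState fun a => (Pi.single e 1 : _ → ℂ) (a ∘ Sum.inl) * v (a ∘ Sum.inr) with hv₀
  have e0 : runGates (oracleOf D) (authCircuit d).gates v₀ =
      (onWires (verWires d).toEmbedding (verMatrix (D d))).mulVec v₀ := by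
    change (Gate.toOp (oracleOf D) (.oracle false (44 * d + 1) _)).mulVec v₀ = _
    rw [onWires_call_ver]
  have htrue : (fun _ : Fin 1 => true) ≠ fun _ => false := fun h => by
    simpa using congrFun h 0
  -- The flag starts in `|0⟩`, so on the accepting branch only the flipped term of `1 + P ⊗ (X - 1)`
  -- survives.
  have hz : ∀ q : Fin (32 * d) ⊕ Fin (12 * d) → Bool, v₀ (Sum.elim q fun _ => true) = 0 := by
    intro q
    rw [hv₀, initState, Sum.elim_comp_inr, if_neg htrue, mul_zero]
  have e1 : a ∘ (verWires d).toEmbedding ∘ Sum.inl = p ∘ (pubEquiv d).symm := rfl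
  have e2 : a ∘ ((verNote d).trans (verWires d).toEmbedding) = x := rfl
  have e3 : ∀ y, splice ((verNote d).trans (verWires d).toEmbedding) y a =
      Sum.elim (Sum.elim p y) fun _ => true := by
    intro y
    symm
    refine eq_splice (fun j => rfl) fun i hi => ?_
    rcases i with (i | i) | i
    · rfl
    · exact absurd rfl (hi i)
    · rfl
  have e4 : ∀ y : Fin (12 * d) → Bool, flipDiff ((verWires d).toEmbedding (Sum.inr (Sum.inr ()))) v₀
      (Sum.elim (Sum.elim p y) fun _ => true) = if p = e then v y else 0 := by
    intro y
    have : flipWire ((verWires d).toEmbedding (Sum.inr (Sum.inr ())))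
        (Sum.elim (Sum.elim p y) fun _ => true) = Sum.elim (Sum.elim p y) fun _ => false := by
      ext i
      rcases i with i | i
      · exact Function.update_of_ne (by simp [verWires]) _ _
      · have hi : i = 0 := Subsingleton.elim _ _
        subst hi
        exact Function.update_self _ _ _
    rw [flipDiff_apply, hz, this, hv₀, initState]
    simp only [Sum.elim_comp_inl, Sum.elim_comp_inr, if_true, Pi.single_apply]
    split_ifs <;> simp
  change runGates (oracleOf D) (authCircuit d).gates v₀ a = _
  rw [e0, onWires_verMatrix_mulVec]
  change v₀ (Sum.elim (Sum.elim p x) fun _ => true) + _ = _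
  rw [hz, zero_add, phaseProj_apply, e1, e2]
  simp only [e3, e4]
  split_ifs with hp
  · subst hp
    rw [phaseProj_apply]
    congr 1
    refine Finset.sum_congr rfl fun y _ => ?_
    have : splice (Function.Embedding.refl _) y x = y := splice_comp (Function.Embedding.refl _) y x
    rw [this]
    rfl
  · simp

lemma auth_run_pureState (D : World) (e : Fin (32 * d) → Bool)
    (v : (Fin (12 * d) → Bool) → ℂ) :
    (authCircuit d).run (oracleOf D) (tensor (basisState e) (pureState v)) (fun _ => true)
      (fun _ => true) =
      (nsq (phaseProjSelf (phaseOf (D d) (e ∘ (pubEquiv d).symm)) v) : ℝ) := by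
  rw [basisState_eq_pureState, tensor_pureState, run_pureState]
  have h2 : (dim Unit : ℂ) = 2 := by simp
  refine mul_left_cancel₀ (two_ne_zero (α := ℂ)) ?_
  rw [← h2, reduce_apply, h2, sum_sum_eq]
  have hs : ∀ q (t : Fin 1 → Bool), splice (authCircuit d).out (fun _ => true) (Sum.elim q t) =
      (Sum.elim q fun _ => true : (Fin (32 * d) ⊕ Fin (12 * d)) ⊕ Fin 1 → Bool) := by
    intro q t
    symm
    refine eq_splice (fun j => rfl) fun i hi => ?_
    rcases i with i | i
    · rfl
    · exact absurd (by rw [Subsingleton.elim i 0]; rfl) (hi ())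
  have hcard : Fintype.card (Fin (authCircuit d).ancillas → Bool) = 2 := by
    change Fintype.card (Fin 1 → Bool) = 2
    rfl
  have hsum : ∀ q : Fin (32 * d) ⊕ Fin (12 * d) → Bool,
      ∑ t : Fin (authCircuit d).ancillas → Bool, pureState (runGates (oracleOf D)
        (authCircuit d).gates
        (initState fun a => (Pi.single e 1 : _ → ℂ) (a ∘ Sum.inl) * v (a ∘ Sum.inr)))
        (splice (authCircuit d).out (fun _ => true) (Sum.elim q t))
        (splice (authCircuit d).out (fun _ => true) (Sum.elim q t)) =
      2 * ((‖runGates (oracleOf D) (authCircuit d).gates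
        (initState fun a => (Pi.single e 1 : _ → ℂ) (a ∘ Sum.inl) * v (a ∘ Sum.inr))
        (Sum.elim q fun _ => true)‖ ^ 2 : ℝ) : ℂ) := by
    intro q
    rw [Finset.sum_congr rfl fun t _ => by rw [hs q t], Finset.sum_const, card_univ, hcard,
      nsmul_eq_mul]
    change ((2 : ℕ) : ℂ) * (_ * (starRingEnd ℂ) _) = _
    rw [Complex.mul_conj']
    push_cast
    rfl
  rw [Finset.sum_congr rfl fun q _ => hsum q, ← Finset.mul_sum, sum_sum_eq]
  congr 1
  simp only [← Complex.ofReal_sum]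
  congr 1
  rw [Finset.sum_eq_single e]
  · rw [nsq]
    refine Finset.sum_congr rfl fun x _ => ?_
    have := authState_apply D e v e x
    rw [if_pos rfl] at this
    rw [← this]
  · intro p _ hp
    refine Finset.sum_eq_zero fun x _ => ?_
    have := authState_apply D e v p x
    rw [if_neg hp] at this
    change ‖runGates (oracleOf D) (authCircuit d).gates _ (Sum.elim (Sum.elim p x) fun _ => true)‖ ^ 2 = 0
    rw [sq_eq_zero_iff, norm_eq_zero]
    exact this
  · simp

/-- The public key for a secret key of length `n`. -/
def publicKeyOf (D : World) (n : ℕ) (s : Fin n → Bool) : Fin (32 * (n / 28)) → Bool :=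
  publicOf (D (n / 28)) (s ∘ keyEmb n) ∘ pubEquiv (n / 28)

/-- The phase function of the banknotes for a secret key of length `n`. -/
def notePhase (D : World) (n : ℕ) (s : Fin n → Bool) : Phase (n / 28) :=
  phaseOf (D (n / 28)) (publicOf (D (n / 28)) (s ∘ keyEmb n))

lemma onWires_mulVec_single {ι κ : Type} [Fintype ι] [DecidableEq ι] [Fintype κ] (w : κ ↪ ι)
    (G : Op κ) (a b : ι → Bool) : (onWires w G).mulVec (Pi.single b 1) a =
      if ∀ i, (∀ j, w j ≠ i) → a i = b i then G (a ∘ w) (b ∘ w) else 0 := by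
  rw [Matrix.mulVec_single_one]
  rfl

/-- On zero registers, the xor writes the public key and the Hadamard transformation gives the
uniform superposition, to which the signs are applied. -/
lemma bankState_apply (D : World) (n : ℕ) (s s' : Fin n → Bool)
    (x : Fin (32 * (n / 28)) ⊕ Fin (12 * (n / 28)) → Bool) :
    runGates (oracleOf D) (bankCircuit n).gates (initState (Pi.single s 1))
      (Sum.elim s' (x ∘ finSumFinEquiv.symm)) =
    if s' = s then (Pi.single (publicKeyOf D n s) 1 : _ → ℂ) (x ∘ Sum.inl) *
      phaseState (notePhase D n s) (x ∘ Sum.inr) else 0 := by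
  have hv : (initState (Pi.single s 1) :
      (Fin n ⊕ Fin (32 * (n / 28) + 12 * (n / 28)) → Bool) → ℂ) =
      Pi.single (Sum.elim s fun _ => false) 1 := by
    ext a
    simp only [initState, Pi.single_apply, sum_type_ext (a := a), Sum.elim_comp_inl,
      Sum.elim_comp_inr]
    by_cases h1 : a ∘ Sum.inl = s <;> simp [h1]
  set A : Fin n ⊕ Fin (32 * (n / 28) + 12 * (n / 28)) → Bool :=
    Sum.elim s' (x ∘ finSumFinEquiv.symm) with hA
  set b : Fin n ⊕ Fin (32 * (n / 28) + 12 * (n / 28)) → Bool :=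
    Sum.elim s fun _ => false with hb
  have e0 : runGates (oracleOf D) (bankCircuit n).gates (initState (Pi.single s 1)) A =
      (onWires (bankWires n) (bankMatrix (D (n / 28)))).mulVec (Pi.single b 1) A := by
    rw [← hv]
    change (Gate.toOp (oracleOf D) (.oracle false (72 * (n / 28)) _)).mulVec _ A = _
    rw [onWires_call_bank]
    rfl
  have h1 : (A ∘ bankWires n) ∘ Sum.inl = s' ∘ keyEmb n := rfl
  have h2 : (b ∘ bankWires n) ∘ Sum.inl = s ∘ keyEmb n := rfl
  have h3 : ∀ i, (A ∘ bankWires n) (Sum.inr (Sum.inl i)) = x (Sum.inl ((pubEquiv _).symm i)) := by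
    intro i
    change x (finSumFinEquiv.symm (finSumFinEquiv (Sum.inl ((pubEquiv _).symm i)))) = _
    rw [Equiv.symm_apply_apply]
  have h4 : (A ∘ bankWires n) ∘ Sum.inr ∘ Sum.inr = x ∘ Sum.inr := by
    ext i
    change x (finSumFinEquiv.symm (finSumFinEquiv (Sum.inr i))) = _
    rw [Equiv.symm_apply_apply]
    rfl
  have h5 : (b ∘ bankWires n) ∘ Sum.inr ∘ Sum.inl = fun _ => false := rfl
  have h6 : (b ∘ bankWires n) ∘ Sum.inr ∘ Sum.inr = fun _ => false := rfl
  -- Key bits outside `keyEmb n` are preserved because the gate does not touch them, the others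
  -- because the bank matrix preserves its key register.
  have hcond : ((∀ i, (∀ j, bankWires n j ≠ i) → A i = b i) ∧
      s' ∘ keyEmb n = s ∘ keyEmb n) ↔ s' = s := by
    constructor
    · rintro ⟨h, h'⟩
      ext i
      by_cases hi : ∃ j, keyEmb n j = i
      · obtain ⟨j, rfl⟩ := hi
        exact congrFun h' j
      · refine h (Sum.inl i) fun j hj => ?_
        rcases j with j | j
        · exact hi ⟨j, Sum.inl_injective hj⟩
        · exact Sum.inr_ne_inl hj
    · rintro rfl
      refine ⟨fun i hi => ?_, rfl⟩
      rcases i with i | i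
      · rfl
      · exfalso
        obtain ⟨j, rfl⟩ := (((pubEquiv _).symm.sumCongr (Equiv.refl _)).trans
          finSumFinEquiv).surjective i
        exact hi (Sum.inr j) rfl
  have hkey : ((fun _ => false : PubIdx (n / 28) → Bool) =
      fun i => xor (x (Sum.inl ((pubEquiv _).symm i)))
        (publicOf (D (n / 28)) (s ∘ keyEmb n) i)) ↔ x ∘ Sum.inl = publicKeyOf D n s := by
    rw [funext_iff, funext_iff, ← (pubEquiv (n / 28)).forall_congr_right]
    refine forall_congr' fun i => ?_
    simp only [Equiv.symm_apply_apply, publicKeyOf, Function.comp_apply]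
    cases x (Sum.inl i) <;> cases publicOf (D (n / 28)) (s ∘ keyEmb n) (pubEquiv _ i) <;> simp
  refine e0.trans ?_
  rw [onWires_mulVec_single, bankMatrix, Matrix.of_apply, h1, h2, h4, h5, h6, walsh_false]
  simp only [h3, hkey, Pi.single_apply]
  rw [← ite_and]
  simp only [← and_assoc, hcond]
  by_cases h7 : s' = s
  · simp only [h7, true_and, if_true]
    split_ifs
    · rw [one_mul, phaseState, mul_one_div]
      rfl
    · simp
  · simp [h7]

lemma bank_run (D : World) (n : ℕ) (s : Fin n → Bool) :
    (bankCircuit n).run (oracleOf D) (basisState s) =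
      tensor (basisState (publicKeyOf D n s)) (pureState (phaseState (notePhase D n s))) := by
  rw [basisState_eq_pureState, basisState_eq_pureState, tensor_pureState, run_pureState]
  ext x y
  have hN : (dim (Fin (32 * (n / 28)) ⊕ Fin (12 * (n / 28))) : ℂ) ≠ 0 := by
    exact_mod_cast dim_pos.ne'
  refine mul_left_cancel₀ hN ?_
  rw [reduce_apply, sum_sum_eq (ι := Fin n)]
  have hs : ∀ (x : Fin (32 * (n / 28)) ⊕ Fin (12 * (n / 28)) → Bool) (q : Fin n → Bool)
      (t : Fin (bankCircuit n).ancillas → Bool),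
      splice (bankCircuit n).out x (Sum.elim q t) =
      (Sum.elim q (x ∘ finSumFinEquiv.symm) : Fin n ⊕ Fin (32 * (n / 28) + 12 * (n / 28)) → Bool) := by
    intro x q t
    symm
    refine eq_splice (fun j => ?_) fun i hi => ?_
    · change x (finSumFinEquiv.symm (finSumFinEquiv j)) = _
      rw [Equiv.symm_apply_apply]
    · rcases i with i | i
      · rfl
      · obtain ⟨j, rfl⟩ := finSumFinEquiv.surjective i
        exact absurd rfl (hi j)
  have hsum : ∀ (q : Fin n → Bool) (t : Fin (bankCircuit n).ancillas → Bool),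
      pureState (runGates (oracleOf D) (bankCircuit n).gates (initState (Pi.single s 1)))
        (splice (bankCircuit n).out x (Sum.elim q t))
        (splice (bankCircuit n).out y (Sum.elim q t)) =
      if q = s then pureState (fun a => (Pi.single (publicKeyOf D n s) 1 : _ → ℂ) (a ∘ Sum.inl) *
        phaseState (notePhase D n s) (a ∘ Sum.inr)) x y else 0 := by
    intro q t
    rw [hs, hs]
    change runGates (oracleOf D) (bankCircuit n).gates (initState (Pi.single s 1)) _ *
      (starRingEnd ℂ) (runGates (oracleOf D) (bankCircuit n).gates (initState (Pi.single s 1)) _) = _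
    refine (congrArg₂ (fun u v : ℂ => u * (starRingEnd ℂ) v) (bankState_apply D n s q x)
      (bankState_apply D n s q y)).trans ?_
    split_ifs
    · rfl
    · simp
  simp only [hsum]
  rw [Finset.sum_comm, Finset.sum_congr rfl fun _ _ => Finset.sum_ite_eq' _ _ _]
  simp only [Finset.mem_univ, if_true, Finset.sum_const, card_univ, nsmul_eq_mul]
  congr 1
  rw [dim, Complex.ofReal_natCast, Fintype.card_congr (Equiv.arrowCongr
    (finSumFinEquiv (m := 32 * (n / 28)) (n := 12 * (n / 28))) (Equiv.refl Bool))]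
  rfl

/-- The money scheme relative to the oracle given by `D`. -/
def moneyScheme (D : World) : MoneyScheme (oracleOf D) where
  keyLen n := 32 * (n / 28)
  noteLen n := 12 * (n / 28)
  bank := bankCircuit
  auth n := authCircuit (n / 28)
  bank_poly := ⟨3 * Polynomial.X + 1, fun n => by
    simp only [QCircuit.size, bankCircuit, Fintype.card_fin, List.length_singleton,
      Polynomial.eval_add, Polynomial.eval_mul, Polynomial.eval_X, Polynomial.eval_one,
      Polynomial.eval_ofNat]
    omega⟩
  auth_poly := ⟨2 * Polynomial.X + 2, fun n => by
    simp only [QCircuit.size, authCircuit, Fintype.card_fin, Fintype.card_sum,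
      List.length_singleton, Polynomial.eval_add, Polynomial.eval_mul, Polynomial.eval_X,
      Polynomial.eval_ofNat]
    omega⟩
  publicKey := publicKeyOf D
  note n s := pureState (phaseState (notePhase D n s))
  bank_output := bank_run D

lemma phaseProjSelf_phaseState {κ : Type} [Fintype κ] [DecidableEq κ] (f : (κ → Bool) → Bool) :
    phaseProjSelf f (phaseState f) = phaseState f := by
  have hN := dim_pos (κ := κ)
  ext x
  rw [phaseProj_apply]
  have : ∀ y, splice (Function.Embedding.refl κ) y x = y :=
    fun y => splice_comp (Function.Embedding.refl κ) y x
  have h1 : ∀ y, sgn (f ((x ∘ Function.Embedding.refl κ))) * sgn (f y) *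
      phaseState f (splice (Function.Embedding.refl κ) y x) = phaseState f x := by
    intro y
    rw [this, phaseState, phaseState, mul_assoc, ← mul_div_assoc, ← mul_div_assoc, sgn_mul_self,
      mul_one]
    rfl
  simp only [h1, Finset.sum_const, card_univ, nsmul_eq_mul]
  rw [dim, Complex.ofReal_natCast, mul_div_cancel_left₀]
  exact_mod_cast Fintype.card_ne_zero

lemma nsq_phaseState {κ : Type} [Fintype κ] [DecidableEq κ] (f : (κ → Bool) → Bool) :
    nsq (phaseState f) = 1 := by
  have hN := dim_pos (κ := κ)
  simp only [nsq, norm_phaseState, Finset.sum_const, card_univ, nsmul_eq_mul]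
  rw [dim] at hN ⊢
  exact mul_one_div_cancel hN.ne'

lemma moneyScheme_complete (D : World) : (moneyScheme D).HasCompletenessError 0 := by
  intro n s
  change 1 - 0 ≤ ((authCircuit (n / 28)).run (oracleOf D) (tensor (basisState (publicKeyOf D n s))
    (pureState (phaseState (notePhase D n s)))) (fun _ => true) (fun _ => true)).re
  have : phaseOf (D (n / 28)) (publicKeyOf D n s ∘ (pubEquiv _).symm) = notePhase D n s := by
    rw [publicKeyOf, Function.comp_assoc, Equiv.self_comp_symm, Function.comp_id, notePhase]
  rw [auth_run_pureState, this, phaseProjSelf_phaseState, nsq_phaseState]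
  simp

/-- The authenticator's acceptance probability on a register of a larger pure state. -/
lemma acceptProb_reduce_pureState (D : World) {ι : Type} [Fintype ι] [DecidableEq ι]
    (e : PubIdx d → Bool) (u : Fin (12 * d) ↪ ι) (Ψ : (ι → Bool) → ℂ) :
    (authCircuit d).acceptProb (oracleOf D)
      (tensor (basisState (e ∘ pubEquiv d)) (reduce u (pureState Ψ))) =
      nsq (phaseProj (phaseOf (D d) e) u Ψ) := by
  have hN : (dim (Fin (12 * d)) : ℂ) ≠ 0 := by exact_mod_cast dim_pos.ne'
  have h := run_tensor_reduce (oracleOf D) (authCircuit d) (basisState (e ∘ pubEquiv d)) u Ψ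
    (fun _ => true) (fun _ => true)
  have he : (e ∘ pubEquiv d) ∘ (pubEquiv d).symm = e := by
    rw [Function.comp_assoc, Equiv.self_comp_symm, Function.comp_id]
  simp only [auth_run_pureState, he] at h
  rw [← Complex.ofReal_sum, sum_nsq_phaseProjSelf, Complex.ofReal_mul] at h
  rw [QCircuit.acceptProb, mul_left_cancel₀ hN h, Complex.ofReal_re]

lemma forger_run {k r : ℕ} (U : QuantumOracle) (C : Forger d k r) (e : PubIdx d → Bool)
    (f : Phase d) :
    C.run U (tensor (basisState (e ∘ pubEquiv d)) (tensorPow k (pureState (phaseState f)))) =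
      reduce C.out (pureState (forgedState U C e f)) := by
  rw [basisState_eq_pureState, tensorPow_pureState, tensor_pureState, run_pureState,
    forgedState]
  congr 4
  ext a
  rw [forgerInput, Pi.single_apply]
  rfl

/-- Acceptance of a register has probability equal to the squared norm of its projection, and only
the key bits selected by `keyEmb n` matter, so the average over all secret keys is an average over
the keys of level `n / 28`. -/
lemma sum_passProb (D : World) {n k r : ℕ} (C : (moneyScheme D).Counterfeiter n k r) :
    ∑ i, (moneyScheme D).passProb C i =
      𝔼 z : KeyIdx (n / 28) → Bool, forgedCount (oracleOf D) (C : Forger (n / 28) k r)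
        (publicOf (D (n / 28)) z) (phaseOf (D (n / 28)) (publicOf (D (n / 28)) z)) := by
  have h1 : ∀ i, (moneyScheme D).passProb C i = 𝔼 s : Fin n → Bool,
      (moneyScheme D).acceptProb n ((moneyScheme D).publicKey n s)
        (reduce (Function.Embedding.sectR i (Fin ((moneyScheme D).noteLen n)))
          ((moneyScheme D).forged C s)) := by
    intro i
    rw [MoneyScheme.passProb, Fintype.expect_eq_sum_div_card]
    congr 1
    simp
  have h2 : ∀ (s : Fin n → Bool) i, (moneyScheme D).acceptProb n ((moneyScheme D).publicKey n s)
        (reduce (Function.Embedding.sectR i (Fin ((moneyScheme D).noteLen n)))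
          ((moneyScheme D).forged C s)) =
      nsq (phaseProj (notePhase D n s) (noteReg (C : Forger (n / 28) k r) i)
        (forgedState (oracleOf D) (C : Forger (n / 28) k r)
        (publicOf (D (n / 28)) (s ∘ keyEmb n)) (notePhase D n s))) := by
    intro s i
    have h3 : (moneyScheme D).forged C s = reduce C.out (pureState
        (forgedState (oracleOf D) (C : Forger (n / 28) k r)
          (publicOf (D (n / 28)) (s ∘ keyEmb n)) (notePhase D n s))) := by
      change C.run (oracleOf D) (tensor (basisState (publicKeyOf D n s))
        (tensorPow k (pureState (phaseState (notePhase D n s))))) = _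
      exact forger_run _ _ _ _
    rw [h3, reduce_reduce]
    exact acceptProb_reduce_pureState D _ _ _
  simp only [h1, h2]
  rw [← Finset.expect_sum_comm, ← expect_comp_splice (keyEmb n)]
  rfl

end

section

variable {d k r : ℕ}

/-! ## Averages over the oracle -/

section Expect

variable {α β : Type} [Fintype α] [Fintype β]

lemma expect_indicator_eq [Nonempty β] [DecidableEq β] (b : β) :
    𝔼 y, (if y = b then (1 : ℝ) else 0) = 1 / Fintype.card β := by
  rw [Fintype.expect_eq_sum_div_card, Finset.sum_ite_eq' univ b, if_pos (mem_univ _)]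

lemma expect_prod_type (F : α × β → ℝ) : 𝔼 p, F p = 𝔼 a, 𝔼 b, F (a, b) :=
  Finset.expect_product univ univ F

/-- The value of a uniformly random function at `i` may be drawn afresh and independently. This
separates the tag of a secret location, or the chosen column of a row, from the rest of the random
data. -/
lemma expect_apply_swap [DecidableEq α] [Nonempty β] (i : α) (F : (α → β) → β → ℝ) :
    𝔼 g, F g (g i) = 𝔼 g, 𝔼 y, F (Function.update g i y) y := by
  rw [← expect_update i]
  simp only [Function.update_self]

lemma expect_le_expect {F G : α → ℝ} (h : ∀ a, F a ≤ G a) : 𝔼 a, F a ≤ 𝔼 a, G a :=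
  Finset.expect_le_expect fun a _ => h a

lemma expect_add_const [Nonempty α] (F : α → ℝ) (c : ℝ) : 𝔼 a, (F a + c) = 𝔼 a, F a + c := by
  rw [Finset.expect_add_distrib, Fintype.expect_const]

lemma expect_indicator_apply_eq [DecidableEq α] [Nonempty β] [DecidableEq β] (i : α) (b : β) :
    𝔼 g : α → β, (if g i = b then (1 : ℝ) else 0) = 1 / Fintype.card β := by
  rw [expect_apply_swap i fun _ y => if y = b then (1 : ℝ) else 0]
  simp only [expect_indicator_eq, Fintype.expect_const]

lemma expect_indicator_range_le [DecidableEq α] [Nonempty β] [DecidableEq β] (g : α → β) :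
    𝔼 y, (if ∃ i, g i = y then (1 : ℝ) else 0) ≤ Fintype.card α / Fintype.card β := by
  classical
  have h : ∀ y, (if ∃ i, g i = y then (1 : ℝ) else 0) ≤ ∑ i, if y = g i then (1 : ℝ) else 0 := by
    intro y
    split_ifs with hy
    · obtain ⟨i, rfl⟩ := hy
      exact le_trans (by simp) (Finset.single_le_sum
        (f := fun j => if g i = g j then (1 : ℝ) else 0) (fun j _ => by split_ifs <;> simp)
        (mem_univ i))
    · exact Finset.sum_nonneg fun j _ => by split_ifs <;> simp
  refine (expect_le_expect h).trans_eq ?_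
  rw [Finset.expect_sum_comm]
  simp only [expect_indicator_eq, Finset.sum_const, card_univ, nsmul_eq_mul, mul_one_div]

end Expect

/-- The oracle of a world with the data of level `d` replaced. -/
def oracleAt (D : World) (L : LevelData d) : QuantumOracle := oracleOf (Function.update D d L)

/-- The block of data that is read at an address. -/
def addrBlock : Addr d → Row d × Column d
  | .inl z => keyBlock z
  | .inr e => pubBlock e

/-- The public key of a secret key names the same block, so the phase function behind it lies in
that block too. -/
lemma agreeAt_of_block_eq {L L' : LevelData d} {x : Addr d} (h : L (addrBlock x) = L' (addrBlock x)) :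
    AgreeAt L L' x := by
  rcases x with z | e
  · have h : L (keyBlock z) = L' (keyBlock z) := h
    have h1 : publicOf L z = publicOf L' z := by rw [publicOf, publicOf, h]
    refine ⟨h1, ?_⟩
    rw [← h1, phaseOf, phaseOf]
    change (L (keyBlock z)).2 _ = (L' (keyBlock z)).2 _
    rw [h]
  · have h : L (pubBlock e) = L' (pubBlock e) := h
    change (L (pubBlock e)).2 _ = (L' (pubBlock e)).2 _
    rw [h]

/-! ### Hybrid bounds averaged over a random change of the data of one level. -/

section Hybrid

variable (D : World) (C : Forger d k r) (e : PubIdx d → Bool) (f : Phase d) (L : LevelData d)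
  {Ω : Type} [Fintype Ω] [Nonempty Ω] (L' : Ω → LevelData d) (Δ : Ω → Set (Addr d)) {c : ℝ}

/-- The error of the hybrid argument. -/
def hybridError (C : Forger d k r) (c : ℝ) : ℝ := 4 * (k + r : ℕ) * C.gates.length * √c

/-- The run under `L` is fixed while the changed places `Δ ω` are random, so each gate reads in `Δ
ω` with expected amplitude at most `√c`. -/
lemma expect_l2_forgedState_sub_le (hL : ∀ ω, ∀ x ∉ Δ ω, AgreeAt L (L' ω) x)
    (hΔ : ∀ x, 𝔼 ω, (open Classical in if x ∈ Δ ω then (1 : ℝ) else 0) ≤ c) :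
    𝔼 ω, l2 (forgedState (oracleAt D (L' ω)) C e f - forgedState (oracleAt D L) C e f) ≤
      2 * (C.gates.length * √c) := by
  have h1 : ∀ ω, l2 (forgedState (oracleAt D (L' ω)) C e f - forgedState (oracleAt D L) C e f) ≤
      2 * readAmplitude (oracleAt D L) (Δ ω) C.gates (initState (forgerInput k e f)) := by
    intro ω
    refine l2_runGates_sub_le (d := d) C.gates (fun d' hd' => ?_) (fun x hx => ?_) _
    · rw [Function.update_of_ne hd', Function.update_of_ne hd']
    · rw [Function.update_self, Function.update_self]
      exact hL ω x hx
  refine (expect_le_expect h1).trans ?_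
  rw [← Finset.mul_expect]
  have := expect_readAmplitude_le Δ hΔ (oracleAt D L) C.gates
    (initState (n := C.ancillas) (forgerInput k e f))
  rw [l2, nsq_initState, nsq_forgerInput, Real.sqrt_one, mul_one] at this
  linarith

lemma expect_forgedCount_le_add (hL : ∀ ω, ∀ x ∉ Δ ω, AgreeAt L (L' ω) x)
    (hΔ : ∀ x, 𝔼 ω, (open Classical in if x ∈ Δ ω then (1 : ℝ) else 0) ≤ c) :
    𝔼 ω, forgedCount (oracleAt D (L' ω)) C e f ≤
      forgedCount (oracleAt D L) C e f + hybridError C c := by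
  refine (expect_le_expect fun ω => forgedCount_le_add (oracleAt D L) (oracleAt D (L' ω)) C e f).trans ?_
  have := expect_l2_forgedState_sub_le D C e f L L' Δ hL hΔ
  rw [Finset.expect_add_distrib, Fintype.expect_const, ← Finset.mul_expect, ← Finset.mul_expect,
    hybridError]
  have h := mul_le_mul_of_nonneg_left this (Nat.cast_nonneg (α := ℝ) (k + r))
  linarith

lemma forgedCount_le_expect_add (hL : ∀ ω, ∀ x ∉ Δ ω, AgreeAt L (L' ω) x)
    (hΔ : ∀ x, 𝔼 ω, (open Classical in if x ∈ Δ ω then (1 : ℝ) else 0) ≤ c) :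
    forgedCount (oracleAt D L) C e f ≤
      𝔼 ω, forgedCount (oracleAt D (L' ω)) C e f + hybridError C c := by
  have h0 := expect_le_expect fun ω => forgedCount_le_add (oracleAt D (L' ω)) (oracleAt D L) C e f
  have := expect_l2_forgedState_sub_le D C e f L L' Δ hL hΔ
  have hc : ∀ v w : (ForgerWires d k C.ancillas → Bool) → ℂ, l2 (v - w) = l2 (w - v) := by
    intro v w
    have : v - w = (-1 : ℂ) • (w - v) := by simp
    rw [l2, this, nsq_smul, norm_neg, norm_one, one_pow, one_mul, ← l2]
  rw [Finset.expect_add_distrib, Fintype.expect_const, ← Finset.mul_expect, ← Finset.mul_expect,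
    Finset.expect_congr rfl fun ω _ => hc _ _] at h0
  rw [hybridError]
  have h := mul_le_mul_of_nonneg_left this (Nat.cast_nonneg (α := ℝ) (k + r))
  linarith

end Hybrid

/-- The expected number of accepted registers, averaged over the secret keys of a block. -/
def blockCount (D : World) (C : Forger d k r) (L : LevelData d) (b : Row d × Column d) : ℝ :=
  𝔼 l, forgedCount (oracleAt D L) C (mkPub b ((L b).1 l)) ((L b).2 ((L b).1 l))

lemma blockCount_nonneg (D : World) (C : Forger d k r) (L : LevelData d) (b : Row d × Column d) :
    0 ≤ blockCount D C L b := Finset.expect_nonneg fun _ _ => forgedCount_nonneg _ _ _ _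

lemma blockCount_le (D : World) (C : Forger d k r) (L : LevelData d) (b : Row d × Column d) :
    blockCount D C L b ≤ (k + r : ℕ) :=
  (expect_le_expect fun _ => forgedCount_le _ _ _ _).trans_eq (Fintype.expect_const _)

lemma expect_forgedCount_eq (D : World) (C : Forger d k r) (L : LevelData d) :
    𝔼 z, forgedCount (oracleAt D L) C (publicOf L z) (phaseOf L (publicOf L z)) =
      𝔼 j, 𝔼 a, blockCount D C L (j, a) := by
  let E : (KeyIdx d → Bool) ≃ Row d × Column d × Loc d :=
    (Equiv.sumArrowEquivProdArrow _ _ _).trans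
      ((Equiv.refl _).prodCongr (Equiv.sumArrowEquivProdArrow _ _ _))
  have h := Fintype.expect_equiv E (fun z => forgedCount (oracleAt D L) C (publicOf L z)
    (phaseOf L (publicOf L z))) (fun p => forgedCount (oracleAt D L) C
      (mkPub (p.1, p.2.1) ((L (p.1, p.2.1)).1 p.2.2))
      ((L (p.1, p.2.1)).2 ((L (p.1, p.2.1)).1 p.2.2))) fun z => rfl
  rw [h, expect_prod_type]
  simp only [expect_prod_type]
  rfl

/-- The bound for a counterfeiter when the data of the block are random. -/
def countBound (C : Forger d k r) (η : ℝ) : ℝ :=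
  k * (1 + (k + r : ℕ) / dim (Fin (12 * d))) * (1 + 3 * η) +
    2 * (k + r : ℕ) * (2 * keepError (Fin (12 * d)) k + η) +
    (k + r : ℕ) * ((Fintype.card (Loc d) : ℝ) / Fintype.card (Tag d)) +
    hybridError C (1 / Fintype.card (Loc d))

/-- Give the secret location `l` a fresh tag `y`, then take this change back in the bank but keep
`y` in the public key: a circuit hardly finds the random `l`. Unless `y` happens to be a tag in use,
no secret key has the public key with tag `y`, its phase function is uniform, and the bound on
copying phase states applies. -/
theorem expect_blockCount_le (D : World) (C : Forger d k r) (L : LevelData d)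
    (b : Row d × Column d) {η : ℝ}
    (hη : (1 + 2 * keepError (Fin (12 * d)) k) ^ C.gates.length - 1 ≤ η) (hη1 : η ≤ 1) :
    𝔼 β, blockCount D C (Function.update L b β) b ≤ countBound C η := by
  set Φ : (Loc d → Tag d) → (Tag d → Phase d) → Tag d → ℝ := fun g f y =>
    forgedCount (oracleAt D (Function.update L b (g, f))) C (mkPub b y) (f y) with hΦ
  -- The tag of `l` is resampled as `y`, so that `g`, `y` and `l` are independent.
  have h1 : 𝔼 β, blockCount D C (Function.update L b β) b =
      𝔼 g, 𝔼 f, 𝔼 y, 𝔼 l, Φ (Function.update g l y) f y := by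
    rw [expect_prod_type]
    simp only [blockCount, Function.update_self]
    rw [Finset.expect_comm]
    rw [Finset.expect_comm (f := fun g f => 𝔼 y, 𝔼 l, Φ (Function.update g l y) f y)]
    refine Finset.expect_congr rfl fun f _ => ?_
    rw [Finset.expect_comm]
    have : ∀ l : Loc d, 𝔼 g, Φ g f (g l) = 𝔼 g, 𝔼 y, Φ (Function.update g l y) f y :=
      fun l => expect_apply_swap l fun g y => Φ g f y
    refine (Finset.expect_congr rfl fun l _ => this l).trans ?_
    rw [Finset.expect_comm]
    refine Finset.expect_congr rfl fun g _ => ?_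
    rw [Finset.expect_comm]
  -- Only bank queries at location `l` can notice the change of tag, and a given query has this
  -- location with probability `1 / Fintype.card (Loc d)`. Verification queries never consult the
  -- tag table.
  have h2 : ∀ g f y, 𝔼 l, Φ (Function.update g l y) f y ≤
      Φ g f y + hybridError C (1 / Fintype.card (Loc d)) := by
    intro g f y
    refine expect_forgedCount_le_add D C (mkPub b y) (f y) (Function.update L b (g, f))
      (fun l => Function.update L b (Function.update g l y, f))
      (fun l => {x | ∃ z, x = .inl z ∧ keyLoc z = l}) (fun l x hx => ?_) fun x => ?_
    · rcases x with z | e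
      · have hz : keyLoc z ≠ l := fun h => hx ⟨z, rfl, h⟩
        have h3 : publicOf (Function.update L b (Function.update g l y, f)) z =
            publicOf (Function.update L b (g, f)) z := by
          unfold publicOf
          by_cases hb : keyBlock z = b
          · subst hb
            simp only [Function.update_self, Function.update_of_ne hz]
          · rw [Function.update_of_ne hb, Function.update_of_ne hb]
        refine ⟨h3.symm, ?_⟩
        rw [h3]
        unfold phaseOf
        by_cases hb : pubBlock (publicOf (Function.update L b (g, f)) z) = b
        · rw [hb, Function.update_self, Function.update_self]
        · rw [Function.update_of_ne hb, Function.update_of_ne hb]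
      · change phaseOf _ _ = phaseOf _ _
        unfold phaseOf
        by_cases hb : pubBlock e = b
        · rw [hb, Function.update_self, Function.update_self]
        · rw [Function.update_of_ne hb, Function.update_of_ne hb]
    · rcases x with z | e
      · refine le_of_eq ?_
        rw [← expect_indicator_eq (keyLoc z)]
        refine Finset.expect_congr rfl fun l _ => ?_
        by_cases h : l = keyLoc z
        · rw [if_pos h, if_pos]
          exact ⟨z, rfl, h.symm⟩
        · rw [if_neg h, if_neg]
          rintro ⟨z', hz', rfl⟩
          exact h (by rw [Sum.inl_injective hz'])
      · have : ∀ l : Loc d, (Sum.inr e : Addr d) ∉ {x : Addr d | ∃ z, x = .inl z ∧ keyLoc z = l} := by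
          rintro l ⟨z, hz, -⟩
          exact Sum.inr_ne_inl hz
        simp only [this, if_false, Finset.expect_const_zero]
        positivity
  -- With `y` outside the range of `g`, the phase function of `y` is resampled and the remaining
  -- data are fixed.
  have h3 : ∀ g y, (∀ l, g l ≠ y) → 𝔼 f, Φ g f y ≤
      k * (1 + (k + r : ℕ) / dim (Fin (12 * d))) * (1 + 3 * η) +
        2 * (k + r : ℕ) * (2 * keepError (Fin (12 * d)) k + η) := by
    intro g y hg
    rw [← expect_update y]
    refine (expect_le_expect fun f => ?_).trans_eq (Fintype.expect_const _)
    have h4 : ∀ h, Φ g (Function.update f y h) y = forgedCount (oracleOf (Function.update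
        (Function.update D d (Function.update L b (g, f))) d
        (setPhase (Function.update D d (Function.update L b (g, f)) d) (mkPub b y) h))) C
        (mkPub b y) h := by
      intro h
      simp only [hΦ, oracleAt, Function.update_self, Function.update_idem, setPhase, pubBlock_mkPub,
        pubTag_mkPub]
    simp only [h4]
    refine expect_forgedCount_le _ (fun z hz => ?_) C hη hη1
    rw [Function.update_self] at hz
    have hb : keyBlock z = b := congrArg pubBlock hz
    have ht := congrArg pubTag hz
    rw [publicOf, hb, pubTag_mkPub, pubTag_mkPub, Function.update_self] at ht
    exact hg _ ht
  have hB : 0 ≤ k * (1 + (k + r : ℕ) / dim (Fin (12 * d))) * (1 + 3 * η) +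
        2 * (k + r : ℕ) * (2 * keepError (Fin (12 * d)) k + η) := by
    have hk := keepError_nonneg (κ := Fin (12 * d)) k
    have hN := dim_pos (κ := Fin (12 * d))
    have : (1 : ℝ) ≤ (1 + 2 * keepError (Fin (12 * d)) k) ^ C.gates.length :=
      one_le_pow₀ (by linarith)
    have : 0 ≤ η := by linarith
    positivity
  have h5 : ∀ g, 𝔼 f, 𝔼 y, Φ g f y ≤
      k * (1 + (k + r : ℕ) / dim (Fin (12 * d))) * (1 + 3 * η) +
        2 * (k + r : ℕ) * (2 * keepError (Fin (12 * d)) k + η) +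
      (k + r : ℕ) * ((Fintype.card (Loc d) : ℝ) / Fintype.card (Tag d)) := by
    intro g
    rw [Finset.expect_comm]
    have h6 : ∀ y, 𝔼 f, Φ g f y ≤ (k * (1 + (k + r : ℕ) / dim (Fin (12 * d))) * (1 + 3 * η) +
        2 * (k + r : ℕ) * (2 * keepError (Fin (12 * d)) k + η)) +
        (k + r : ℕ) * (if ∃ l, g l = y then (1 : ℝ) else 0) := by
      intro y
      by_cases hy : ∃ l, g l = y
      · rw [if_pos hy, mul_one]
        have : 𝔼 f, Φ g f y ≤ (k + r : ℕ) :=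
          (expect_le_expect fun f => forgedCount_le _ _ _ _).trans_eq (Fintype.expect_const _)
        linarith
      · rw [if_neg hy, mul_zero, add_zero]
        exact h3 g y fun l hl => hy ⟨l, hl⟩
    refine (expect_le_expect h6).trans ?_
    rw [Finset.expect_add_distrib, Fintype.expect_const, ← Finset.mul_expect]
    have := mul_le_mul_of_nonneg_left (expect_indicator_range_le g)
      (Nat.cast_nonneg (α := ℝ) (k + r))
    linarith
  rw [h1, countBound]
  refine (expect_le_expect fun g => expect_le_expect fun f => expect_le_expect (h2 g f)).trans ?_
  simp only [expect_add_const]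
  gcongr
  exact (expect_le_expect h5).trans_eq (Fintype.expect_const _)

/-! ## Blanking one block in every other row -/

/-- The data where in every row other than `j` the block chosen by `ρ` is blank. -/
def blank (L : LevelData d) (ρ : Row d → Column d) (j : Row d) : LevelData d := fun b =>
  if b.1 ≠ j ∧ ρ b.1 = b.2 then (fun _ _ => false, fun _ _ => false) else L b

/-- Blanking for row `j` ignores the choice in row `j`, so `ρ j` remains uniform and independent of
the blanked data. -/
lemma blank_update (L : LevelData d) (ρ : Row d → Column d) (j : Row d) (a : Column d) :
    blank L (Function.update ρ j a) j = blank L ρ j := by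
  ext1 b
  unfold blank
  by_cases h : b.1 = j
  · simp [h]
  · rw [Function.update_of_ne h]

lemma blank_row (L : LevelData d) (ρ : Row d → Column d) (j : Row d) (a : Column d) :
    blank L ρ j (j, a) = L (j, a) := by
  simp [blank]

/-- The data at an address lie in a single block, and that block is blanked with probability at most
`1 / Fintype.card (Column d)` over `ρ`. The block `(j, a)` itself is never blanked. -/
lemma blockCount_le_expect_blank (D : World) (C : Forger d k r) (L : LevelData d) (j : Row d)
    (a : Column d) : blockCount D C L (j, a) ≤
      𝔼 ρ, blockCount D C (blank L ρ j) (j, a) + hybridError C (1 / Fintype.card (Column d)) := by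
  unfold blockCount
  simp only [blank_row]
  rw [Finset.expect_comm, ← expect_add_const]
  refine expect_le_expect fun l => ?_
  refine forgedCount_le_expect_add D C _ _ L (fun ρ => blank L ρ j)
    (fun ρ => {x | (addrBlock x).1 ≠ j ∧ ρ (addrBlock x).1 = (addrBlock x).2})
    (fun ρ x hx => agreeAt_of_block_eq ?_) fun x => ?_
  · exact (if_neg hx).symm
  · rw [← expect_indicator_apply_eq (addrBlock x).1 (addrBlock x).2]
    refine expect_le_expect fun ρ => ?_
    by_cases h : ρ (addrBlock x).1 = (addrBlock x).2
    · rw [if_pos h]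
      split_ifs <;> simp
    · rw [if_neg h, if_neg fun h' => h h'.2]

/-- The average over all keys is almost an average over random choices of one block per row, where
the counts of the chosen blocks do not depend on the data of the other chosen blocks. -/
lemma expect_forgedCount_le_expect_blank (D : World) (C : Forger d k r) (L : LevelData d) :
    𝔼 z, forgedCount (oracleAt D L) C (publicOf L z) (phaseOf L (publicOf L z)) ≤
      𝔼 ρ : Row d → Column d, 𝔼 j, blockCount D C (blank L ρ j) (j, ρ j) +
        hybridError C (1 / Fintype.card (Column d)) := by
  rw [expect_forgedCount_eq, Finset.expect_comm (f := fun (ρ : Row d → Column d) j =>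
    blockCount D C (blank L ρ j) (j, ρ j)), ← expect_add_const]
  refine expect_le_expect fun j => ?_
  -- By independence, `ρ j` plays the part of the uniform column `a`.
  rw [expect_apply_swap j fun ρ a => blockCount D C (blank L ρ j) (j, a)]
  simp only [blank_update]
  rw [Finset.expect_comm, ← expect_add_const]
  exact expect_le_expect fun a => blockCount_le_expect_blank D C L j a

end

section

variable {d k r : ℕ}

/-! ## Concentration -/

/-- Jensen's inequality, from the tangent of the exponential at the mean. -/
lemma exp_expect_le {α : Type} [Fintype α] [Nonempty α] (f : α → ℝ) :
    Real.exp (𝔼 a, f a) ≤ 𝔼 a, Real.exp (f a) := by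
  set m := 𝔼 a, f a with hm
  have h : ∀ a, Real.exp m * (f a + (1 - m)) ≤ Real.exp (f a) := by
    intro a
    have h1 := Real.add_one_le_exp (f a - m)
    calc Real.exp m * (f a + (1 - m)) ≤ Real.exp m * Real.exp (f a - m) := by
          gcongr; linarith
      _ = Real.exp (f a) := by rw [← Real.exp_add]; congr 1; ring
  have h2 := expect_le_expect h
  rw [← Finset.mul_expect, expect_add_const, ← hm] at h2
  linarith [h2]

lemma expect_prod_apply {α β : Type} [Fintype α] [DecidableEq α] [Fintype β] [Nonempty β]
    (F : α → β → ℝ) : 𝔼 y : α → β, ∏ a, F a (y a) = ∏ a, 𝔼 b, F a b := by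
  simp only [Fintype.expect_eq_sum_div_card, Finset.prod_div_distrib]
  rw [Finset.prod_univ_sum, Fintype.piFinset_univ]
  simp

/-- Exponential moments of a bounded random variable. -/
lemma expect_exp_le {α : Type} [Fintype α] [Nonempty α] (f : α → ℝ) {t M μ : ℝ} (ht : 0 ≤ t)
    (h0 : ∀ a, 0 ≤ f a) (hM : ∀ a, f a ≤ M) (hμ0 : 0 ≤ μ) (hμM : μ ≤ M) (htM : t * M ≤ 1)
    (hf : 𝔼 a, f a ≤ μ) : 𝔼 a, Real.exp (t * (f a - μ)) ≤ Real.exp ((t * M) ^ 2) := by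
  -- This is `exp x ≤ 1 + x + x ^ 2` for `|x| ≤ 1`, which is where `t * M ≤ 1` enters.
  have h : ∀ a, Real.exp (t * (f a - μ)) ≤ t * f a + (1 - t * μ + (t * M) ^ 2) := by
    intro a
    have h1 : |f a - μ| ≤ M := abs_le.2 ⟨by linarith [h0 a], by linarith [hM a]⟩
    have h2 : |t * (f a - μ)| ≤ t * M := by
      rw [abs_mul, abs_of_nonneg ht]; gcongr
    have h3 := (abs_le.1 (Real.abs_exp_sub_one_sub_id_le (h2.trans htM))).2
    have h4 := sq_le_sq' (by linarith [abs_le.1 h2 |>.1]) (abs_le.1 h2 |>.2)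
    linarith
  refine (expect_le_expect h).trans ?_
  rw [expect_add_const, ← Finset.mul_expect]
  have h5 := Real.add_one_le_exp ((t * M) ^ 2)
  have h6 := mul_le_mul_of_nonneg_left hf ht
  linarith

/-- The blocks chosen by `ρ`, one per row. -/
def chosenBlocks (ρ : Row d → Column d) : Row d ↪ Row d × Column d :=
  ⟨fun j => (j, ρ j), fun _ _ h => congrArg Prod.fst h⟩

/-- Resampling all chosen blocks changes the data seen by row `j` only in the block `(j, ρ j)`. This
is the source of independence between rows. -/
lemma blank_splice (L : LevelData d) (ρ : Row d → Column d) (y : Row d → BlockData d) (j : Row d) :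
    blank (splice (chosenBlocks ρ) y L) ρ j = Function.update (blank L ρ j) (j, ρ j) (y j) := by
  ext1 b
  by_cases hb : ρ b.1 = b.2
  · have hb' : b = chosenBlocks ρ b.1 := by
      rw [← Prod.mk.eta (p := b), ← hb]; rfl
    by_cases hj : b.1 = j
    · have : b = (j, ρ j) := by rw [hb', hj]; rfl
      rw [this, Function.update_self, blank, if_neg (by simp)]
      exact splice_apply (chosenBlocks ρ) y L j
    · have : b ≠ (j, ρ j) := fun h => hj (congrArg Prod.fst h)
      rw [Function.update_of_ne this, blank, blank, if_pos ⟨hj, hb⟩, if_pos ⟨hj, hb⟩]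
  · have : b ≠ (j, ρ j) := by rintro rfl; exact hb rfl
    rw [Function.update_of_ne this, blank, blank, if_neg fun h => hb h.2, if_neg fun h => hb h.2]
    refine splice_of_not_mem _ _ _ fun i hi => hb ?_
    rw [← hi]
    rfl

/-- After the chosen blocks are resampled with the others fixed, the `j`-th factor depends only on
the `j`-th new block, so the expectation of the product factors. Each factor is an exponential
moment of a bounded count whose mean is controlled by `expect_blockCount_le`. -/
lemma expect_exp_blank_le (D : World) (C : Forger d k r) {η t M μ : ℝ}
    (hη : (1 + 2 * keepError (Fin (12 * d)) k) ^ C.gates.length - 1 ≤ η) (hη1 : η ≤ 1)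
    (hμ0 : 0 ≤ μ) (hμ : countBound C η ≤ μ) (hμM : μ ≤ M) (hkM : ((k + r : ℕ) : ℝ) ≤ M)
    (ht : 0 ≤ t) (htM : t * M ≤ 1) (ρ : Row d → Column d) :
    𝔼 L : LevelData d, ∏ j, Real.exp (t * (blockCount D C (blank L ρ j) (j, ρ j) - μ)) ≤
      Real.exp (Fintype.card (Row d) * (t * M) ^ 2) := by
  rw [← expect_expect_splice (chosenBlocks ρ)]
  refine (expect_le_expect fun L => ?_).trans_eq (Fintype.expect_const _)
  simp only [blank_splice]
  rw [expect_prod_apply fun j β =>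
    Real.exp (t * (blockCount D C (Function.update (blank L ρ j) (j, ρ j) β) (j, ρ j) - μ))]
  refine (Finset.prod_le_prod (fun j _ => Finset.expect_nonneg fun _ _ => (Real.exp_pos _).le)
    fun j _ => expect_exp_le (μ := μ) (M := M) _ ht (fun _ => blockCount_nonneg _ _ _ _)
      (fun _ => (blockCount_le _ _ _ _).trans hkM) hμ0 hμM htM
      ((expect_blockCount_le D C (blank L ρ j) (j, ρ j) hη hη1).trans hμ)).trans_eq ?_
  rw [Finset.prod_const, ← Real.exp_nat_mul]
  rfl

/-- For all but few data of level `d`, a given counterfeiter hardly gains anything. -/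
theorem expect_indicator_forgedCount_le (D : World) (C : Forger d k r) {η t M μ ε : ℝ}
    (hη : (1 + 2 * keepError (Fin (12 * d)) k) ^ C.gates.length - 1 ≤ η) (hη1 : η ≤ 1)
    (hμ0 : 0 ≤ μ) (hμ : countBound C η ≤ μ) (hμM : μ ≤ M) (hkM : ((k + r : ℕ) : ℝ) ≤ M)
    (ht : 0 ≤ t) (htM : t * M ≤ 1) :
    𝔼 L : LevelData d, (if μ + ε + hybridError C (1 / Fintype.card (Column d)) <
        𝔼 z, forgedCount (oracleAt D L) C (publicOf L z) (phaseOf L (publicOf L z))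
      then (1 : ℝ) else 0) ≤ Real.exp (Fintype.card (Row d) * ((t * M) ^ 2 - t * ε)) := by
  set N := (Fintype.card (Row d) : ℝ) with hN
  have hN0 : 0 < N := by rw [hN]; exact_mod_cast Fintype.card_pos
  set Y : LevelData d → (Row d → Column d) → Row d → ℝ := fun L ρ j =>
    blockCount D C (blank L ρ j) (j, ρ j) with hY
  -- Markov's inequality for the exponential moment.
  have h1 : ∀ L : LevelData d, (if μ + ε + hybridError C (1 / Fintype.card (Column d)) <
        𝔼 z, forgedCount (oracleAt D L) C (publicOf L z) (phaseOf L (publicOf L z))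
      then (1 : ℝ) else 0) ≤ Real.exp (-(t * N * ε)) * 𝔼 ρ, ∏ j, Real.exp (t * (Y L ρ j - μ)) := by
    intro L
    split_ifs with h
    · have h2 := expect_forgedCount_le_expect_blank D C L
      have h3 : ε ≤ 𝔼 ρ, 𝔼 j, Y L ρ j - μ := by linarith
      have h4 : ∀ ρ, ∏ j, Real.exp (t * (Y L ρ j - μ)) =
          Real.exp (t * N * (𝔼 j, Y L ρ j - μ)) := by
        intro ρ
        rw [← Real.exp_sum, ← Finset.mul_sum, Finset.sum_sub_distrib, Finset.sum_const, card_univ,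
          nsmul_eq_mul, Fintype.expect_eq_sum_div_card, ← hN]
        congr 1
        field_simp
      simp only [h4]
      -- Jensen takes the average over `ρ` out of the exponential, so that `ρ` can be fixed before
      -- averaging over `L`.
      have h5 := exp_expect_le fun ρ => t * N * (𝔼 j, Y L ρ j - μ)
      have h6 : 𝔼 ρ, (t * N * (𝔼 j, Y L ρ j - μ)) = t * N * (𝔼 ρ, 𝔼 j, Y L ρ j - μ) := by
        rw [← Finset.mul_expect, Finset.expect_sub_distrib, Fintype.expect_const]
      rw [h6] at h5
      refine le_trans ?_ (mul_le_mul_of_nonneg_left h5 (Real.exp_pos _).le)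
      rw [← Real.exp_add]
      refine Real.one_le_exp ?_
      have := mul_le_mul_of_nonneg_left h3 (mul_nonneg ht hN0.le)
      linarith
    · refine mul_nonneg (Real.exp_pos _).le (Finset.expect_nonneg fun ρ _ => ?_)
      exact Finset.prod_nonneg fun j _ => (Real.exp_pos _).le
  refine (expect_le_expect h1).trans ?_
  rw [← Finset.mul_expect, Finset.expect_comm]
  have h7 : 𝔼 ρ, 𝔼 L, ∏ j, Real.exp (t * (Y L ρ j - μ)) ≤ Real.exp (N * (t * M) ^ 2) :=
    (expect_le_expect fun ρ =>
      expect_exp_blank_le D C hη hη1 hμ0 hμ hμM hkM ht htM ρ).trans_eq (Fintype.expect_const _)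
  refine (mul_le_mul_of_nonneg_left h7 (Real.exp_pos _).le).trans_eq ?_
  rw [← Real.exp_add]
  congr 1
  ring

end

section

/-! ## Union bounds -/

/-- The union bound for events that are labelled injectively by finitely many codes. -/
lemma expect_indicator_exists_le {Ω α γ : Type} [Fintype Ω] [Fintype γ] (code : α → γ)
    {s : Set α} (hinj : Set.InjOn code s) (P : α → Ω → Prop) {c : ℝ} (hc : 0 ≤ c)
    (h : ∀ a ∈ s, 𝔼 ω, (open Classical in if P a ω then (1 : ℝ) else 0) ≤ c) :
    𝔼 ω, (open Classical in if ∃ a ∈ s, P a ω then (1 : ℝ) else 0) ≤ Fintype.card γ * c := by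
  classical
  have h1 : ∀ ω, (if ∃ a ∈ s, P a ω then (1 : ℝ) else 0) ≤
      ∑ x, if ∃ a ∈ s, code a = x ∧ P a ω then (1 : ℝ) else 0 := by
    intro ω
    split_ifs with hω
    · obtain ⟨a, ha, hP⟩ := hω
      refine le_trans ?_ (Finset.single_le_sum
        (f := fun x => if ∃ a ∈ s, code a = x ∧ P a ω then (1 : ℝ) else 0)
        (fun x _ => by split_ifs <;> simp) (mem_univ (code a)))
      rw [if_pos ⟨a, ha, rfl, hP⟩]
    · exact Finset.sum_nonneg fun x _ => by split_ifs <;> simp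
  have h2 : ∀ x, 𝔼 ω, (if ∃ a ∈ s, code a = x ∧ P a ω then (1 : ℝ) else 0) ≤ c := by
    intro x
    by_cases hx : ∃ a ∈ s, code a = x
    · obtain ⟨a, ha, rfl⟩ := hx
      refine le_trans (expect_le_expect fun ω => ?_) (h a ha)
      by_cases hP : P a ω
      · rw [if_pos hP]; split_ifs <;> simp
      · rw [if_neg hP, if_neg]
        rintro ⟨a', ha', he, hP'⟩
        exact hP (hinj ha' ha he ▸ hP')
    · have : ∀ ω, ¬ ∃ a ∈ s, code a = x ∧ P a ω := fun ω ⟨a, ha, he, _⟩ => hx ⟨a, ha, he⟩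
      simp only [this, if_false, Finset.expect_const_zero]
      exact hc
  have h3 := expect_le_expect h1
  rw [Finset.expect_sum_comm] at h3
  have h4 := Finset.sum_le_sum fun x (_ : x ∈ (univ : Finset γ)) => h2 x
  rw [Finset.sum_const, card_univ, nsmul_eq_mul] at h4
  convert h3.trans h4

lemma expect_pi_update {I : Type} [Fintype I] [DecidableEq I] {β : I → Type} [∀ i, Fintype (β i)]
    [∀ i, Nonempty (β i)] (i : I) (F : (∀ i, β i) → ℝ) :
    𝔼 x, 𝔼 y, F (Function.update x i y) = 𝔼 x, F x := by
  let E : ((∀ i, β i) × β i) ≃ ((∀ i, β i) × β i) :=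
    { toFun := fun p => (Function.update p.1 i p.2, p.1 i)
      invFun := fun p => (Function.update p.1 i p.2, p.1 i)
      left_inv := fun p => by simp
      right_inv := fun p => by simp }
  have h := Fintype.expect_equiv E (fun p => F (Function.update p.1 i p.2)) (fun p => F p.1)
    fun p => rfl
  rw [expect_prod_type, expect_prod_type] at h
  simpa only [Fintype.expect_const] using h

section Compactness

variable {β : ℕ → Type} [∀ d, Fintype (β d)] [∀ d, Nonempty (β d)]

/-- A union bound on the finitely many coordinates below `n`, the others being frozen. The bound for
the `i`-th event holds whatever the other coordinates are, so resampling coordinate `i` alone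
suffices. -/
lemma exists_forall_le_not (Bad : ℕ → (∀ d, β d) → Prop) {p : ℕ → ℝ}
    (hp : ∀ n, ∑ d ∈ range n, p d < 1)
    (h : ∀ d D, 𝔼 y, (open Classical in if Bad d (Function.update D d y) then (1 : ℝ) else 0) ≤ p d)
    (n : ℕ) : ∃ D, ∀ d < n, ¬ Bad d D := by
  classical
  obtain ⟨D₀⟩ : Nonempty (∀ d, β d) := inferInstance
  let ext : (∀ d : Fin n, β d) → ∀ d, β d := fun x d => if hd : d < n then x ⟨d, hd⟩ else D₀ d
  have hext : ∀ x (i : Fin n) y, ext (Function.update x i y) = Function.update (ext x) i y := by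
    intro x i y
    ext d
    by_cases hd : d = i
    · subst hd
      simp [ext]
    · rw [Function.update_of_ne hd]
      by_cases hd' : d < n
      · simp only [ext, hd', dif_pos]
        rw [Function.update_of_ne]
        exact fun he => hd (congrArg Fin.val he)
      · simp [ext, hd']
  by_contra! hcon
  have h1 : ∀ x, (1 : ℝ) ≤ ∑ i : Fin n, if Bad i (ext x) then (1 : ℝ) else 0 := by
    intro x
    obtain ⟨d, hd, hbad⟩ := hcon (ext x)
    refine le_trans ?_ (Finset.single_le_sum
      (f := fun i : Fin n => if Bad i (ext x) then (1 : ℝ) else 0)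
      (fun x _ => by split_ifs <;> simp) (mem_univ ⟨d, hd⟩))
    rw [if_pos hbad]
  have h2 := expect_le_expect h1
  rw [Fintype.expect_const, Finset.expect_sum_comm] at h2
  have h3 : ∀ i : Fin n, 𝔼 x, (if Bad i (ext x) then (1 : ℝ) else 0) ≤ p i := by
    intro i
    rw [← expect_pi_update i]
    simp only [hext]
    refine (expect_le_expect fun x => ?_).trans_eq (Fintype.expect_const _)
    convert h i (ext x)
  have h4 := h2.trans (Finset.sum_le_sum fun i _ => h3 i)
  rw [← Finset.sum_range fun d => p d] at h4
  linarith [hp n]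

/-- If bad events of small total probability depend on finitely many coordinates each, some point
avoids them all. -/
theorem exists_forall_not (Bad : ℕ → (∀ d, β d) → Prop) {p : ℕ → ℝ}
    (hp : ∀ n, ∑ d ∈ range n, p d < 1)
    (h : ∀ d D, 𝔼 y, (open Classical in if Bad d (Function.update D d y) then (1 : ℝ) else 0) ≤ p d)
    (hfin : ∀ d, ∃ N, ∀ D D' : ∀ d, β d, (∀ i ≤ N, D i = D' i) → Bad d D → Bad d D') :
    ∃ D, ∀ d, ¬ Bad d D := by
  let _ : ∀ d, TopologicalSpace (β d) := fun _ => ⊥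
  have : ∀ d, DiscreteTopology (β d) := fun _ => ⟨rfl⟩
  -- A bad event that looks at finitely many discrete coordinates is open.
  have hclosed : ∀ d, IsClosed {D | ¬ Bad d D} := by
    intro d
    rw [← isOpen_compl_iff]
    obtain ⟨N, hN⟩ := hfin d
    rw [isOpen_iff_mem_nhds]
    intro D hD
    have hD : Bad d D := not_not.1 hD
    have hopen : IsOpen (⋂ i ∈ range (N + 1), (fun D' : ∀ d, β d => D' i) ⁻¹' {D i}) :=
      isOpen_biInter_finset fun i _ => (isOpen_discrete _).preimage (continuous_apply i)
    refine Filter.mem_of_superset (hopen.mem_nhds (by simp)) fun D' hD' => ?_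
    refine not_not.2 (hN D D' (fun i hi => ?_) hD)
    have := Set.mem_iInter₂.1 hD' i (mem_range.2 (Nat.lt_succ_of_le hi))
    exact (Set.mem_singleton_iff.1 this).symm
  -- The product of finite discrete spaces is compact, and the sets that avoid the first `n` events
  -- are closed, nonempty and decreasing.
  obtain ⟨D, hD⟩ := IsCompact.nonempty_iInter_of_sequence_nonempty_isCompact_isClosed
    (fun n => ⋂ d ∈ range n, {D | ¬ Bad d D})
    (fun n => Set.biInter_subset_biInter_left fun d hd =>
      mem_range.2 ((mem_range.1 hd).trans (Nat.lt_succ_self n)))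
    (fun n => by
      obtain ⟨D, hD⟩ := exists_forall_le_not Bad hp h n
      exact ⟨D, Set.mem_iInter₂.2 fun d hd => hD d (mem_range.1 hd)⟩)
    (by simpa using isCompact_univ)
    (fun n => isClosed_biInter fun d _ => hclosed d)
  exact ⟨D, fun d => Set.mem_iInter₂.1 (Set.mem_iInter.1 hD (d + 1)) d (self_mem_range_succ d)⟩

end Compactness

/-! ## Counting circuits -/

section Codes

variable {A B : Type} [Fintype A] [Fintype B] {q : ℕ}

/-- A number below `q + 1` for every element of a small type. -/
def elemCode (q : ℕ) (a : A) : Fin (q + 1) := Fin.ofNat (q + 1) (Fintype.equivFin A a)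

lemma ofNat_inj {m n : ℕ} (hm : m ≤ q) (hn : n ≤ q) (h : Fin.ofNat (q + 1) m = Fin.ofNat (q + 1) n) :
    m = n := by
  have := congrArg Fin.val h
  simpa [Fin.ofNat, Nat.mod_eq_of_lt (Nat.lt_succ_of_le hm), Nat.mod_eq_of_lt (Nat.lt_succ_of_le hn)]
    using this

lemma elemCode_injective (h : Fintype.card A ≤ q) : Function.Injective (elemCode (A := A) q) := by
  intro a b hab
  have hlt : ∀ a : A, (Fintype.equivFin A a : ℕ) ≤ q := fun a =>
    (Fintype.equivFin A a).2.le.trans h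
  exact (Fintype.equivFin A).injective (Fin.ext (ofNat_inj (hlt a) (hlt b) hab))

/-- The code type depends on `q` only, so functions between different small types are coded alike;
codes that name no element are sent to `0`. -/
def funCode (q : ℕ) (f : A → B) : Fin (q + 1) → Fin (q + 1) :=
  Function.extend (elemCode q) (elemCode q ∘ f) 0

lemma funCode_injective (hA : Fintype.card A ≤ q) (hB : Fintype.card B ≤ q) :
    Function.Injective (funCode (A := A) (B := B) q) := by
  intro f g hfg
  ext1 a
  have := congrFun hfg (elemCode q a)
  rw [funCode, funCode, (elemCode_injective hA).extend_apply, (elemCode_injective hA).extend_apply]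
    at this
  exact elemCode_injective hB this

/-- One finite type for the gates on any set of at most `q` wires, so that circuits with different
wire types can be counted together. -/
abbrev GateCode (q : ℕ) : Type :=
  Fin 5 × Bool × Fin (q + 1) × Fin (q + 1) × (Fin (q + 1) → Fin (q + 1))

def gateCode (q : ℕ) : Gate A → GateCode q
  | .hadamard i => (0, false, elemCode q i, 0, 0)
  | .t i => (1, false, elemCode q i, 0, 0)
  | .cnot c i _ => (2, false, elemCode q i, elemCode q c, 0)
  | .oracle b m w => (3, b, 0, Fin.ofNat (q + 1) m, funCode q w)
  | .controlledOracle b c m w _ => (4, b, elemCode q c, Fin.ofNat (q + 1) m, funCode q w)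

lemma gateCode_injective (h : Fintype.card A ≤ q) : Function.Injective (gateCode (A := A) q) := by
  have hE := elemCode_injective h
  have hm : ∀ {m : ℕ}, (Fin m ↪ A) → m ≤ q := fun w =>
    le_trans (by simpa using Fintype.card_le_of_embedding w) h
  intro g g' hg
  cases g <;> cases g' <;> simp only [gateCode, Prod.mk.injEq] at hg <;>
    first
      | exact absurd hg.1 (by decide)
      | skip
  · rw [hE hg.2.2.1]
  · rw [hE hg.2.2.1]
  · obtain rfl := hE hg.2.2.1
    obtain rfl := hE hg.2.2.2.1
    rfl
  · rename_i b m w b' m' w'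
    obtain rfl : b = b' := hg.2.1
    obtain rfl : m = m' := ofNat_inj (hm w) (hm w') hg.2.2.2.1
    have := funCode_injective (by simpa using hm w) h hg.2.2.2.2
    obtain rfl : w = w' := DFunLike.coe_injective this
    rfl
  · rename_i b c m w _ b' c' m' w' _
    obtain rfl : b = b' := hg.2.1
    obtain rfl : c = c' := hE hg.2.2.1
    obtain rfl : m = m' := ofNat_inj (hm w) (hm w') hg.2.2.2.1
    have := funCode_injective (by simpa using hm w) h hg.2.2.2.2
    obtain rfl : w = w' := DFunLike.coe_injective this
    rfl

end Codes

variable {d : ℕ}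

/-- Counterfeiters of all types. -/
abbrev AnyForger (d : ℕ) : Type := Σ k r : ℕ, Forger d k r

abbrev ForgerCode (q : ℕ) : Type :=
  Fin (q + 1) × Fin (q + 1) × Fin (q + 1) × (Fin q → Option (GateCode q)) ×
    (Fin (q + 1) → Fin (q + 1))

def forgerCode (q : ℕ) (C : AnyForger d) : ForgerCode q :=
  (Fin.ofNat (q + 1) C.1, Fin.ofNat (q + 1) C.2.1, Fin.ofNat (q + 1) C.2.2.ancillas,
    fun i => C.2.2.gates[(i : ℕ)]?.map (gateCode q), funCode q C.2.2.out)

lemma card_forgerWires_le {k r : ℕ} (C : Forger d k r) :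
    Fintype.card (ForgerWires d k C.ancillas) + C.gates.length = C.size := by
  simp [QCircuit.size]

lemma card_forgerOut_le {k r : ℕ} (C : Forger d k r) : (k + r) * (12 * d) ≤ C.size := by
  have h := Fintype.card_le_of_embedding C.out
  rw [← card_forgerWires_le C]
  simp only [Fintype.card_prod, Fintype.card_fin] at h ⊢
  exact h.trans (Nat.le_add_right _ _)

/-- For positive `d` every output register occupies wires of its own; for `d = 0` the registers are
empty and the size would not bound `k + r`. -/
lemma add_le_size {k r : ℕ} (hd : 0 < d) (C : Forger d k r) : k + r ≤ C.size :=
  le_trans (Nat.le_mul_of_pos_right _ (by omega)) (card_forgerOut_le C)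

lemma forgerCode_injOn (hd : 0 < d) (q : ℕ) :
    Set.InjOn (forgerCode (d := d) q) {C | C.2.2.size ≤ q} := by
  rintro ⟨k, r, C⟩ hC ⟨k', r', C'⟩ hC' h
  have hC : C.size ≤ q := hC
  have hC' : C'.size ≤ q := hC'
  have b := (add_le_size hd C).trans hC
  have b' := (add_le_size hd C').trans hC'
  simp only [forgerCode, Prod.mk.injEq] at h
  obtain ⟨h1, h2, h3, h4, h5⟩ := h
  -- The numbers `k`, `r` and the ancilla count are identified first, because only then do the gates
  -- and outputs of the two circuits have the same type.
  obtain rfl := ofNat_inj (by omega) (by omega) h1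
  obtain rfl := ofNat_inj (by omega) (by omega) h2
  have a := card_forgerWires_le C
  have a' := card_forgerWires_le C'
  have hw : Fintype.card (ForgerWires d k C.ancillas) ≤ q := by omega
  have ho := (card_forgerOut_le C).trans hC
  have hl : C.gates.length ≤ q := by omega
  have hl' : C'.gates.length ≤ q := by omega
  have hanc : C.ancillas = C'.ancillas := by
    have e : C.ancillas ≤ C.size := by unfold QCircuit.size; omega
    have e' : C'.ancillas ≤ C'.size := by unfold QCircuit.size; omega
    exact ofNat_inj (e.trans hC) (e'.trans hC') h3
  obtain ⟨m, gs, w⟩ := C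
  obtain ⟨m', gs', w'⟩ := C'
  dsimp only at *
  subst hanc
  obtain rfl : w = w' := DFunLike.coe_injective
    (funCode_injective (by simpa using ho) hw h5)
  have : gs = gs' := by
    refine List.ext_getElem? fun i => ?_
    by_cases hi : i < q
    · exact Option.map_injective (gateCode_injective hw) (congrFun h4 ⟨i, hi⟩)
    · rw [List.getElem?_eq_none (by omega), List.getElem?_eq_none (by omega)]
  rw [this]

/-- A circuit has at most `q` gates, each described by a function on `q + 1` points, hence `(q + 1)
^ O(q ^ 2)` codes; `exp (q ^ 4)` is a generous bound. -/
lemma card_forgerCode_le {q : ℕ} (hq : 64 ≤ q) :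
    (Fintype.card (ForgerCode q) : ℝ) ≤ Real.exp ((q : ℝ) ^ 4) := by
  have h1 : Fintype.card (ForgerCode q) ≤ (q + 1) ^ (q ^ 2 + 10 * q + 4) := by
    simp only [Fintype.card_prod, Fintype.card_fun, Fintype.card_fin, Fintype.card_option,
      Fintype.card_bool]
    have h2 : 5 * (2 * ((q + 1) * ((q + 1) * (q + 1) ^ (q + 1)))) + 1 ≤ (q + 1) ^ (q + 5) := by
      have e : (q + 1) ^ (q + 5) = (q + 1) ^ 2 * ((q + 1) * ((q + 1) * (q + 1) ^ (q + 1))) := by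
        ring
      have h3 : 1 ≤ (q + 1) * ((q + 1) * (q + 1) ^ (q + 1)) := Nat.one_le_iff_ne_zero.2 (by positivity)
      have h4 : 11 ≤ (q + 1) ^ 2 := by nlinarith
      rw [e]
      nlinarith
    calc _ ≤ (q + 1) * ((q + 1) * ((q + 1) * (((q + 1) ^ (q + 5)) ^ q * (q + 1) ^ (q + 1)))) := by
          gcongr
      _ = (q + 1) ^ (q ^ 2 + 6 * q + 4) := by
          rw [← pow_mul]; ring
      _ ≤ _ := Nat.pow_le_pow_right (by omega) (by omega)
  have hq' : (64 : ℝ) ≤ q := by exact_mod_cast hq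
  have h5 : ((q : ℝ) + 1) ≤ Real.exp q := Real.add_one_le_exp _
  calc (Fintype.card (ForgerCode q) : ℝ) ≤ ((q : ℝ) + 1) ^ (q ^ 2 + 10 * q + 4) := by
        exact_mod_cast h1
    _ ≤ Real.exp q ^ (q ^ 2 + 10 * q + 4) := by gcongr
    _ = Real.exp ((q ^ 2 + 10 * q + 4) * q) := by
        rw [← Real.exp_nat_mul]; push_cast; rfl
    _ ≤ Real.exp ((q : ℝ) ^ 4) := by
        refine Real.exp_le_exp.2 ?_
        have : (q : ℝ) ^ 2 + 10 * q + 4 ≤ q ^ 3 := by nlinarith [sq_nonneg ((q : ℝ))]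
        calc _ ≤ (q : ℝ) ^ 3 * q := by gcongr
          _ = _ := by ring

end

section

variable {d k r : ℕ}

/-! ## Numerical estimates -/

lemma card_bits (m : ℕ) : (Fintype.card (Fin (m * d) → Bool) : ℝ) = ((2 : ℝ) ^ d) ^ m := by
  simp only [Fintype.card_fun, Fintype.card_fin, Fintype.card_bool]
  push_cast
  rw [← pow_mul, mul_comm]

lemma two_pow_ge (hd : 6 ≤ d) : (64 : ℝ) ≤ 2 ^ d :=
  le_trans (by norm_num) (pow_le_pow_right₀ (by norm_num : (1 : ℝ) ≤ 2) hd)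

lemma sqrt_inv_pow_eight {q : ℝ} (hq : 0 < q) : √(1 / q ^ 8) = 1 / q ^ 4 := by
  rw [show (1 : ℝ) / q ^ 8 = (1 / q ^ 4) ^ 2 by rw [div_pow, one_pow, ← pow_mul]]
  exact Real.sqrt_sq (by positivity)

lemma hybridError_le {q : ℝ} (hq : 0 < q) (C : Forger d k r) (hk : ((k + r : ℕ) : ℝ) ≤ q)
    (hT : (C.gates.length : ℝ) ≤ q) : hybridError C (1 / q ^ 8) ≤ 4 / q ^ 2 := by
  rw [hybridError, sqrt_inv_pow_eight hq]
  calc 4 * ((k + r : ℕ) : ℝ) * C.gates.length * (1 / q ^ 4) ≤ 4 * q * q * (1 / q ^ 4) := by gcongr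
    _ = 4 / q ^ 2 := by field_simp

lemma keepError_le (hd : 6 ≤ d) (hk : (k : ℝ) ≤ 2 ^ d) :
    keepError (Fin (12 * d)) k ≤ 2 / ((2 : ℝ) ^ d) ^ 5 := by
  have hq := two_pow_ge hd
  set q : ℝ := 2 ^ d with hqd
  have hdim : dim (Fin (12 * d)) = q ^ 12 := by rw [dim, card_bits]
  rw [keepError, hdim, div_eq_mul_one_div 2 (q ^ 5)]
  refine mul_le_mul_of_nonneg_left (Real.sqrt_le_iff.2 ⟨by positivity, ?_⟩) (by norm_num)
  rw [div_pow, one_pow, ← pow_mul q 5 2, div_le_div_iff₀ (by positivity) (by positivity)]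
  calc ((k : ℝ) + 1) * q ^ (5 * 2) ≤ q ^ 2 * q ^ (5 * 2) := by gcongr; nlinarith
    _ = 1 * q ^ 12 := by ring

/-- `(1 + x) ^ T ≤ exp (T * x)` with `T * x ≤ 4 / q ^ 4`, and `exp y ≤ 1 + 2 * y` for `0 ≤ y ≤ 1`.
-/
lemma keepError_pow_le (hd : 6 ≤ d) (hk : (k : ℝ) ≤ 2 ^ d) {T : ℕ} (hT : (T : ℝ) ≤ 2 ^ d) :
    (1 + 2 * keepError (Fin (12 * d)) k) ^ T - 1 ≤ 8 / ((2 : ℝ) ^ d) ^ 4 := by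
  have hq := two_pow_ge hd
  have hke := keepError_le hd hk
  have h0 := keepError_nonneg (κ := Fin (12 * d)) k
  set q : ℝ := 2 ^ d with hqd
  have hx : T * (2 * keepError (Fin (12 * d)) k) ≤ 4 / q ^ 4 := by
    calc (T : ℝ) * (2 * keepError (Fin (12 * d)) k) ≤ q * (2 * (2 / q ^ 5)) := by gcongr
      _ = 4 / q ^ 4 := by field_simp; norm_num
  have h4 : 4 / q ^ 4 ≤ 1 := by
    rw [div_le_one (by positivity)]
    calc (4 : ℝ) ≤ q := by linarith
      _ ≤ q ^ 4 := le_self_pow₀ (by linarith) (by norm_num)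
  have h40 : 0 ≤ 4 / q ^ 4 := by positivity
  have h5 : (1 + 2 * keepError (Fin (12 * d)) k) ^ T ≤ Real.exp (4 / q ^ 4) := by
    calc _ ≤ Real.exp (2 * keepError (Fin (12 * d)) k) ^ T := by
          gcongr
          linarith [Real.add_one_le_exp (2 * keepError (Fin (12 * d)) k)]
      _ = Real.exp (T * (2 * keepError (Fin (12 * d)) k)) := (Real.exp_nat_mul _ _).symm
      _ ≤ _ := Real.exp_le_exp.2 hx
  have h6 := (abs_le.1 (Real.abs_exp_sub_one_sub_id_le
    (by rwa [abs_of_nonneg h40] : |4 / q ^ 4| ≤ 1))).2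
  have h7 : (4 / q ^ 4) ^ 2 ≤ 4 / q ^ 4 := by nlinarith
  have h8 : 8 / q ^ 4 = 4 / q ^ 4 + 4 / q ^ 4 := by ring
  linarith

/-- Beyond `k`, the monogamy term contributes at most `49 / q ^ 3`, the Fourier error `24 / q ^ 3`,
tags already in use `1 / q ^ 3`, and the hybrid error `4 / q ^ 2`. -/
lemma countBound_le (hd : 6 ≤ d) (C : Forger d k r) (hk : ((k + r : ℕ) : ℝ) ≤ 2 ^ d)
    (hT : (C.gates.length : ℝ) ≤ 2 ^ d) :
    countBound C (8 / ((2 : ℝ) ^ d) ^ 4) ≤ k + 2 / 2 ^ d := by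
  have hk' : (k : ℝ) ≤ 2 ^ d := le_trans (by push_cast; linarith [Nat.cast_nonneg (α := ℝ) r]) hk
  have hke := keepError_le hd hk'
  have h0 := keepError_nonneg (κ := Fin (12 * d)) k
  have hy := hybridError_le (q := 2 ^ d) (by positivity) C hk hT
  have hq := two_pow_ge hd
  rw [countBound, card_bits, card_bits, dim, card_bits]
  set q : ℝ := 2 ^ d with hqd
  have hq0 : 0 < q := by linarith
  have i1 : ((k + r : ℕ) : ℝ) / q ^ 12 ≤ 1 / q ^ 4 := by
    rw [div_le_div_iff₀ (by positivity) (by positivity)]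
    calc ((k + r : ℕ) : ℝ) * q ^ 4 ≤ q * q ^ 4 := by gcongr
      _ = 1 * q ^ 5 := by ring
      _ ≤ 1 * q ^ 12 := by gcongr <;> linarith
  have i2 : (1 : ℝ) / q ^ 4 ≤ 1 := by
    rw [div_le_one (by positivity)]; exact one_le_pow₀ (by linarith)
  have i20 : 0 ≤ (1 : ℝ) / q ^ 4 := by positivity
  have t1 : (k : ℝ) * (1 + (k + r : ℕ) / q ^ 12) * (1 + 3 * (8 / q ^ 4)) ≤ k + 49 / q ^ 3 := by
    calc (k : ℝ) * (1 + (k + r : ℕ) / q ^ 12) * (1 + 3 * (8 / q ^ 4)) ≤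
          k * (1 + 1 / q ^ 4) * (1 + 24 * (1 / q ^ 4)) := by
          rw [show 3 * (8 / q ^ 4) = 24 * (1 / q ^ 4) by ring]
          gcongr
      _ = k + k * (25 * (1 / q ^ 4) + 24 * (1 / q ^ 4 * (1 / q ^ 4))) := by ring
      _ ≤ k + q * (25 * (1 / q ^ 4) + 24 * (1 / q ^ 4 * 1)) := by gcongr
      _ = k + 49 / q ^ 3 := by field_simp; ring
  have t2 : 2 * ((k + r : ℕ) : ℝ) * (2 * keepError (Fin (12 * d)) k + 8 / q ^ 4) ≤ 24 / q ^ 3 := by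
    have : 2 / q ^ 5 ≤ 2 / q ^ 4 := by gcongr <;> linarith
    calc 2 * ((k + r : ℕ) : ℝ) * (2 * keepError (Fin (12 * d)) k + 8 / q ^ 4) ≤
          2 * q * (2 * (2 / q ^ 4) + 8 / q ^ 4) := by gcongr; exact hke.trans this
      _ = 24 / q ^ 3 := by field_simp; ring
  have t3 : ((k + r : ℕ) : ℝ) * (q ^ 8 / q ^ 12) ≤ 1 / q ^ 3 := by
    calc ((k + r : ℕ) : ℝ) * (q ^ 8 / q ^ 12) ≤ q * (q ^ 8 / q ^ 12) := by gcongr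
      _ = 1 / q ^ 3 := by field_simp
  have t4 : 74 / q ^ 3 + 4 / q ^ 2 ≤ 2 / q := by
    rw [div_add_div _ _ (by positivity) (by positivity), div_le_div_iff₀ (by positivity) hq0]
    have : 74 + 4 * q ≤ 2 * q ^ 2 := by nlinarith
    calc (74 * q ^ 2 + q ^ 3 * 4) * q = (74 + 4 * q) * q ^ 3 := by ring
      _ ≤ (2 * q ^ 2) * q ^ 3 := by gcongr
      _ = _ := by ring
  have t5 : 74 / q ^ 3 = 49 / q ^ 3 + 24 / q ^ 3 + 1 / q ^ 3 := by ring
  linarith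

/-- The event that some small circuit forges banknotes of level `d`. -/
def Forgeable (d : ℕ) (D : World) : Prop :=
  6 ≤ d ∧ ∃ C ∈ {C : AnyForger d | C.2.2.size ≤ 2 ^ d}, (C.1 : ℝ) + 4 / 2 ^ d <
    𝔼 z, forgedCount (oracleOf D) C.2.2 (publicOf (D d) z) (phaseOf (D d) (publicOf (D d) z))

lemma expect_indicator_forger_le (hd : 6 ≤ d) (D : World) (C : Forger d k r)
    (hC : C.size ≤ 2 ^ d) :
    𝔼 L : LevelData d, (open Classical in if (k : ℝ) + 4 / 2 ^ d <
        𝔼 z, forgedCount (oracleAt D L) C (publicOf L z) (phaseOf L (publicOf L z))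
      then (1 : ℝ) else 0) ≤ Real.exp (-((2 : ℝ) ^ d) ^ 8 / 16) := by
  have hkr : ((k + r : ℕ) : ℝ) ≤ 2 ^ d := by exact_mod_cast (add_le_size (by omega) C).trans hC
  have hT : (C.gates.length : ℝ) ≤ 2 ^ d := by
    have := card_forgerWires_le C
    exact_mod_cast (by omega : C.gates.length ≤ C.size).trans hC
  have hk : (k : ℝ) ≤ 2 ^ d := le_trans (by push_cast; linarith [Nat.cast_nonneg (α := ℝ) r]) hkr
  have hcb := countBound_le hd C hkr hT
  have hη := keepError_pow_le hd hk hT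
  have hy := hybridError_le (q := 2 ^ d) (by positivity) C hkr hT
  have hq := two_pow_ge hd
  have hrow : (Fintype.card (Row d) : ℝ) = ((2 : ℝ) ^ d) ^ 12 := card_bits 12
  have hcol : (Fintype.card (Column d) : ℝ) = ((2 : ℝ) ^ d) ^ 8 := card_bits 8
  set q : ℝ := 2 ^ d with hqd
  have hq0 : 0 < q := by linarith
  have hη1 : 8 / q ^ 4 ≤ 1 := by
    rw [div_le_one (by positivity)]
    calc (8 : ℝ) ≤ q := by linarith
      _ ≤ q ^ 4 := le_self_pow₀ (by linarith) (by norm_num)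
  have h2q : 2 / q ≤ 1 := by rw [div_le_one hq0]; linarith
  -- The allowance `4 / q` is spent as `2 / q` on the mean, `1 / q` on the deviation `ε` and `1 / q`
  -- on the blanking error. With `t * M = 1 / (4 * q ^ 2)` and `t * ε = 1 / (8 * q ^ 4)`, the
  -- exponent is `q ^ 12 * (1 / 16 - 1 / 8) / q ^ 4 = -q ^ 8 / 16`.
  have h := expect_indicator_forgedCount_le D C (ε := 1 / q) (t := 1 / (8 * q ^ 3)) (M := 2 * q)
    (μ := k + 2 / q) hη hη1 (by positivity) hcb (by linarith) (by linarith) (by positivity)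
    (by
      rw [div_mul_eq_mul_div, div_le_one (by positivity)]
      nlinarith [pow_pos hq0 2])
  rw [hrow, hcol] at h
  refine le_trans (expect_le_expect fun L => ?_) (h.trans_eq ?_)
  · have h4 : 4 / q ^ 2 ≤ 1 / q := by
      rw [div_le_div_iff₀ (by positivity) hq0]; nlinarith
    have h5 : 4 / q = 2 / q + 1 / q + 1 / q := by ring
    split_ifs with h1 h2
    · rfl
    · exact absurd (lt_of_le_of_lt (by linarith) h1) h2
    · simp
    · rfl
  · congr 1
    field_simp
    ring

lemma expect_indicator_forgeable_le (d : ℕ) (D : World) :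
    𝔼 L, (open Classical in if Forgeable d (Function.update D d L) then (1 : ℝ) else 0) ≤
      (1 / 2) ^ (d + 2) := by
  classical
  by_cases hd : 6 ≤ d
  swap
  · have : ∀ L, ¬ Forgeable d (Function.update D d L) := fun L h => hd h.1
    simp only [this, if_false, Finset.expect_const_zero]
    positivity
  have h1 := expect_indicator_exists_le (Ω := LevelData d) (forgerCode (d := d) (2 ^ d))
    (forgerCode_injOn (by omega) (2 ^ d))
    (fun C L => (C.1 : ℝ) + 4 / 2 ^ d < 𝔼 z, forgedCount (oracleAt D L) C.2.2 (publicOf L z)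
      (phaseOf L (publicOf L z))) (Real.exp_pos _).le
    fun C hC => expect_indicator_forger_le hd D C.2.2 hC
  have h2 : ∀ L, Forgeable d (Function.update D d L) ↔
      ∃ C ∈ {C : AnyForger d | C.2.2.size ≤ 2 ^ d}, (C.1 : ℝ) + 4 / 2 ^ d <
        𝔼 z, forgedCount (oracleAt D L) C.2.2 (publicOf L z) (phaseOf L (publicOf L z)) := by
    intro L
    simp only [Forgeable, hd, true_and, Function.update_self]
    rfl
  simp only [h2]
  have hq := two_pow_ge hd
  have hq64 : 64 ≤ 2 ^ d := by exact_mod_cast hq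
  have h3 := card_forgerCode_le hq64
  refine le_trans (le_of_eq ?_) (h1.trans ((mul_le_mul_of_nonneg_right h3
    (Real.exp_pos _).le).trans ?_))
  · refine Finset.expect_congr rfl fun L _ => ?_
    congr
  · push_cast
    rw [← Real.exp_add]
    have hdq : ((d + 2 : ℕ) : ℝ) ≤ 2 ^ d := by
      have : ∀ m, 6 ≤ m → m + 2 ≤ 2 ^ m := by
        intro m hm
        induction m, hm using Nat.le_induction with
        | base => norm_num
        | succ m hm ih => rw [pow_succ]; omega
      exact_mod_cast this d hd
    set q : ℝ := 2 ^ d with hqd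
    -- Then `q ^ 4 - q ^ 8 / 16 ≤ -q ^ 4 ≤ -q ≤ -(d + 2)`.
    have h16 : 32 * q ^ 4 ≤ q ^ 8 := by
      have : 32 ≤ q ^ 4 := (by linarith : 32 ≤ q).trans (le_self_pow₀ (by linarith) (by norm_num))
      calc 32 * q ^ 4 ≤ q ^ 4 * q ^ 4 := by gcongr
        _ = q ^ 8 := by ring
    have hq4 : q ≤ q ^ 4 := le_self_pow₀ (by linarith) (by norm_num)
    calc Real.exp (q ^ 4 + -q ^ 8 / 16) ≤ Real.exp (-((d + 2 : ℕ) : ℝ)) := by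
          refine Real.exp_le_exp.2 ?_
          linarith
      _ = (Real.exp (-1)) ^ (d + 2) := by rw [← Real.exp_nat_mul]; ring_nf
      _ ≤ (1 / 2) ^ (d + 2) := by
          have h5 : Real.exp (-1) ≤ 1 / 2 := by
            rw [Real.exp_neg, one_div]
            gcongr
            linarith [Real.add_one_le_exp (1 : ℝ)]
          have := Real.exp_pos (-1)
          gcongr

/-- A circuit of size at most `2 ^ d` may query other levels, also higher ones, but none beyond its
number of wires. -/
lemma forgeable_congr (d : ℕ) : ∃ N, ∀ D D' : World, (∀ i ≤ N, D i = D' i) →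
    Forgeable d D → Forgeable d D' := by
  refine ⟨2 ^ d, fun D D' h hD => ?_⟩
  obtain ⟨hd, C, hC, hlt⟩ := hD
  refine ⟨hd, C, hC, ?_⟩
  have hC' : C.2.2.size ≤ 2 ^ d := hC
  have hw := card_forgerWires_le C.2.2
  have h1 : ∀ e f, forgedCount (oracleOf D) C.2.2 e f = forgedCount (oracleOf D') C.2.2 e f := by
    intro e f
    rw [forgedCount, forgedCount, forgedState, forgedState,
      runGates_congr _ fun i hi => h i (by omega)]
  rw [← h d Nat.lt_two_pow_self.le]
  simpa only [h1] using hlt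

/-- There is a world in which no small circuit forges banknotes. -/
theorem exists_unforgeable : ∃ D : World, ∀ d, ¬ Forgeable d D := by
  refine exists_forall_not Forgeable (p := fun d => (1 / 2) ^ (d + 2)) (fun n => ?_)
    expect_indicator_forgeable_le forgeable_congr
  -- The total failure probability is at most `1 / 4 * 2 = 1 / 2`.
  have h := summable_geometric_two.sum_le_tsum (range n) fun d _ => by positivity
  rw [tsum_geometric_two] at h
  simp only [pow_add, ← Finset.sum_mul]
  linarith

lemma tendsto_div_atTop : Filter.Tendsto (fun n : ℕ => n / 28) Filter.atTop Filter.atTop :=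
  Nat.tendsto_div_const_atTop (by norm_num)

lemma negligible_four_div : Negligible fun n => 4 / 2 ^ (n / 28) := by
  intro m
  -- With `j = n / 28 + 1` one has `n ≤ 28 * j` and `4 / 2 ^ (j - 1) = 8 / 2 ^ j`, whence the
  -- constant `28 ^ m * 8`.
  have h0 := (tendsto_pow_const_mul_const_pow_of_abs_lt_one m
    (by norm_num [abs_of_pos] : |(1 / 2 : ℝ)| < 1)).const_mul (28 ^ m * 8)
  rw [mul_zero] at h0
  have h1 := (h0.comp (Filter.tendsto_add_atTop_nat 1)).comp tendsto_div_atTop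
  refine squeeze_zero (fun n => by positivity) (fun n => ?_) h1
  have h2 : (n : ℝ) ≤ 28 * ((n / 28 + 1 : ℕ) : ℝ) := by exact_mod_cast (by omega)
  calc (n : ℝ) ^ m * (4 / 2 ^ (n / 28)) ≤
        (28 * ((n / 28 + 1 : ℕ) : ℝ)) ^ m * (4 / 2 ^ (n / 28)) := by gcongr
    _ = _ := by
      simp only [Function.comp_apply, mul_pow, one_div, inv_pow, pow_succ]
      field_simp
      ring

lemma PolyBounded.eventually_le_two_pow {f : ℕ → ℕ} (hf : PolyBounded f) :
    ∀ᶠ n in Filter.atTop, f n ≤ 2 ^ (n / 28) := by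
  obtain ⟨p, hp⟩ := hf
  -- `p.eval 1` is the sum of the coefficients, each multiplied by a power of `n` that is at most `n
  -- ^ p.natDegree`.
  have h1 : ∀ n : ℕ, 1 ≤ n → f n ≤ p.eval 1 * n ^ p.natDegree := by
    intro n hn
    refine (hp n).trans ?_
    rw [Polynomial.eval_eq_sum_range, Polynomial.eval_eq_sum_range, Finset.sum_mul]
    refine Finset.sum_le_sum fun i hi => ?_
    rw [one_pow, mul_one]
    exact Nat.mul_le_mul_left _ (Nat.pow_le_pow_right hn (Nat.lt_succ_iff.1 (mem_range.1 hi)))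
  have h2 := (negligible_four_div p.natDegree).eventually_lt_const
    (by positivity : (0 : ℝ) < 4 / (p.eval 1 + 1 : ℕ))
  filter_upwards [h2, Filter.eventually_ge_atTop 1] with n hn hn1
  rw [← mul_div_assoc, div_lt_div_iff₀ (by positivity) (by positivity)] at hn
  have h3 : ((n ^ p.natDegree * (p.eval 1 + 1) : ℕ) : ℝ) < ((2 ^ (n / 28) : ℕ) : ℝ) := by
    push_cast at hn ⊢
    linarith
  have h4 : n ^ p.natDegree * (p.eval 1 + 1) < 2 ^ (n / 28) := by exact_mod_cast h3
  have := h1 n hn1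
  rw [mul_add, mul_comm] at h4
  omega

/-- For large `n` a polynomial-size counterfeiter has size at most `2 ^ (n / 28)`, so if it gained
more than the allowed error it would witness `Forgeable (n / 28) D`. -/
theorem moneyScheme_sound {D : World} (hD : ∀ d, ¬ Forgeable d D) :
    (moneyScheme D).HasPublicKeySoundnessError fun n => 4 / 2 ^ (n / 28) := by
  intro k r _ _ C hC
  filter_upwards [hC.eventually_le_two_pow, tendsto_div_atTop.eventually_ge_atTop 6] with n hn hn6
  rw [sum_passProb]
  by_contra! hlt
  exact hD (n / 28) ⟨hn6, ⟨k n, r n, C n⟩, hn, hlt⟩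

end

end QuantumMoney

end

theorem theorem6 :
    ∃ (U : QuantumMoney.QuantumOracle) (M : QuantumMoney.MoneyScheme U),
      M.HasCompletenessError 0 ∧
        ∃ δ : ℕ → ℝ, QuantumMoney.Negligible δ ∧ M.HasPublicKeySoundnessError δ := by
  obtain ⟨D, hD⟩ := QuantumMoney.exists_unforgeable
  exact ⟨QuantumMoney.oracleOf D, QuantumMoney.moneyScheme D, QuantumMoney.moneyScheme_complete D,
    _, QuantumMoney.negligible_four_div, QuantumMoney.moneyScheme_sound hD⟩
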